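/- **Setting.** An ordered ZDD $G$ over $\{1,\dots,c\}$ is a finite rooted acyclic digraph with branching nodes and terminals $\bot,\top$, all nodes reachable from the root. Each branching node $v$ has a label $\ell(v)\in\{1,\dots,c\}$, a $0$-edge and a $1$-edge to nodes $\mathrm{zero}(v)$, $\mathrm{one}(v)$, and labels strictly increase along edges between branching nodes. The root is a branching node. Let $n$ be the number of nodes of $G$ (terminals included) and $b$ the number of its branching nodes. **The top ZDD of $G$.** 1. *Spanning tree.* Let $T$ be the depth-first spanning tree of the branching nodes ($0$-edges explored before $1$-edges, terminals omitted). A branching node is identified with its preorder in $T$, a number in $\{1,\dots,b\}$; $\bot,\top$ are denoted by $b+1,b+2$. The edges of $G$ not in $T$ are called complement edges. 2. *Top tree.* $T$ is converted into a top tree $\mathcal T$. Its leaves are the clusters consisting of a single edge of $T$ and its internal vertices are vertical or horizontal merges of two clusters. It is built greedily, in rounds, until one cluster is left. In a round the current clusters are regarded as the edges of a contracted tree. Two sibling edges are merged horizontally if at least one of them ends in a leaf. On every maximal path of $p\ge 2$ edges whose inner nodes have one child, consecutive edges are paired and each pair is merged vertically: for odd $p$ the topmost edge stays alone; for even $p$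 all edges are paired, except that the two topmost edges are not merged with each other if the topmost one takes part in a horizontal merge of this round. If $b=1$, $\mathcal T$ is empty. 3. *Complement edges.* A complement edge from $u$ to a terminal is assigned to the leaf of $\mathcal T$ for the tree edge towards $u$. A complement edge from $u$ to a branching node $v$ is assigned to the lowest common ancestor in $\mathcal T$ of the leaves for the tree edges towards $u$ and $v$. Complement edges leaving the root of $G$ are assigned to the root. The information recorded is the pair of local preorders of the endpoints inside the cluster (for a terminal, its code), the edge label $0/1$, and the label difference or the terminal. 4. *Top DAG.* Two clusters are identified if their subtrees of $\mathcal T$ agree in structure, merge labels ($\mathrm V$, $\mathrm H_L$, $\mathrm H_R$), edge labels and label differences at the leaves, and the information on all assigned complement edges. Complement edges assigned to clusters that occur only once are moved to the root. 5. *Unfolding.* The top DAG is unfolded into a tree $T'$ by replacing every visit after the first (in preorder) to a vertex by a dummy leaf. 6. *Components.* The top ZDD consists of the following arrays and bit sequences: - the numbers $b$ and $\ell(\text{root})$; - the balanced parentheses sequence of $T'$; - the bitvector marking the dummies among the leaves of $T'$; - the cumulative sums of the cluster sizes of the dummies, and for each dummy the preorder in $T'$ of the vertex it points to; - for each non-dummy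 leaf, the label difference and the type $0/1$ of its edge; - the bitvector telling for each internal vertex of $T'$ whether its merge is horizontal; - for each vertical merge in $T'$, the local preorder and the label difference of the bottom boundary node of the upper one of the two merged clusters, relative to that cluster's top boundary node; - for the complement edges in the root, sorted by starting point: the number of them leaving each node (in unary), their endpoints, their types; - for the other complement edges, grouped by vertices of $T'$ in preorder and sorted by starting point in each group: the number of them at each vertex of $T'$ (in unary), the local preorders of their starting points, the local preorders (or terminal codes) of their endpoints, their types. **Claim.** There are a representation of bitvectors and a representation of balanced parentheses sequences, each a function of the bit sequence alone that represents $m$ bits by $O(m+1)$ words of $O(\log(m+2))$ bits; fixed word-RAM programs for $\ell$, $\mathrm{zero}$ and $\mathrm{one}$; and absolute constants $a,K$, such that the following holds for every ordered ZDD $G$ as above and every word length $w\ge a\log(n+c)$ (all logarithms being $\lfloor\log_2\cdot\rfloor$). Suppose the memory holds the top ZDD of $G$, with its bitvectors and its balanced parentheses sequence in these representations and the other arrays stored plainly. Given the preorder of any branching node $x$, - the program for $\ell$ outputs $\ell(x)$ after at most $K\log n$ steps; - the programs for $\mathrm{zero}$ and $\mathrm{one}$ output $\mathrm{zero}(x)$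 and $\mathrm{one}(x)$ (as a preorder, or as the code of $\bot$ or $\top$) after at most $K\log^2 n$ steps. -/

import Mathlib

/-! # Top ZDDs and a word-RAM -/

/-- An ordered ZDD with set `V` of branching nodes and labels in `{1, …, c}`.  The terminals are
`Sum.inr false` (that is, `⊥`) and `Sum.inr true` (that is, `⊤`).  Every branching node is reachable
from the root.  (A ZDD whose root is a terminal has no branching node, hence nothing to query.) -/
structure ZDD (V : Type*) (c : ℕ) where
  root : V
  label : V → ℕ
  zero : V → V ⊕ Bool
  one : V → V ⊕ Bool
  one_le_label : ∀ v, 1 ≤ label v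
  label_le : ∀ v, label v ≤ c
  ordered_zero : ∀ v u, zero v = Sum.inl u → label v < label u
  ordered_one : ∀ v u, one v = Sum.inl u → label v < label u
  reachable : ∀ v, Relation.ReflTransGen
    (fun u u' => zero u = Sum.inl u' ∨ one u = Sum.inl u') root v

/-- Rooted ordered trees in which every node has at most two children, with edges labelled in `α`.
Spanning trees of ZDDs have this form, and merging clusters keeps it. -/
inductive EdgeTree (α : Type*) where
  | leaf : EdgeTree α
  | one : α → EdgeTree α → EdgeTree α
  | two : α → EdgeTree α → α → EdgeTree α → EdgeTree α

/-- Top trees.  A leaf is the cluster of a single edge `(u, v)`, which is the `0`-edge or the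
`1`-edge of `u` according to the Boolean.  In `vert l r` the cluster `l` is the upper one.
In `horiz b l r` the label `b` is `false` for `H_L` and `true` for `H_R`. -/
inductive TopTree (V : Type*) where
  | edge : V → V → Bool → TopTree V
  | vert : TopTree V → TopTree V → TopTree V
  | horiz : Bool → TopTree V → TopTree V → TopTree V

/-- The information stored for a complement edge `(u, v)` in a cluster: local preorder of `u`;
local preorder of `v`, or the code of a terminal `v`; whether it is a `1`-edge;
the difference of the levels of `v` and `u`, or the terminal `v`. -/
structure EdgeInfo where
  src : ℕ
  dst : ℕ
  bit : Bool
  info : ℕ ⊕ Bool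
deriving DecidableEq

/-- What is compared in order to decide whether two clusters (vertices of the top tree)
are identical. -/
inductive Shape where
  | edge : Bool → ℕ → List EdgeInfo → Shape
  | vert : Shape → Shape → List EdgeInfo → Shape
  | horiz : Bool → Shape → Shape → List EdgeInfo → Shape
deriving DecidableEq

/-- The tree into which a top DAG is unfolded: dummy leaves, proper leaves and internal vertices,
each carrying a datum in `α`. -/
inductive PTree (α : Type*) where
  | dummy : α → PTree α
  | leaf : α → PTree α
  | node : α → PTree α → PTree α → PTree α

/-! ## The greedy construction of the top tree -/

namespace EdgeTree

variable {V : Type*} {α : Type*}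

/-- The number of edges of the path that leads from the root downwards through nodes with
exactly one child. -/
def chain : EdgeTree α → ℕ
  | leaf => 0
  | one _ t => chain t + 1
  | two _ _ _ _ => 0

/- One round of the greedy algorithm.  The edges of the current tree are clusters; the edge
`(u, v)` has bottom boundary node `v` exactly if `v` is not a leaf.

* Horizontal step: two sibling edges are merged if one of them ends in a leaf.
* Vertical step: on every maximal path with `p ≥ 2` edges whose inner nodes have one child,
  the edges are paired.  If `p` is odd, the topmost edge stays alone.  If `p` is even, all
  edges are paired, except that the two topmost ones are not merged with each other if the
  topmost one takes part in a horizontal merge.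

`greedyEdge a t` treats an edge `a`, not merged horizontally, whose lower end carries `t`;
`p = chain t + 1` is the number of edges of its path.  `greedyBody t` treats the tree `t` if the edge
above its root is not available for a merge with an edge of `t`. -/
mutual

def greedyEdge : TopTree V → EdgeTree (TopTree V) → TopTree V × EdgeTree (TopTree V)
  | a, leaf => (a, leaf)
  | a, one b t =>
    if chain t % 2 = 1 then
      (a, one (greedyEdge b t).1 (greedyEdge b t).2)
    else
      (TopTree.vert a b, greedyBody t)
  | a, two b s d t => (a, greedyBody (two b s d t))

def greedyBody : EdgeTree (TopTree V) → EdgeTree (TopTree V)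
  | leaf => leaf
  | one a t => one (greedyEdge a t).1 (greedyEdge a t).2
  | two a leaf b leaf => one (TopTree.horiz false a b) leaf
  | two a leaf b t => one (TopTree.horiz true a b) (greedyBody t)
  | two a s b leaf => one (TopTree.horiz false a b) (greedyBody s)
  | two a s b t =>
    two (greedyEdge a s).1 (greedyEdge a s).2 (greedyEdge b t).1 (greedyEdge b t).2

end

/-- The cluster of a tree that has been contracted to a single edge. -/
def single : EdgeTree α → Option α
  | one a leaf => some a
  | _ => none

end EdgeTree

/-! ## Clusters -/

namespace TopTree

variable {V : Type*} [DecidableEq V]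

/-- The node set of a cluster. -/
def nodes : TopTree V → Finset V
  | edge u v _ => {u, v}
  | vert l r => nodes l ∪ nodes r
  | horiz _ l r => nodes l ∪ nodes r

/-- The lower ends of the edges of a cluster: the edge towards `v` lies in the
cluster `t` exactly if `v ∈ t.heads`. -/
def heads : TopTree V → Finset V
  | edge _ v _ => {v}
  | vert l r => heads l ∪ heads r
  | horiz _ l r => heads l ∪ heads r

/-- The top boundary node of a cluster. -/
def top : TopTree V → V
  | edge u _ _ => u
  | vert l _ => top l
  | horiz _ l _ => top l

/-- All vertices of the top tree. -/
def vertices : TopTree V → List (TopTree V)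
  | edge u v b => [edge u v b]
  | vert l r => vert l r :: (vertices l ++ vertices r)
  | horiz b l r => horiz b l r :: (vertices l ++ vertices r)

/-- The edges of the original tree in a cluster, as pairs (starting point, edge label). -/
def edges : TopTree V → List (V × Bool)
  | edge u _ b => [(u, b)]
  | vert l r => edges l ++ edges r
  | horiz _ l r => edges l ++ edges r

/-- Unfolding of the top DAG into a tree: in a preorder traversal, the first visit to a vertex of
the DAG (an element of the second argument is a DAG vertex already visited) is a proper vertex,
all later ones become dummy leaves. -/
def unfold (key : TopTree V → Shape) : TopTree V → List Shape → PTree (TopTree V) × List Shape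
  | edge u v b, seen =>
    if key (edge u v b) ∈ seen then (PTree.dummy (edge u v b), seen)
    else (PTree.leaf (edge u v b), key (edge u v b) :: seen)
  | vert l r, seen =>
    if key (vert l r) ∈ seen then (PTree.dummy (vert l r), seen)
    else
      let p := unfold key l (key (vert l r) :: seen)
      let q := unfold key r p.2
      (PTree.node (vert l r) p.1 q.1, q.2)
  | horiz b l r, seen =>
    if key (horiz b l r) ∈ seen then (PTree.dummy (horiz b l r), seen)
    else
      let p := unfold key l (key (horiz b l r) :: seen)
      let q := unfold key r p.2
      (PTree.node (horiz b l r) p.1 q.1, q.2)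

end TopTree

namespace PTree

variable {α : Type*}

/-- Balanced parentheses sequence; `true` is an opening parenthesis. -/
def bp : PTree α → List Bool
  | dummy _ => [true, false]
  | leaf _ => [true, false]
  | node _ l r => [true] ++ bp l ++ bp r ++ [false]

/-- All vertices in preorder; the Boolean tells whether the vertex is a dummy. -/
def vertices : PTree α → List (Bool × α)
  | dummy a => [(true, a)]
  | leaf a => [(false, a)]
  | node a l r => (false, a) :: (vertices l ++ vertices r)

/-- All leaves in preorder; the Boolean tells whether the leaf is a dummy. -/
def leaves : PTree α → List (Bool × α)
  | dummy a => [(true, a)]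
  | leaf a => [(false, a)]
  | node _ l r => leaves l ++ leaves r

/-- The internal vertices in preorder. -/
def internals : PTree α → List α
  | dummy _ => []
  | leaf _ => []
  | node a l r => a :: (internals l ++ internals r)

end PTree

/-- The components of a top ZDD.  Entry `i` of an array is stored at position `i - 1` of the list. -/
structure TopZDD where
  /-- number of branching nodes, and level of the root -/
  header : List ℕ
  bp : List Bool
  bDummy : List Bool
  clsize : List ℕ
  dstDummy : List ℕ
  labelSpan : List ℕ
  typeSpan : List Bool
  bH : List Bool
  preorderDiff : List ℕ
  labelDiff : List ℕ
  bSrcRoot : List Bool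
  dstRoot : List ℕ
  typeRoot : List Bool
  bEdge : List Bool
  srcIn : List ℕ
  dstIn : List ℕ
  typeIn : List Bool

/-- Unary code. -/
def unary (k : ℕ) : List Bool := List.replicate k true ++ [false]

/-! ## The top ZDD of a ZDD -/

namespace ZDD

variable {V : Type*} [Fintype V] [DecidableEq V] {c : ℕ} (G : ZDD V c)

/-- The node pointed to by the `0`-edge (`false`) or the `1`-edge (`true`). -/
def child (b : Bool) (v : V) : V ⊕ Bool := if b then G.one v else G.zero v

/-- The number of nodes of the ZDD: the branching nodes and those terminals that occur. -/
def size : ℕ :=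
  Fintype.card V +
    (Finset.univ.filter fun τ : Bool => ∃ v, G.zero v = Sum.inr τ ∨ G.one v = Sum.inr τ).card

/-- Depth-first traversal below `u`, with `0`-edges before `1`-edges.  The list holds the nodes
visited so far in order of their visits.  The first argument bounds the depth. -/
def dfs : ℕ → V → List V → EdgeTree (TopTree V) × List V
  | 0, _, vis => (EdgeTree.leaf, vis)
  | k + 1, u, vis =>
    let explore (b : Bool) (vis : List V) : Option (TopTree V × EdgeTree (TopTree V)) × List V :=
      match G.child b u with
      | Sum.inr _ => (none, vis)
      | Sum.inl v =>
        if v ∈ vis then (none, vis)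
        else (some (TopTree.edge u v b, (dfs k v vis).1), (dfs k v vis).2)
    let r₀ := explore false (vis ++ [u])
    let r₁ := explore true r₀.2
    match r₀.1, r₁.1 with
    | none, none => (EdgeTree.leaf, r₁.2)
    | some (a, s), none => (EdgeTree.one a s, r₁.2)
    | none, some (b, t) => (EdgeTree.one b t, r₁.2)
    | some (a, s), some (b, t) => (EdgeTree.two a s b t, r₁.2)

/-- The spanning tree of the branching nodes, its edges being single-edge clusters. -/
def spanningTree : EdgeTree (TopTree V) := (G.dfs (Fintype.card V) G.root []).1

/-- The branching nodes in preorder of the spanning tree. -/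
def order : List V := (G.dfs (Fintype.card V) G.root []).2

/-- The preorder (from `1`) of a node in the spanning tree. -/
def pre (v : V) : ℕ := G.order.idxOf v + 1

/-- The numbers used for `⊥` and `⊤`. -/
def terminalCode (τ : Bool) : ℕ := if τ then Fintype.card V + 2 else Fintype.card V + 1

/-- The number by which a node is reported: preorder or terminal code. -/
def code : V ⊕ Bool → ℕ
  | Sum.inl v => G.pre v
  | Sum.inr τ => terminalCode (V := V) τ

/-- The greedy top tree of the spanning tree: rounds are performed until one edge is left.
Every round on a tree with two or more edges merges some of them, and a single edge is not changed,
so a number of rounds equal to the number of nodes is enough.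
If there is only one branching node, there is no edge and the top tree is empty (`none`). -/
def topTree : Option (TopTree V) :=
  (EdgeTree.greedyBody^[Fintype.card V] G.spanningTree).single

/-- The vertices of the top tree. -/
def clusters : List (TopTree V) := G.topTree.elim [] TopTree.vertices

/-- The edges of the spanning tree. -/
def treeEdges : List (V × Bool) := G.topTree.elim [] TopTree.edges

/-- The complement edges `(u, b)` (the `b`-edge of `u`), in preorder of their starting points. -/
def complementEdges : List (V × Bool) :=
  (G.order.flatMap fun u => [(u, false), (u, true)]).filter fun e => e ∉ G.treeEdges

/-- The local preorder (from `1`) of a node in a cluster.  As a cluster is a connected subtree,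
its preorder is the restriction of the preorder of the whole tree. -/
def localPre (t : TopTree V) (v : V) : ℕ := (t.nodes.filter fun y => G.pre y ≤ G.pre v).card

/-- The complement edges assigned to a vertex of the top tree, sorted by starting point.
An edge from `u` to a terminal belongs to the leaf for the tree edge towards `u`;
an edge from `u` to a branching node `v` belongs to the lowest common ancestor of the
leaves for the tree edges towards `u` and `v`.  (There is no tree edge towards the root;
the complement edges leaving the root of the ZDD belong to the root of the top tree,
see `rootEdges`.) -/
def assigned : TopTree V → List (V × Bool)
  | TopTree.edge _ v _ =>
    G.complementEdges.filter fun e => e.1 = v ∧ (G.child e.2 e.1).isRight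
  | TopTree.vert l r => G.complementEdges.filter fun e =>
    match G.child e.2 e.1 with
    | Sum.inl y => decide (e.1 ∈ l.heads ∧ y ∈ r.heads ∨ e.1 ∈ r.heads ∧ y ∈ l.heads)
    | Sum.inr _ => false
  | TopTree.horiz _ l r => G.complementEdges.filter fun e =>
    match G.child e.2 e.1 with
    | Sum.inl y => decide (e.1 ∈ l.heads ∧ y ∈ r.heads ∨ e.1 ∈ r.heads ∧ y ∈ l.heads)
    | Sum.inr _ => false

/-- The information stored in the cluster `t` for a complement edge. -/
def edgeInfo (t : TopTree V) (e : V × Bool) : EdgeInfo where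
  src := G.localPre t e.1
  dst := match G.child e.2 e.1 with
    | Sum.inl y => G.localPre t y
    | Sum.inr τ => terminalCode (V := V) τ
  bit := e.2
  info := match G.child e.2 e.1 with
    | Sum.inl y => Sum.inl (G.label y - G.label e.1)
    | Sum.inr τ => Sum.inr τ

/-- Clusters with equal keys are identified by the DAG compression: these are the vertices
of the top DAG. -/
def key : TopTree V → Shape
  | TopTree.edge u v b =>
    Shape.edge b (G.label v - G.label u)
      ((G.assigned (TopTree.edge u v b)).map (G.edgeInfo (TopTree.edge u v b)))
  | TopTree.vert l r =>
    Shape.vert (key l) (key r)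
      ((G.assigned (TopTree.vert l r)).map (G.edgeInfo (TopTree.vert l r)))
  | TopTree.horiz b l r =>
    Shape.horiz b (key l) (key r)
      ((G.assigned (TopTree.horiz b l r)).map (G.edgeInfo (TopTree.horiz b l r)))

/-- The cluster occurs at least twice in the top tree. -/
def shared (t : TopTree V) : Bool := 2 ≤ G.clusters.countP fun s => G.key s = G.key t

/-- The complement edges that are kept in the vertex of the top DAG given by `t`. -/
def innerEdges (t : TopTree V) : List (V × Bool) := if G.shared t then G.assigned t else []

/-- The complement edges that are kept in, or moved to, the root of the top DAG. -/
def rootEdges : List (V × Bool) :=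
  G.complementEdges.filter fun e => ¬ ∃ t ∈ G.clusters, e ∈ G.innerEdges t

/-- The tree `T'` into which the top DAG is unfolded. -/
def dagTree : Option (PTree (TopTree V)) :=
  G.topTree.map fun t => (t.unfold G.key []).1

def dagVertices : List (Bool × TopTree V) := G.dagTree.elim [] PTree.vertices

def dagLeaves : List (Bool × TopTree V) := G.dagTree.elim [] PTree.leaves

def dagInternals : List (TopTree V) := G.dagTree.elim [] PTree.internals

/-- The clusters represented by the dummy leaves of `T'`. -/
def dagDummies : List (TopTree V) := (G.dagLeaves.filter fun p => p.1).map Prod.snd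

/-- The preorder (from `1`) in `T'` of the proper vertex that stands for the cluster `t`. -/
def dagPre (t : TopTree V) : ℕ :=
  G.dagVertices.findIdx (fun p => !p.1 && decide (G.key p.2 = G.key t)) + 1

/-- The complement edges kept in vertices of `T'` other than the root, in the order of storage,
each with its cluster. -/
def storedEdges : List (TopTree V × (V × Bool)) :=
  G.dagVertices.flatMap fun p => if p.1 then [] else (G.innerEdges p.2).map fun e => (p.2, e)

/-- The top ZDD of a ZDD.  `preorderDiff` and `labelDiff` have one entry for each vertical merge,
which describes the bottom boundary node of the upper one of the two merged clusters (this is the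
top boundary node of the lower one) relatively to the top boundary node. -/
def topZDD : TopZDD where
  header := [Fintype.card V, G.label G.root]
  bp := G.dagTree.elim [] PTree.bp
  bDummy := G.dagLeaves.map Prod.fst
  clsize := (List.range G.dagDummies.length).map fun i =>
    ((G.dagDummies.take (i + 1)).map fun t => t.nodes.card).sum
  dstDummy := G.dagDummies.map G.dagPre
  labelSpan := G.dagLeaves.filterMap fun
    | (false, TopTree.edge u v _) => some (G.label v - G.label u)
    | _ => none
  typeSpan := G.dagLeaves.filterMap fun
    | (false, TopTree.edge _ _ b) => some b
    | _ => none
  bH := G.dagInternals.map fun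
    | TopTree.horiz _ _ _ => true
    | _ => false
  preorderDiff := G.dagInternals.filterMap fun
    | TopTree.vert l r => some (G.localPre l r.top)
    | _ => none
  labelDiff := G.dagInternals.filterMap fun
    | TopTree.vert l r => some (G.label r.top - G.label l.top)
    | _ => none
  bSrcRoot := G.order.flatMap fun u => unary (G.rootEdges.countP fun e => e.1 = u)
  dstRoot := G.rootEdges.map fun e => G.code (G.child e.2 e.1)
  typeRoot := G.rootEdges.map Prod.snd
  bEdge := G.dagVertices.flatMap fun p => unary (if p.1 then 0 else (G.innerEdges p.2).length)
  srcIn := G.storedEdges.map fun p => (G.edgeInfo p.1 p.2).src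
  dstIn := G.storedEdges.map fun p => (G.edgeInfo p.1 p.2).dst
  typeIn := G.storedEdges.map fun p => p.2.2

end ZDD

/-! ## Memory layout -/

/-- A representation of bit sequences in linear space: a sequence of `m` bits becomes `O(m + 1)`
words of `O(log (m + 2))` bits each. -/
def LinearSpace (enc : List Bool → List ℕ) : Prop :=
  ∃ C : ℕ, ∀ B : List Bool,
    (enc B).length ≤ C * (B.length + 1) ∧ ∀ z ∈ enc B, z ≤ C * (B.length + 1)

/-- Several arrays stored one after the other, preceded by a directory of their start addresses. -/
def layout (segs : List (List ℕ)) : List ℕ :=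
  ((List.range segs.length).map fun i => segs.length + ((segs.take i).map List.length).sum) ++
    segs.flatten

/-- A top ZDD in memory.  The representation `bvEnc` is used for the bitvectors and the
representation `bpEnc` for the balanced parentheses sequence. -/
def TopZDD.memory (bvEnc bpEnc : List Bool → List ℕ) (D : TopZDD) : List ℕ :=
  layout [D.header, bpEnc D.bp, bvEnc D.bDummy, D.clsize, D.dstDummy, D.labelSpan,
    D.typeSpan.map Bool.toNat, bvEnc D.bH, D.preorderDiff, D.labelDiff, bvEnc D.bSrcRoot,
    D.dstRoot, D.typeRoot.map Bool.toNat, bvEnc D.bEdge, D.srcIn, D.dstIn,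
    D.typeIn.map Bool.toNat]

/-! ## The word-RAM -/

namespace WordRAM

/-- Operations on words. -/
inductive Op where
  | add | sub | mul | div | and | or | xor | shl | shr | lt | eq

/-- Operations on words of length `w`. -/
def Op.eval (w : ℕ) : Op → ℕ → ℕ → ℕ
  | .add, a, b => (a + b) % 2 ^ w
  | .sub, a, b => (a + 2 ^ w - b) % 2 ^ w
  | .mul, a, b => (a * b) % 2 ^ w
  | .div, a, b => a / b
  | .and, a, b => a &&& b
  | .or, a, b => a ||| b
  | .xor, a, b => a ^^^ b
  | .shl, a, b => (a <<< b) % 2 ^ w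
  | .shr, a, b => a >>> b
  | .lt, a, b => if a < b then 1 else 0
  | .eq, a, b => if a = b then 1 else 0

/-- Programs.  Registers are named by natural numbers. -/
inductive Prog where
  | skip : Prog
  /-- `reg d := z` -/
  | const (d z : ℕ) : Prog
  /-- `reg d := o (reg a) (reg b)` -/
  | op (o : Op) (d a b : ℕ) : Prog
  /-- `reg d := mem (reg a)` -/
  | load (d a : ℕ) : Prog
  /-- `mem (reg a) := reg s` -/
  | store (a s : ℕ) : Prog
  | seq (p q : Prog) : Prog
  /-- `if reg r ≠ 0 then p else q` -/
  | ite (r : ℕ) (p q : Prog) : Prog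
  /-- `while reg r ≠ 0 do p` -/
  | loop (r : ℕ) (p : Prog) : Prog

structure State where
  reg : ℕ → ℕ
  mem : ℕ → ℕ

/-- `Runs w p s t s'`: with words of length `w`, the program `p` started in `s` halts in `s'` after
exactly `t` steps.  Every instruction and every test takes one step. -/
inductive Runs (w : ℕ) : Prog → State → ℕ → State → Prop where
  | skip (s : State) : Runs w Prog.skip s 1 s
  | const (s : State) (d z : ℕ) :
      Runs w (Prog.const d z) s 1 { s with reg := Function.update s.reg d (z % 2 ^ w) }
  | op (s : State) (o : Op) (d a b : ℕ) :
      Runs w (Prog.op o d a b) s 1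
        { s with reg := Function.update s.reg d (o.eval w (s.reg a) (s.reg b)) }
  | load (s : State) (d a : ℕ) :
      Runs w (Prog.load d a) s 1 { s with reg := Function.update s.reg d (s.mem (s.reg a)) }
  | store (s : State) (a r : ℕ) :
      Runs w (Prog.store a r) s 1 { s with mem := Function.update s.mem (s.reg a) (s.reg r) }
  | seq {p q : Prog} {s s' s'' : State} {t t' : ℕ} :
      Runs w p s t s' → Runs w q s' t' s'' → Runs w (Prog.seq p q) s (t + t') s''
  | ite_true {r : ℕ} {p q : Prog} {s s' : State} {t : ℕ} :
      s.reg r ≠ 0 → Runs w p s t s' → Runs w (Prog.ite r p q) s (t + 1) s'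
  | ite_false {r : ℕ} {p q : Prog} {s s' : State} {t : ℕ} :
      s.reg r = 0 → Runs w q s t s' → Runs w (Prog.ite r p q) s (t + 1) s'
  | loop_done {r : ℕ} {p : Prog} {s : State} :
      s.reg r = 0 → Runs w (Prog.loop r p) s 1 s
  | loop_step {r : ℕ} {p : Prog} {s s' s'' : State} {t t' : ℕ} :
      s.reg r ≠ 0 → Runs w p s t s' → Runs w (Prog.loop r p) s' t' s'' →
        Runs w (Prog.loop r p) s (t + t' + 1) s''

/-- The initial state: argument `x` in register `0`, data structure at the beginning of the memory,
everything else zero. -/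
def initial (w : ℕ) (data : List ℕ) (x : ℕ) : State where
  reg r := if r = 0 then x % 2 ^ w else 0
  mem i := data.getD i 0 % 2 ^ w

/-- On word length `w`, data structure `data` and argument `x`, the program `p` halts after at most
`T` steps with the value `y` in register `0`. -/
def Answers (w : ℕ) (p : Prog) (data : List ℕ) (x y T : ℕ) : Prop :=
  ∃ (t : ℕ) (s : State), Runs w p (initial w data x) t s ∧ t ≤ T ∧ s.reg 0 = y

end WordRAM

-- The representations need only be linear in words, so rank, select and tree navigation can be
-- tabulated. `bvEnc` stores the bit, the rank and the select value for every position. `bpEnc`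
-- stores the right child and two leaf counts for every vertex of the unfolded tree, which the
-- parentheses determine (`PTree.nodeTable_eq_of_bp`). Each elementary query then takes constant
-- time, and what remains is to bound how many of them are made.
--
-- A greedy round leaves at most 5/6 of the edges (`EdgeTree.six_mul_numEdges_greedy_le`) and raises
-- heights by at most one (`EdgeTree.heightLE_greedy`), so the top tree has logarithmic height
-- (`EdgeTree.exists_single`). A node is located by its local preorder in a cluster, and
-- `TopTree.descend` passes to a child cluster and the local preorder there. One proper vertex of
-- the unfolded tree stands for all clusters with the same key. Everything read at it (sizes,
-- position of the bottom boundary node, label differences, kept complement edges) is a function of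
-- the key, so a dummy can be replaced by the vertex it points to. Adding label differences on the
-- way to a leaf gives the label, with constant work per level (`IsDag.tot_step`, `IsDag.tot_walk`).
--
-- An edge leaving `x` is in the root, kept in another vertex, or a tree edge (`ZDD.mem_treeEdges`).
-- A kept edge has `x` among the heads of its cluster, and all such clusters lie on the path of the
-- descent (`TopTree.mem_vertices_descend`), so one binary search per level finds it. A tree edge is
-- reached by a second descent that resolves ties at boundary nodes in favour of the outgoing edge
-- (`TopTree.mem_edges_descend`). The end point is then known by a local preorder, and the shifts
-- pushed on a stack during the descent turn it into a global one (`TopTree.getElem?_shift`,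
-- `tot_unwind`).
--
-- Running times are read off the program text. The predicate `Tot` charges the syntactic bound
-- `cost L`, in which no loop makes more than `L` iterations, and `cost_le` bounds it by a constant
-- times `L` to the power of the loop depth. With `L` equal to five times the logarithm of the size,
-- loop depths 1 and 2 give the two bounds. Words of logarithmic length suffice because addresses
-- and entries are polynomially bounded (`ZDD.holds_initial`).

set_option linter.unusedSectionVars false

namespace WordRAM

/-! ## Structured programs with named variables -/

/-- Program variables; variable number `j` lives in register `j`, scratch registers start at `20`. -/
inductive Var where
  | inp | node | pos | acc | sp | run | lo | hi | mid | siz | bnd | right | found | out | base | cnt | dep | dif | cmp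
deriving DecidableEq

def Var.idx : Var → ℕ
  | .inp => 0 | .node => 1 | .pos => 2 | .acc => 3 | .sp => 4 | .run => 5 | .lo => 6 | .hi => 7
  | .mid => 8 | .siz => 9 | .bnd => 10 | .right => 11 | .found => 12 | .out => 13 | .base => 14
  | .cnt => 15 | .dep => 16 | .dif => 17 | .cmp => 18

theorem Var.idx_lt (x : Var) : x.idx < 20 := by cases x <;> decide

theorem Var.idx_inj {x y : Var} (h : x.idx = y.idx) : x = y := by
  cases x <;> cases y <;> first | rfl | (simp [Var.idx] at h)

/-- Values of the program variables together with the memory. -/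
structure Store where
  v : Var → ℕ
  m : ℕ → ℕ

def Store.set (σ : Store) (x : Var) (n : ℕ) : Store := { σ with v := Function.update σ.v x n }

@[simp] theorem Store.set_v (σ : Store) (x y : Var) (n : ℕ) :
    (σ.set x n).v y = if y = x then n else σ.v y := by
  simp [Store.set, Function.update_apply]

def Store.write (σ : Store) (a n : ℕ) : Store := { σ with m := Function.update σ.m a n }

@[simp] theorem Store.write_v (σ : Store) (a n : ℕ) : (σ.write a n).v = σ.v := rfl

def Agree (s : State) (σ : Store) : Prop := (∀ x : Var, s.reg x.idx = σ.v x) ∧ s.mem = σ.m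

/-- Expressions. -/
inductive Exp where
  | lit (n : ℕ)
  | var (x : Var)
  | bin (o : Op) (a b : Exp)
  | rd (a : Exp)

-- Expressions: values without overflow, and compilation

namespace Exp

instance : Add Exp := ⟨bin .add⟩
instance : Sub Exp := ⟨bin .sub⟩
instance : Mul Exp := ⟨bin .mul⟩
instance : Div Exp := ⟨bin .div⟩

def lt (a b : Exp) : Exp := bin .lt a b
def eq (a b : Exp) : Exp := bin .eq a b

/-- The result goes to register `d` and only registers from `d` on are used, so a left operand
survives in `d` while the right one is computed in `d + 1`. The `or` of a register with itself
serves as a copy instruction. -/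
def compile : Exp → ℕ → Prog
  | lit n, d => .const d n
  | var x, d => .op .or d x.idx x.idx
  | bin o a b, d => .seq (compile a d) (.seq (compile b (d + 1)) (.op o d d (d + 1)))
  | rd a, d => .seq (compile a d) (.load d d)

/-- The value computed on words of length `w`. -/
def ev (w : ℕ) (σ : Store) : Exp → ℕ
  | lit n => n % 2 ^ w
  | var x => σ.v x
  | bin o a b => o.eval w (ev w σ a) (ev w σ b)
  | rd a => σ.m (ev w σ a)

section ev

variable {w : ℕ} {σ : Store} {a b : Exp} {x y : ℕ}

theorem ev_lit (h : x < 2 ^ w) : ev w σ (lit x) = x := Nat.mod_eq_of_lt h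

theorem ev_var (z : Var) : ev w σ (var z) = σ.v z := rfl

theorem ev_rd (ha : ev w σ a = x) : ev w σ (rd a) = σ.m x := by rw [← ha]; rfl

theorem ev_add (ha : ev w σ a = x) (hb : ev w σ b = y) (h : x + y < 2 ^ w) :
    ev w σ (a + b) = x + y := by
  change (ev w σ a + ev w σ b) % 2 ^ w = _
  rw [ha, hb, Nat.mod_eq_of_lt h]

theorem ev_mul (ha : ev w σ a = x) (hb : ev w σ b = y) (h : x * y < 2 ^ w) :
    ev w σ (a * b) = x * y := by
  change (ev w σ a * ev w σ b) % 2 ^ w = _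
  rw [ha, hb, Nat.mod_eq_of_lt h]

theorem ev_div (ha : ev w σ a = x) (hb : ev w σ b = y) : ev w σ (a / b) = x / y := by
  change ev w σ a / ev w σ b = _
  rw [ha, hb]

theorem ev_sub (ha : ev w σ a = x) (hb : ev w σ b = y) (h : y ≤ x) (hx : x < 2 ^ w) :
    ev w σ (a - b) = x - y := by
  change (ev w σ a + 2 ^ w - ev w σ b) % 2 ^ w = _
  rw [ha, hb, show x + 2 ^ w - y = x - y + 2 ^ w by omega, Nat.add_mod_right,
    Nat.mod_eq_of_lt (by omega)]

/-- Subtraction below zero wraps around. -/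
theorem ev_neg (ha : ev w σ a = 0) (hb : ev w σ b = y) (h : 0 < y) :
    ev w σ (a - b) = 2 ^ w - y := by
  change (ev w σ a + 2 ^ w - ev w σ b) % 2 ^ w = _
  have := Nat.two_pow_pos w
  rw [ha, hb, Nat.zero_add, Nat.mod_eq_of_lt (by omega)]

theorem ev_lt (ha : ev w σ a = x) (hb : ev w σ b = y) :
    ev w σ (lt a b) = if x < y then 1 else 0 := by
  change (if ev w σ a < ev w σ b then 1 else 0) = _
  rw [ha, hb]

theorem ev_eq (ha : ev w σ a = x) (hb : ev w σ b = y) :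
    ev w σ (eq a b) = if x = y then 1 else 0 := by
  change (if ev w σ a = ev w σ b then 1 else 0) = _
  rw [ha, hb]

end ev

/-- The number of steps of the compiled expression. -/
def cost : Exp → ℕ
  | lit _ => 1
  | var _ => 1
  | bin _ a b => cost a + (cost b + 1)
  | rd a => cost a + 1

/-- The frame clause for registers below `d` makes the induction work: it protects the program
variables, which live below 20, and the left operand of a binary operation. -/
theorem compile_runs (w : ℕ) (σ : Store) (e : Exp) : ∀ (d : ℕ) (s : State), 20 ≤ d → Agree s σ →
    ∃ s', Runs w (e.compile d) s e.cost s' ∧ s'.reg d = e.ev w σ ∧ s'.mem = s.mem ∧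
      ∀ r < d, s'.reg r = s.reg r := by
  induction e with
  | lit n =>
    intro d s _ _
    exact ⟨_, Runs.const s d n, by simp [ev], rfl, fun r hr => by simp [hr.ne]⟩
  | var x =>
    intro d s _ h
    exact ⟨_, Runs.op s .or d _ _, by simp [ev, Op.eval, h.1 x], rfl, fun r hr => by simp [hr.ne]⟩
  | bin o a b iha ihb =>
    intro d s hd h
    obtain ⟨s₁, r₁, v₁, m₁, f₁⟩ := iha d s hd h
    have h₁ : Agree s₁ σ :=
      ⟨fun x => by rw [f₁ _ (x.idx_lt.trans_le hd), h.1 x], m₁.trans h.2⟩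
    obtain ⟨s₂, r₂, v₂, m₂, f₂⟩ := ihb (d + 1) s₁ (by omega) h₁
    refine ⟨_, r₁.seq (r₂.seq (Runs.op s₂ o d d (d + 1))), ?_, m₂.trans m₁, fun r hr => ?_⟩
    · simp [ev, f₂ d (by omega), v₁, v₂]
    · simp [hr.ne, f₂ r (by omega), f₁ r hr]
  | rd a iha =>
    intro d s hd h
    obtain ⟨s₁, r₁, v₁, m₁, f₁⟩ := iha d s hd h
    refine ⟨_, r₁.seq (Runs.load s₁ d d), ?_, m₁, fun r hr => ?_⟩
    · simp [ev, v₁, m₁, h.2]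
    · simp [hr.ne, f₁ r hr]

end Exp

-- Statements and syntactic running time

/-- Assignment to a variable. -/
def asg (x : Var) (e : Exp) : Prog := .seq (e.compile 20) (.op .or x.idx 20 20)

/-- Write the value of `e` to the address given by `a`. -/
def wr (a e : Exp) : Prog := .seq (a.compile 20) (.seq (e.compile 21) (.store 20 21))

/-- Conditional on an expression. -/
def cond (e : Exp) (p q : Prog) : Prog := .seq (e.compile 20) (.ite 20 p q)

def whileVar (x : Var) (p : Prog) : Prog := .loop x.idx p

/-- An upper bound for the running time if no loop makes more than `L` iterations. -/
def cost (L : ℕ) : Prog → ℕ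
  | .skip => 1
  | .const _ _ => 1
  | .op _ _ _ _ => 1
  | .load _ _ => 1
  | .store _ _ => 1
  | .seq p q => cost L p + cost L q
  | .ite _ p q => cost L p + cost L q + 1
  | .loop _ p => L * (cost L p + 1) + 1

/-- The nesting depth of loops becomes the exponent of the logarithm in the running time. -/
def loopDepth : Prog → ℕ
  | .seq p q => max (loopDepth p) (loopDepth q)
  | .ite _ p q => max (loopDepth p) (loopDepth q)
  | .loop _ p => loopDepth p + 1
  | _ => 0

/-- The `+ 2` for a loop pays for the test in each iteration and for the last, failing test. -/
def coeff : Prog → ℕ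
  | .seq p q => coeff p + coeff q
  | .ite _ p q => coeff p + coeff q + 1
  | .loop _ p => coeff p + 2
  | _ => 1

/-- Nesting multiplies by `L` and sequencing only adds, so the bound is a monomial in `L` whose
degree can be computed from the program. -/
theorem cost_le {L : ℕ} (hL : 1 ≤ L) (p : Prog) : cost L p ≤ coeff p * L ^ loopDepth p := by
  induction p with
  | skip => simp [cost, coeff, loopDepth]
  | const => simp [cost, coeff, loopDepth]
  | op => simp [cost, coeff, loopDepth]
  | load => simp [cost, coeff, loopDepth]
  | store => simp [cost, coeff, loopDepth]
  | seq p q hp hq =>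
    have h₁ := Nat.pow_le_pow_right hL (le_max_left (loopDepth p) (loopDepth q))
    have h₂ := Nat.pow_le_pow_right hL (le_max_right (loopDepth p) (loopDepth q))
    have h₃ := Nat.mul_le_mul_left (coeff p) h₁
    have h₄ := Nat.mul_le_mul_left (coeff q) h₂
    simp only [cost, coeff, loopDepth, add_mul]
    omega
  | ite r p q hp hq =>
    have h₁ := Nat.pow_le_pow_right hL (le_max_left (loopDepth p) (loopDepth q))
    have h₂ := Nat.pow_le_pow_right hL (le_max_right (loopDepth p) (loopDepth q))
    have h₃ := Nat.mul_le_mul_left (coeff p) h₁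
    have h₄ := Nat.mul_le_mul_left (coeff q) h₂
    have h₅ := Nat.pow_le_pow_right hL (Nat.zero_le (max (loopDepth p) (loopDepth q)))
    simp only [cost, coeff, loopDepth, add_mul, pow_zero, one_mul] at *
    omega
  | loop r p hp =>
    have h₁ := Nat.mul_le_mul_left L hp
    have h₂ : L ≤ L ^ (loopDepth p + 1) := by
      simpa using Nat.pow_le_pow_right hL (Nat.succ_le_succ (Nat.zero_le (loopDepth p)))
    simp only [cost, coeff, loopDepth]
    calc L * (cost L p + 1) + 1 ≤ L * (coeff p * L ^ loopDepth p) + L + 1 := by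
          rw [mul_add]; omega
      _ ≤ (coeff p + 2) * L ^ (loopDepth p + 1) := by
          rw [add_mul, pow_succ]
          rw [pow_succ] at h₂
          have : L * (coeff p * L ^ loopDepth p) = coeff p * (L ^ loopDepth p * L) := by ring
          omega

/-- Started in a state that agrees with `σ`, the program halts in time `cost L p` in a state that
agrees with a store satisfying `Q`. -/
def Tot (w L : ℕ) (p : Prog) (σ : Store) (Q : Store → Prop) : Prop :=
  ∀ s, Agree s σ → ∃ t s' σ', Runs w p s t s' ∧ t ≤ cost L p ∧ Agree s' σ' ∧ Q σ'

-- Rules of total correctness with time bounds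

section Tot

variable {w L : ℕ} {σ : Store} {Q R : Store → Prop} {p q : Prog}

theorem Tot.mono (h : Tot w L p σ Q) (hQ : ∀ σ', Q σ' → R σ') : Tot w L p σ R := fun s hs =>
  let ⟨t, s', σ', r, ht, ha, hq⟩ := h s hs
  ⟨t, s', σ', r, ht, ha, hQ _ hq⟩

theorem Tot.seq (h : Tot w L p σ fun σ' => Tot w L q σ' Q) : Tot w L (.seq p q) σ Q := by
  intro s hs
  obtain ⟨t, s', σ', r, ht, ha, hq⟩ := h s hs
  obtain ⟨t', s'', σ'', r', ht', ha', hq'⟩ := hq s' ha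
  exact ⟨_, s'', σ'', r.seq r', Nat.add_le_add ht ht', ha', hq'⟩

theorem Tot.skip (h : Q σ) : Tot w L .skip σ Q := fun s hs => ⟨1, s, σ, .skip s, le_rfl, hs, h⟩

theorem cost_compile (L : ℕ) (e : Exp) : ∀ d, cost L (e.compile d) = e.cost := by
  induction e with
  | lit => intro d; rfl
  | var => intro d; rfl
  | bin o a b iha ihb => intro d; simp [Exp.compile, cost, Exp.cost, iha, ihb]
  | rd a iha => intro d; simp [Exp.compile, cost, Exp.cost, iha]

theorem Agree.of_frame {s s' : State} (h : Agree s σ) (hm : s'.mem = s.mem)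
    (hr : ∀ r < 20, s'.reg r = s.reg r) : Agree s' σ :=
  ⟨fun x => by rw [hr _ x.idx_lt, h.1 x], hm.trans h.2⟩

theorem Tot.asg {x : Var} {e : Exp} {n : ℕ} (he : e.ev w σ = n) (h : Q (σ.set x n)) :
    Tot w L (asg x e) σ Q := by
  intro s hs
  obtain ⟨s₁, r₁, v₁, m₁, f₁⟩ := e.compile_runs w σ 20 s le_rfl hs
  have h₁ := hs.of_frame m₁ f₁
  refine ⟨_, _, σ.set x n, r₁.seq (Runs.op s₁ .or x.idx 20 20), ?_, ⟨fun y => ?_, h₁.2⟩, h⟩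
  · simp [WordRAM.asg, cost, cost_compile]
  · by_cases hy : y = x
    · subst hy
      simp [Op.eval, v₁, he]
    · have : y.idx ≠ x.idx := fun h => hy (Var.idx_inj h)
      simp [this, hy, h₁.1 y]

theorem Tot.wr {a e : Exp} {m n : ℕ} (ha : a.ev w σ = m) (he : e.ev w σ = n)
    (h : Q (σ.write m n)) : Tot w L (wr a e) σ Q := by
  intro s hs
  obtain ⟨s₁, r₁, v₁, m₁, f₁⟩ := a.compile_runs w σ 20 s le_rfl hs
  have h₁ := hs.of_frame m₁ f₁
  obtain ⟨s₂, r₂, v₂, m₂, f₂⟩ := e.compile_runs w σ 21 s₁ (by omega) h₁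
  have h₂ := h₁.of_frame m₂ fun r hr => f₂ r (by omega)
  refine ⟨_, _, σ.write m n, r₁.seq (r₂.seq (Runs.store s₂ 20 21)), ?_, ⟨fun y => h₂.1 y, ?_⟩, h⟩
  · simp [WordRAM.wr, cost, cost_compile]
  · simp [Store.write, h₂.2, f₂ 20, v₁, v₂, ha, he]

/-- The cost of a conditional includes both branches, so either one stays within the bound. -/
theorem Tot.cond {e : Exp} {n : ℕ} (he : e.ev w σ = n) (h₁ : n ≠ 0 → Tot w L p σ Q)
    (h₀ : n = 0 → Tot w L q σ Q) : Tot w L (cond e p q) σ Q := by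
  intro s hs
  obtain ⟨s₁, r₁, v₁, m₁, f₁⟩ := e.compile_runs w σ 20 s le_rfl hs
  have hs₁ := hs.of_frame m₁ f₁
  by_cases hn : n = 0
  · obtain ⟨t, s', σ', r, ht, ha, hq⟩ := h₀ hn s₁ hs₁
    refine ⟨_, s', σ', r₁.seq (Runs.ite_false (by rw [v₁, he, hn]) r), ?_, ha, hq⟩
    simp only [WordRAM.cond, cost, cost_compile]
    omega
  · obtain ⟨t, s', σ', r, ht, ha, hq⟩ := h₁ hn s₁ hs₁
    refine ⟨_, s', σ', r₁.seq (Runs.ite_true (by rwa [v₁, he]) r), ?_, ha, hq⟩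
    simp only [WordRAM.cond, cost, cost_compile]
    omega

/-- Conditional on the truth value of a proposition. -/
theorem Tot.condP {e : Exp} {P : Prop} [Decidable P] (he : e.ev w σ = if P then 1 else 0)
    (h₁ : P → Tot w L p σ Q) (h₀ : ¬P → Tot w L q σ Q) : Tot w L (WordRAM.cond e p q) σ Q := by
  refine Tot.cond he (fun h => h₁ ?_) (fun h => h₀ ?_)
  · by_contra hP; simp [hP] at h
  · intro hP; simp [hP] at h

/-- The index of the invariant is a variant: it drops with every iteration, so its initial value
bounds their number. It may drop by more than one, hence the strong induction. -/
theorem Tot.while {x : Var} (I : ℕ → Store → Prop)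
    (h : ∀ k σ, I k σ → σ.v x ≠ 0 → ∃ j, j < k ∧ Tot w L p σ (I j)) {k : ℕ} (hk : k ≤ L)
    (h₀ : I k σ) : Tot w L (whileVar x p) σ fun σ' => (∃ j, I j σ') ∧ σ'.v x = 0 := by
  have key : ∀ k σ, I k σ → ∀ s, Agree s σ → ∃ t s' σ', Runs w (whileVar x p) s t s' ∧
      t ≤ k * (cost L p + 1) + 1 ∧ Agree s' σ' ∧ (∃ j, I j σ') ∧ σ'.v x = 0 := by
    intro k
    induction k using Nat.strong_induction_on with
    | _ k ih =>
      intro σ hI s hs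
      by_cases hx : σ.v x = 0
      · exact ⟨1, s, σ, .loop_done (by rw [hs.1, hx]), by omega, hs, ⟨k, hI⟩, hx⟩
      · obtain ⟨j, hj, hT⟩ := h k σ hI hx
        obtain ⟨t, s₁, σ₁, r, ht, ha, hq⟩ := hT s hs
        obtain ⟨t', s', σ', r', ht', ha', hq'⟩ := ih j hj σ₁ hq s₁ ha
        refine ⟨_, s', σ', .loop_step (by rwa [hs.1]) r r', ?_, ha', hq'⟩
        have := Nat.mul_le_mul_right (cost L p + 1) (Nat.succ_le_of_lt hj)
        rw [Nat.succ_mul] at this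
        omega
  intro s hs
  obtain ⟨t, s', σ', r, ht, ha, hq⟩ := key k σ h₀ s hs
  refine ⟨t, s', σ', r, ht.trans ?_, ha, hq⟩
  simp only [whileVar, cost]
  have := Nat.mul_le_mul_right (cost L p + 1) hk
  omega

theorem Tot.answers {data : List ℕ} {x y T : ℕ}
    (h : Tot w L p ⟨fun r => if r = .inp then x % 2 ^ w else 0, fun i => data.getD i 0 % 2 ^ w⟩
      fun σ => σ.v .inp = y) (hT : cost L p ≤ T) : Answers w p data x y T := by
  obtain ⟨t, s', σ', r, ht, ha, hq⟩ := h (initial w data x)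
    ⟨fun r => by cases r <;> simp [initial, Var.idx], rfl⟩
  exact ⟨t, s', r, ht.trans hT, (ha.1 .inp).trans hq⟩

end Tot

end WordRAM

/-! ## Invariants of the greedy construction -/

namespace TopTree

variable {V : Type*}

/-- The lower ends of the edges of a cluster in preorder, divided into those that come before and
those that come after the nodes below the bottom boundary node. -/
def parts : TopTree V → List V × List V
  | edge _ v _ => ([v], [])
  | vert l r => (l.parts.1 ++ r.parts.1, r.parts.2 ++ l.parts.2)
  | horiz false l r => (l.parts.1, l.parts.2 ++ (r.parts.1 ++ r.parts.2))
  | horiz true l r => (l.parts.1 ++ l.parts.2 ++ r.parts.1, r.parts.2)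

/-- The lower ends of the edges in preorder. -/
def headList (t : TopTree V) : List V := t.parts.1 ++ t.parts.2

/-- The nodes of a cluster in preorder. -/
def localOrder (t : TopTree V) : List V := t.top :: t.headList

/-- The bottom boundary node. -/
def bot : TopTree V → V
  | edge _ v _ => v
  | vert _ r => r.bot
  | horiz false l _ => l.bot
  | horiz true _ r => r.bot

/-- The labels of the edges that leave the top boundary node. -/
def firsts : TopTree V → List Bool
  | edge _ _ b => [b]
  | vert l _ => l.firsts
  | horiz _ l r => l.firsts ++ r.firsts

def height : TopTree V → ℕ
  | edge _ _ _ => 0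
  | vert l r => max l.height r.height + 1
  | horiz _ l r => max l.height r.height + 1

/-- The merges of a top tree join clusters at a common boundary node, all single edges satisfy `E`,
and horizontal merges join the two edges that leave a node in the contracted tree. -/
def Wf (E : V → V → Bool → Prop) : TopTree V → Prop
  | edge u v b => E u v b
  | vert l r => l.Wf E ∧ r.Wf E ∧ r.top = l.bot
  | horiz _ l r => l.Wf E ∧ r.Wf E ∧ r.top = l.top ∧ l.firsts = [false] ∧ r.firsts = [true]

/-- The nodes below the bottom boundary node of `l` are visited immediately after it, hence between
the two parts of `l`. -/
theorem headList_vert (l r : TopTree V) :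
    (vert l r).headList = l.parts.1 ++ (r.headList ++ l.parts.2) := by
  simp [headList, parts]

theorem headList_horiz (b : Bool) (l r : TopTree V) :
    (horiz b l r).headList = l.headList ++ r.headList := by
  cases b <;> simp [headList, parts]

/-- The part before the bottom boundary node ends with it. -/
theorem parts_fst (t : TopTree V) : ∃ L, t.parts.1 = L ++ [t.bot] := by
  induction t with
  | edge u v b => exact ⟨[], rfl⟩
  | vert l r _ ihr =>
    obtain ⟨L, h⟩ := ihr
    exact ⟨l.parts.1 ++ L, by simp [parts, bot, h]⟩
  | horiz b l r ihl ihr =>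
    obtain ⟨L, h⟩ := ihl
    obtain ⟨R, h'⟩ := ihr
    cases b
    · exact ⟨L, by simp [parts, bot, h]⟩
    · exact ⟨l.parts.1 ++ l.parts.2 ++ R, by simp [parts, bot, h']⟩

theorem self_mem_vertices (t : TopTree V) : t ∈ t.vertices := by
  cases t <;> simp [vertices]

theorem Wf.of_mem_vertices {E : V → V → Bool → Prop} {s t : TopTree V} (ht : t.Wf E)
    (hs : s ∈ t.vertices) : s.Wf E := by
  induction t with
  | edge u v b => simp only [vertices, List.mem_singleton] at hs; rwa [hs]
  | vert l r ihl ihr =>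
    simp only [vertices, List.mem_cons, List.mem_append] at hs
    rcases hs with rfl | hs | hs
    exacts [ht, ihl ht.1 hs, ihr ht.2.1 hs]
  | horiz b l r ihl ihr =>
    simp only [vertices, List.mem_cons, List.mem_append] at hs
    rcases hs with rfl | hs | hs
    exacts [ht, ihl ht.1 hs, ihr ht.2.1 hs]

theorem localOrder_left_vert (l r : TopTree V) : l.localOrder.Sublist (vert l r).localOrder := by
  rw [localOrder, localOrder, headList_vert, headList]
  exact List.Sublist.cons_cons _ ((List.Sublist.refl _).append (List.sublist_append_right _ _))

/-- The top of `r` is the last node of the first part of `l`, so it is directly followed by the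
heads of `r`. -/
theorem localOrder_right_vert {l r : TopTree V} (h : r.top = l.bot) :
    r.localOrder.Sublist (vert l r).localOrder := by
  obtain ⟨L, hL⟩ := l.parts_fst
  rw [localOrder, localOrder, headList_vert, hL, h]
  refine List.Sublist.cons _ ?_
  simp only [List.append_assoc, List.singleton_append]
  refine List.Sublist.trans ?_ (List.sublist_append_right _ _)
  exact List.Sublist.cons_cons _ (List.sublist_append_left _ _)

theorem localOrder_left_horiz (b : Bool) (l r : TopTree V) :
    l.localOrder.Sublist (horiz b l r).localOrder := by
  rw [localOrder, localOrder, headList_horiz]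
  exact List.Sublist.cons_cons _ (List.sublist_append_left _ _)

theorem localOrder_right_horiz (b : Bool) {l r : TopTree V} (h : r.top = l.top) :
    r.localOrder.Sublist (horiz b l r).localOrder := by
  rw [localOrder, localOrder, headList_horiz, h]
  exact List.Sublist.cons_cons _ (List.sublist_append_right _ _)

/-- The preorder of a cluster is the restriction of the preorder of any cluster containing it. This
later identifies positions in `localOrder` with `ZDD.localPre`. -/
theorem localOrder_sublist {E : V → V → Bool → Prop} {s t : TopTree V} (ht : t.Wf E)
    (hs : s ∈ t.vertices) : s.localOrder.Sublist t.localOrder := by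
  induction t with
  | edge u v b => simp only [vertices, List.mem_singleton] at hs; rw [hs]
  | vert l r ihl ihr =>
    simp only [vertices, List.mem_cons, List.mem_append] at hs
    rcases hs with rfl | hs | hs
    · exact List.Sublist.refl _
    · exact (ihl ht.1 hs).trans (localOrder_left_vert l r)
    · exact (ihr ht.2.1 hs).trans (localOrder_right_vert ht.2.2)
  | horiz b l r ihl ihr =>
    simp only [vertices, List.mem_cons, List.mem_append] at hs
    rcases hs with rfl | hs | hs
    · exact List.Sublist.refl _
    · exact (ihl ht.1 hs).trans (localOrder_left_horiz b l r)
    · exact (ihr ht.2.1 hs).trans (localOrder_right_horiz b ht.2.2.1)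

/-- A top tree is a full binary tree whose leaves correspond to the heads. -/
theorem length_vertices (t : TopTree V) : t.vertices.length + 1 = 2 * t.headList.length := by
  induction t with
  | edge u v b => rfl
  | vert l r ihl ihr =>
    simp only [vertices, headList_vert, List.length_cons, List.length_append] at *
    simp only [headList, List.length_append] at ihl ihr ⊢
    omega
  | horiz b l r ihl ihr =>
    simp only [vertices, headList_horiz, List.length_cons, List.length_append] at *
    omega

section

variable [DecidableEq V]

theorem heads_eq (t : TopTree V) : t.heads = t.headList.toFinset := by
  induction t with
  | edge u v b => rfl
  | vert l r ihl ihr =>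
    ext x
    simp only [heads, ihl, ihr, headList, parts, Finset.mem_union, List.mem_toFinset,
      List.mem_append]
    tauto
  | horiz b l r ihl ihr => simp [heads, ihl, ihr, headList_horiz]

theorem mem_heads {t : TopTree V} {x : V} : x ∈ t.heads ↔ x ∈ t.headList := by
  rw [heads_eq, List.mem_toFinset]

theorem nodes_eq {E : V → V → Bool → Prop} {t : TopTree V} (ht : t.Wf E) :
    t.nodes = t.localOrder.toFinset := by
  induction t with
  | edge u v b => simp [nodes, localOrder, headList, parts, top]
  | vert l r ihl ihr =>
    obtain ⟨L, hL⟩ := l.parts_fst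
    ext x
    simp only [nodes, ihl ht.1, ihr ht.2.1, localOrder, headList_vert, Finset.mem_union,
      List.mem_toFinset, List.mem_append, List.mem_cons, top, ht.2.2]
    rw [headList, List.mem_append, hL]
    simp only [List.mem_append, List.mem_cons]
    tauto
  | horiz b l r ihl ihr =>
    ext x
    simp only [nodes, ihl ht.1, ihr ht.2.1, localOrder, headList_horiz, Finset.mem_union,
      List.mem_toFinset, List.mem_append, List.mem_cons, top, ht.2.2.1]
    tauto

end

end TopTree

-- Contracted trees: what one greedy round preserves

namespace EdgeTree

open TopTree

variable {V : Type*} {α : Type*}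

/-- All nodes but the root, in preorder, of the tree that a contracted tree stands for. -/
def preorder : EdgeTree (TopTree V) → List V
  | leaf => []
  | one a t => a.parts.1 ++ (preorder t ++ a.parts.2)
  | two a s b t => a.parts.1 ++ (preorder s ++ (a.parts.2 ++ (b.parts.1 ++ (preorder t ++ b.parts.2))))

/-- The clusters of a contracted tree with root `u` fit together. -/
def Wf (E : V → V → Bool → Prop) : V → EdgeTree (TopTree V) → Prop
  | _, leaf => True
  | u, one a t => a.Wf E ∧ a.top = u ∧ Wf E a.bot t
  | u, two a s b t => a.Wf E ∧ b.Wf E ∧ a.top = u ∧ b.top = u ∧ a.firsts = [false] ∧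
      b.firsts = [true] ∧ Wf E a.bot s ∧ Wf E b.bot t

/-- All clusters have height at most `k`. -/
def HeightLE (k : ℕ) : EdgeTree (TopTree V) → Prop
  | leaf => True
  | one a t => a.height ≤ k ∧ HeightLE k t
  | two a s b t => a.height ≤ k ∧ b.height ≤ k ∧ HeightLE k s ∧ HeightLE k t

def numEdges : EdgeTree α → ℕ
  | leaf => 0
  | one _ t => numEdges t + 1
  | two _ s _ t => numEdges s + numEdges t + 2

/-- The number of nodes with two children. -/
def numTwos : EdgeTree α → ℕ
  | leaf => 0
  | one _ t => numTwos t
  | two _ s _ t => numTwos s + numTwos t + 1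

/-- The clauses of `greedyBody` overlap; the hypothesis excludes the earlier clause with two leaves.
-/
theorem greedyBody_two_right {a b : TopTree V} {t : EdgeTree (TopTree V)} (ht : t ≠ leaf) :
    greedyBody (two a leaf b t) = one (horiz true a b) (greedyBody t) := by
  cases t with
  | leaf => contradiction
  | one c t => simp [greedyBody]
  | two c s d t => rw [greedyBody]; simp

theorem greedyBody_two_left {a b : TopTree V} {s : EdgeTree (TopTree V)} (hs : s ≠ leaf) :
    greedyBody (two a s b leaf) = one (horiz false a b) (greedyBody s) := by
  cases s with
  | leaf => contradiction
  | one c t => simp [greedyBody]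
  | two c s d t => rw [greedyBody]; simp

theorem greedyBody_two {a b : TopTree V} {s t : EdgeTree (TopTree V)} (hs : s ≠ leaf)
    (ht : t ≠ leaf) : greedyBody (two a s b t) =
      two (greedyEdge a s).1 (greedyEdge a s).2 (greedyEdge b t).1 (greedyEdge b t).2 := by
  cases s <;> cases t <;> first | contradiction | rw [greedyBody] <;> simp

/-- A vertical merge only regroups the list. In a horizontal merge nothing hangs below one of the
two siblings, so what hangs below the other one can be inserted there. The claim about `greedyEdge`
treats the upper edge together with everything below it, because a vertical merge changes both. -/
theorem order_greedy (t : EdgeTree (TopTree V)) : preorder (greedyBody t) = preorder t ∧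
    ∀ a, (greedyEdge a t).1.parts.1 ++ (preorder (greedyEdge a t).2 ++ (greedyEdge a t).1.parts.2) =
      a.parts.1 ++ (preorder t ++ a.parts.2) := by
  induction t with
  | leaf => simp [greedyBody, greedyEdge]
  | one b t ih =>
    refine ⟨by simp only [greedyBody, preorder]; exact ih.2 b, fun a => ?_⟩
    rw [greedyEdge]
    split
    · simp only [preorder, ih.2 b]
    · simp [preorder, ih.1, parts]
  | two a s b t ihs iht =>
    have h : preorder (greedyBody (two a s b t)) = preorder (two a s b t) := by
      by_cases hs : s = leaf
      · subst hs
        by_cases ht : t = leaf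
        · subst ht; simp [greedyBody, preorder, parts]
        · simp [greedyBody_two_right ht, preorder, iht.1, parts]
      · by_cases ht : t = leaf
        · subst ht; simp [greedyBody_two_left hs, preorder, ihs.1, parts]
        · have h₁ := ihs.2 a
          have h₂ := iht.2 b
          simp only [← List.append_assoc] at h₁ h₂
          simp only [greedyBody_two hs ht, preorder, ← List.append_assoc]
          rw [h₁]
          simp only [List.append_assoc] at h₂ ⊢
          rw [h₂]
    exact ⟨h, fun c => by simp only [greedyEdge, h]⟩

/-- Vertical merges keep the top and `firsts` of the upper edge. This has to be carried along
because the condition on two siblings refers to both. -/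
theorem wf_greedy {E : V → V → Bool → Prop} (t : EdgeTree (TopTree V)) :
    (∀ u, Wf E u t → Wf E u (greedyBody t)) ∧
    ∀ a : TopTree V, a.Wf E → Wf E a.bot t → (greedyEdge a t).1.Wf E ∧
      (greedyEdge a t).1.top = a.top ∧ (greedyEdge a t).1.firsts = a.firsts ∧
      Wf E (greedyEdge a t).1.bot (greedyEdge a t).2 := by
  induction t with
  | leaf => exact ⟨fun u _ => by simp [greedyBody, Wf], fun a ha _ => by simp [greedyEdge, Wf, ha]⟩
  | one b t ih =>
    refine ⟨fun u h => ?_, fun a ha h => ?_⟩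
    · obtain ⟨h₁, h₂, -, h₃⟩ := ih.2 b h.1 h.2.2
      rw [greedyBody]
      exact ⟨h₁, h₂.trans h.2.1, h₃⟩
    · rw [greedyEdge]
      split
      · obtain ⟨h₁, h₂, -, h₃⟩ := ih.2 b h.1 h.2.2
        exact ⟨ha, rfl, rfl, h₁, h₂.trans h.2.1, h₃⟩
      · exact ⟨⟨ha, h.1, h.2.1⟩, rfl, rfl, ih.1 _ h.2.2⟩
  | two a s b t ihs iht =>
    have key : ∀ u, Wf E u (two a s b t) → Wf E u (greedyBody (two a s b t)) := by
      intro u ⟨ha, hb, hau, hbu, hfa, hfb, hWs, hWt⟩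
      by_cases hs : s = leaf
      · subst hs
        by_cases ht : t = leaf
        · subst ht
          rw [greedyBody]
          exact ⟨⟨ha, hb, hbu.trans hau.symm, hfa, hfb⟩, hau, trivial⟩
        · rw [greedyBody_two_right ht]
          exact ⟨⟨ha, hb, hbu.trans hau.symm, hfa, hfb⟩, hau, iht.1 _ hWt⟩
      · by_cases ht : t = leaf
        · subst ht
          rw [greedyBody_two_left hs]
          exact ⟨⟨ha, hb, hbu.trans hau.symm, hfa, hfb⟩, hau, ihs.1 _ hWs⟩
        · rw [greedyBody_two hs ht]
          obtain ⟨a₁, a₂, a₃, a₄⟩ := ihs.2 a ha hWs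
          obtain ⟨b₁, b₂, b₃, b₄⟩ := iht.2 b hb hWt
          exact ⟨a₁, b₁, a₂.trans hau, b₂.trans hbu, a₃.trans hfa, b₃.trans hfb, a₄, b₄⟩
    exact ⟨key, fun c hc h => by rw [greedyEdge]; exact ⟨hc, rfl, rfl, key _ h⟩⟩

/-- A cluster takes part in at most one merge per round. -/
theorem heightLE_greedy {k : ℕ} (t : EdgeTree (TopTree V)) (ht : HeightLE k t) :
    HeightLE (k + 1) (greedyBody t) ∧ ∀ a : TopTree V, a.height ≤ k →
      (greedyEdge a t).1.height ≤ k + 1 ∧ HeightLE (k + 1) (greedyEdge a t).2 := by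
  induction t with
  | leaf => exact ⟨by simp [greedyBody, HeightLE], fun a ha => ⟨by simp [greedyEdge]; omega, by
      simp [greedyEdge, HeightLE]⟩⟩
  | one b t ih =>
    obtain ⟨ih₁, ih₂⟩ := ih ht.2
    refine ⟨by rw [greedyBody]; exact ih₂ b ht.1, fun a ha => ?_⟩
    rw [greedyEdge]
    split
    · exact ⟨by simp only; omega, ih₂ b ht.1⟩
    · exact ⟨by have := ht.1; simp only [height]; omega, ih₁⟩
  | two a s b t ihs iht =>
    have key : HeightLE (k + 1) (greedyBody (two a s b t)) := by
      obtain ⟨ha, hb, hs', ht'⟩ := ht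
      have hab : ∀ c, (horiz c a b).height ≤ k + 1 := fun c => by simp only [height]; omega
      by_cases hs : s = leaf
      · subst hs
        by_cases ht : t = leaf
        · subst ht
          rw [greedyBody]
          exact ⟨hab _, trivial⟩
        · rw [greedyBody_two_right ht]
          exact ⟨hab _, (iht ht').1⟩
      · by_cases ht : t = leaf
        · subst ht
          rw [greedyBody_two_left hs]
          exact ⟨hab _, (ihs hs').1⟩
        · rw [greedyBody_two hs ht]
          exact ⟨((ihs hs').2 a ha).1, ((iht ht').2 b hb).1, ((ihs hs').2 a ha).2,
            ((iht ht').2 b hb).2⟩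
    exact ⟨key, fun c hc => by rw [greedyEdge]; exact ⟨hc.trans (Nat.le_succ k), key⟩⟩

/-! ### A round removes a constant fraction of the edges -/

theorem two_mul_numTwos_le (t : EdgeTree α) : 2 * numTwos t ≤ numEdges t := by
  induction t with
  | leaf => simp [numTwos]
  | one a t ih => simp only [numTwos, numEdges]; omega
  | two a s b t ihs iht => simp only [numTwos, numEdges]; omega

theorem numEdges_eq_zero {t : EdgeTree α} : numEdges t = 0 ↔ t = leaf := by
  cases t <;> simp [numEdges]

/-- The target is three times the new number of edges against twice the old number plus the number
of branchings. A merged pair gains one unit and an edge left alone loses one. On an odd path of at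
least three edges the pairs pay for the topmost edge. A single edge above a branching is paid for by
that branching, which is why the second claim has one unit to spare. A single edge ending in a leaf
stays unpaid: this is the extra 1, and it is absorbed when such an edge hangs below a horizontal
merge. -/
theorem numEdges_greedy (t : EdgeTree (TopTree V)) :
    (3 * numEdges (greedyBody t) ≤ 2 * numEdges t + numTwos t +
        if chain t = 1 ∧ numEdges t = 1 then 1 else 0) ∧
    (chain t = 0 → numEdges t ≠ 0 →
      3 * numEdges (greedyBody t) + 1 ≤ 2 * numEdges t + numTwos t) ∧
    ∀ a, 3 * (numEdges (greedyEdge a t).2 + 1) + (if chain t % 2 = 1 then 1 else 0) ≤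
      2 * (numEdges t + 1) + numTwos t + if numEdges t = 0 then 1 else 0 := by
  induction t with
  | leaf => simp [greedyBody, greedyEdge, numEdges, numTwos, chain]
  | one b t ih =>
    obtain ⟨ih₁, ih₂, ih₃⟩ := ih
    refine ⟨?_, by simp [chain], fun a => ?_⟩
    · have := ih₃ b
      simp only [greedyBody, numEdges, numTwos, chain]
      by_cases h : t = leaf
      · subst h; simpa [chain, numEdges] using this
      · have h' := mt numEdges_eq_zero.1 h
        split_ifs at this ⊢ <;> omega
    · rw [greedyEdge]
      simp only [numTwos]
      rw [if_neg (show numEdges (one b t) ≠ 0 by simp [numEdges])]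
      split
      · rename_i hc
        have := ih₃ b
        have h' : numEdges t ≠ 0 := fun h => by
          rw [numEdges_eq_zero.1 h] at hc; simp [chain] at hc
        rw [if_neg h', if_pos hc] at this
        rw [if_neg (show chain (one b t) % 2 ≠ 1 by simp only [chain]; omega)]
        simp only [numEdges]
        omega
      · rename_i hc
        have h₀ : ¬ (chain t = 1 ∧ numEdges t = 1) := fun h => hc (by rw [h.1])
        rw [if_neg h₀] at ih₁
        rw [if_pos (show chain (one b t) % 2 = 1 by simp only [chain]; omega)]
        simp only [numEdges]
        omega
  | two a s b t ihs iht =>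
    obtain ⟨s₁, s₂, s₃⟩ := ihs
    obtain ⟨t₁, t₂, t₃⟩ := iht
    have key : 3 * numEdges (greedyBody (two a s b t)) + 1 ≤
        2 * numEdges (two a s b t) + numTwos (two a s b t) := by
      by_cases hs : s = leaf
      · subst hs
        by_cases ht : t = leaf
        · subst ht; simp [greedyBody, numEdges, numTwos]
        · rw [greedyBody_two_right ht]
          simp only [numEdges, numTwos]
          split_ifs at t₁ <;> omega
      · by_cases ht : t = leaf
        · subst ht
          rw [greedyBody_two_left hs]
          simp only [numEdges, numTwos]
          split_ifs at s₁ <;> omega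
        · have hs' := mt numEdges_eq_zero.1 hs
          have ht' := mt numEdges_eq_zero.1 ht
          rw [greedyBody_two hs ht]
          have h₁ := s₃ a
          have h₂ := t₃ b
          rw [if_neg hs'] at h₁
          rw [if_neg ht'] at h₂
          simp only [numEdges, numTwos]
          omega
    refine ⟨by omega, fun _ _ => key, fun c => ?_⟩
    rw [greedyEdge, if_neg (by simp [chain])]
    dsimp only
    omega

/-- At most half as many branchings as edges turns `2 + 1/2` over 3 into the factor 5/6; the
exceptional unit needs a tree with one edge. -/
theorem six_mul_numEdges_greedy_le {t : EdgeTree (TopTree V)} (ht : 2 ≤ numEdges t) :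
    6 * numEdges (greedyBody t) ≤ 5 * numEdges t := by
  have h := (numEdges_greedy t).1
  have := two_mul_numTwos_le t
  rw [if_neg (by omega)] at h
  omega

theorem exists_eq_one_of_numEdges {t : EdgeTree α} (ht : numEdges t = 1) : ∃ a, t = one a leaf := by
  cases t with
  | leaf => simp [numEdges] at ht
  | one a t =>
    have : t = leaf := numEdges_eq_zero.1 (by simpa [numEdges] using ht)
    exact ⟨a, by rw [this]⟩
  | two a s b t => simp [numEdges] at ht

theorem greedyBody_of_numEdges_le_one {t : EdgeTree (TopTree V)} (ht : numEdges t ≤ 1) :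
    greedyBody t = t := by
  rcases Nat.le_one_iff_eq_zero_or_eq_one.1 ht with h | h
  · rw [numEdges_eq_zero.1 h, greedyBody]
  · obtain ⟨a, rfl⟩ := exists_eq_one_of_numEdges h
    simp [greedyBody, greedyEdge]

theorem iterate_greedyBody_of_numEdges_le_one {t : EdgeTree (TopTree V)} (ht : numEdges t ≤ 1)
    (k : ℕ) : greedyBody^[k] t = t := by
  induction k with
  | zero => rfl
  | succ k ih => rw [Function.iterate_succ_apply, greedyBody_of_numEdges_le_one ht, ih]

theorem greedyBody_eq_leaf {t : EdgeTree (TopTree V)} : greedyBody t = leaf ↔ t = leaf := by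
  refine ⟨fun h => ?_, fun h => by rw [h, greedyBody]⟩
  have := (order_greedy t).1
  rw [h] at this
  by_contra ht
  cases t with
  | leaf => exact ht rfl
  | one a t =>
    obtain ⟨L, hL⟩ := a.parts_fst
    simp [preorder, hL] at this
  | two a s b t =>
    obtain ⟨L, hL⟩ := a.parts_fst
    simp [preorder, hL] at this

theorem numEdges_iterate_le (k : ℕ) (t : EdgeTree (TopTree V)) (ht : numEdges t ≤ k + 1) :
    numEdges (greedyBody^[k] t) ≤ 1 := by
  induction k generalizing t with
  | zero => exact ht
  | succ k ih =>
    rw [Function.iterate_succ_apply]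
    refine ih _ ?_
    by_cases h : 2 ≤ numEdges t
    · have := six_mul_numEdges_greedy_le h; omega
    · rw [greedyBody_of_numEdges_le_one (by omega)]; omega

/-- Four rounds are the least number that works with this factor: `(5/6) ^ 4 < 1/2`. If the process
stops earlier, a single edge is at most half of two. -/
theorem numEdges_iterate_four (t : EdgeTree (TopTree V)) (ht : 2 ≤ numEdges t) :
    numEdges (greedyBody^[4] t) ≤ numEdges t / 2 := by
  have h (s : EdgeTree (TopTree V)) : numEdges (greedyBody s) ≤ 1 ∧ numEdges s ≤ 1 ∨
      6 * numEdges (greedyBody s) ≤ 5 * numEdges s ∧ 2 ≤ numEdges s := by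
    by_cases hs : 2 ≤ numEdges s
    · exact Or.inr ⟨six_mul_numEdges_greedy_le hs, hs⟩
    · exact Or.inl ⟨by rw [greedyBody_of_numEdges_le_one (by omega)]; omega, by omega⟩
  have h₁ := h t
  have h₂ := h (greedyBody t)
  have h₃ := h (greedyBody (greedyBody t))
  have h₄ := h (greedyBody (greedyBody (greedyBody t)))
  simp only [Function.iterate_succ, Function.comp_apply, Function.iterate_zero, id_eq]
  omega

/-- A logarithmic number of rounds is enough. -/
theorem numEdges_iterate_log (t : EdgeTree (TopTree V)) :
    numEdges (greedyBody^[4 * Nat.log 2 (numEdges t)] t) ≤ 1 := by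
  generalize hm : numEdges t = m
  induction m using Nat.strong_induction_on generalizing t with
  | _ m ih =>
    by_cases h : 2 ≤ m
    · have h₁ : m / 2 < m := Nat.div_lt_self (by omega) (by omega)
      have h₂ := numEdges_iterate_four t (by omega)
      rw [Nat.log_of_one_lt_of_le (by omega) h, mul_add, mul_one, Function.iterate_add_apply]
      set s := greedyBody^[4] t
      have h₃ := ih (numEdges s) (by omega) s rfl
      have h₄ : 4 * Nat.log 2 (numEdges s) ≤ 4 * Nat.log 2 (m / 2) :=
        Nat.mul_le_mul_left 4 (Nat.log_mono_right (by omega))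
      obtain ⟨d, hd⟩ := Nat.exists_eq_add_of_le' h₄
      rw [hd, Function.iterate_add_apply, iterate_greedyBody_of_numEdges_le_one h₃]
      exact h₃
    · rw [iterate_greedyBody_of_numEdges_le_one (by omega)]; omega

theorem iterate_invariant {E : V → V → Bool → Prop} {u : V} {t : EdgeTree (TopTree V)}
    (hE : Wf E u t) (hh : HeightLE 0 t) (k : ℕ) :
    Wf E u (greedyBody^[k] t) ∧ HeightLE k (greedyBody^[k] t) ∧
      preorder (greedyBody^[k] t) = preorder t := by
  induction k with
  | zero => exact ⟨hE, hh, rfl⟩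
  | succ k ih =>
    rw [Function.iterate_succ_apply']
    exact ⟨(wf_greedy _).1 _ ih.1, (heightLE_greedy _ ih.2.1).1, (order_greedy _).1.trans ih.2.2⟩

/-- Every cluster contributes at least its bottom boundary node. -/
theorem numEdges_le_length_order (t : EdgeTree (TopTree V)) : numEdges t ≤ (preorder t).length := by
  induction t with
  | leaf => simp [numEdges]
  | one a t ih =>
    obtain ⟨L, hL⟩ := a.parts_fst
    simp only [numEdges, preorder, hL, List.length_append, List.length_singleton]
    omega
  | two a s b t ihs iht =>
    obtain ⟨L, hL⟩ := a.parts_fst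
    obtain ⟨R, hR⟩ := b.parts_fst
    simp only [numEdges, preorder, hL, hR, List.length_append, List.length_singleton]
    omega

/-- The greedy construction yields a single cluster of logarithmic height with all the nodes. -/
theorem exists_single {E : V → V → Bool → Prop} {u : V} {t : EdgeTree (TopTree V)}
    (hE : Wf E u t) (hh : HeightLE 0 t) (ht : t ≠ leaf) {k : ℕ} (hk : (preorder t).length ≤ k) :
    ∃ a : TopTree V, single (greedyBody^[k] t) = some a ∧ a.Wf E ∧ a.localOrder = u :: preorder t ∧
      a.height ≤ 4 * Nat.log 2 (preorder t).length := by
  have hm := numEdges_le_length_order t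
  set l := 4 * Nat.log 2 (numEdges t) with hl
  have h₁ := numEdges_iterate_log t
  have h₂ := numEdges_iterate_le k t (by omega)
  rw [← hl] at h₁
  -- Both numbers of rounds reach a fixed point, so the trees agree; the height is then bounded by
  -- the smaller count `l`, although the definition performs `k` rounds.
  have heq : greedyBody^[k] t = greedyBody^[l] t := by
    rcases le_total k l with h | h
    · obtain ⟨d, hd⟩ := Nat.exists_eq_add_of_le' h
      rw [hd, Function.iterate_add_apply, iterate_greedyBody_of_numEdges_le_one h₂]
    · obtain ⟨d, hd⟩ := Nat.exists_eq_add_of_le' h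
      rw [hd, Function.iterate_add_apply, iterate_greedyBody_of_numEdges_le_one h₁]
  obtain ⟨i₁, i₂, i₃⟩ := iterate_invariant hE hh l
  have h₀ : numEdges (greedyBody^[l] t) ≠ 0 := by
    rw [Ne, numEdges_eq_zero]
    intro h
    have : ∀ k, greedyBody^[k] t ≠ leaf := by
      intro k
      induction k with
      | zero => exact ht
      | succ k ih => rw [Function.iterate_succ_apply']; exact mt greedyBody_eq_leaf.1 ih
    exact this l h
  obtain ⟨a, ha⟩ := exists_eq_one_of_numEdges (by omega : numEdges (greedyBody^[l] t) = 1)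
  rw [ha] at i₁ i₂ i₃
  refine ⟨a, by rw [heq, ha, single], i₁.1, ?_, ?_⟩
  · rw [← i₃, localOrder, i₁.2.1]
    simp [preorder, headList]
  · exact i₂.1.trans (Nat.mul_le_mul_left 4 (Nat.log_mono_right hm))

end EdgeTree

/-! ## The depth-first spanning tree -/

namespace ZDD

open EdgeTree

variable {V : Type*} [Fintype V] [DecidableEq V] {c : ℕ} (G : ZDD V c)

/-- There is a `b`-edge from `u` to `v`. -/
def IsEdge (u v : V) (b : Bool) : Prop := G.child b u = Sum.inl v

theorem label_lt {u v : V} {b : Bool} (h : G.child b u = Sum.inl v) : G.label u < G.label v := by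
  cases b
  · exact G.ordered_zero u v (by simpa [child] using h)
  · exact G.ordered_one u v (by simpa [child] using h)

/-- Exploration of the `b`-edge of `u` in the depth-first traversal. -/
def explore (k : ℕ) (u : V) (b : Bool) (vis : List V) :
    Option (TopTree V × EdgeTree (TopTree V)) × List V :=
  match G.child b u with
  | Sum.inr _ => (none, vis)
  | Sum.inl v =>
    if v ∈ vis then (none, vis)
    else (some (TopTree.edge u v b, (G.dfs k v vis).1), (G.dfs k v vis).2)

theorem dfs_succ (k : ℕ) (u : V) (vis : List V) : G.dfs (k + 1) u vis =
    let r₀ := G.explore k u false (vis ++ [u])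
    let r₁ := G.explore k u true r₀.2
    match r₀.1, r₁.1 with
    | none, none => (EdgeTree.leaf, r₁.2)
    | some (a, s), none => (EdgeTree.one a s, r₁.2)
    | none, some (b, t) => (EdgeTree.one b t, r₁.2)
    | some (a, s), some (b, t) => (EdgeTree.two a s b t, r₁.2) := rfl

/-- The properties of the result of a traversal that starts at `u`. -/
structure IsTraversal (u : V) (vis : List V) (r : EdgeTree (TopTree V) × List V) : Prop where
  list : r.2 = vis ++ u :: preorder r.1
  nodup : r.2.Nodup
  wf : Wf G.IsEdge u r.1
  height : HeightLE 0 r.1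
  closed : ∀ y ∈ u :: preorder r.1, ∀ b z, G.child b y = Sum.inl z → z ∈ r.2

theorem explore_cases {k : ℕ} {u : V} {vis : List V} (b : Bool)
    (h : ∀ v, G.child b u = Sum.inl v → v ∉ vis → G.IsTraversal v vis (G.dfs k v vis)) :
    ((G.explore k u b vis).1 = none ∧ (G.explore k u b vis).2 = vis ∧
      ∀ z, G.child b u = Sum.inl z → z ∈ vis) ∨
    ∃ v s l, G.explore k u b vis = (some (TopTree.edge u v b, s), l) ∧ G.child b u = Sum.inl v ∧
      G.IsTraversal v vis (s, l) := by
  unfold explore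
  cases hc : G.child b u with
  | inr τ => left; simp
  | inl v =>
    by_cases hv : v ∈ vis
    · left; simp [hv]
    · right
      exact ⟨v, _, _, by simp only [hv, if_false], rfl, h v hc hv⟩

/-- The depth is bounded through the labels: they increase along edges, so the set of nodes with
label at least that of the current node loses that node in each recursive call. With as many levels
as nodes the traversal is never cut off. -/
theorem isTraversal_dfs (k : ℕ) : ∀ (u : V) (vis : List V), vis.Nodup → u ∉ vis →
    (Finset.univ.filter fun y => G.label u ≤ G.label y).card ≤ k →
    G.IsTraversal u vis (G.dfs k u vis) := by
  induction k with
  | zero =>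
    intro u vis _ _ h
    have : u ∈ Finset.univ.filter fun y => G.label u ≤ G.label y := by simp
    rw [Finset.card_eq_zero.1 (Nat.le_zero.1 h)] at this
    simp at this
  | succ k ih =>
    intro u vis hvis hu hk
    have hnd : (vis ++ [u]).Nodup := by
      rw [List.nodup_append]
      exact ⟨hvis, List.nodup_singleton u, fun a ha b hb => by
        rw [List.mem_singleton] at hb; rintro rfl; exact hu (hb ▸ ha)⟩
    have step : ∀ (b : Bool) (l : List V), l.Nodup → ∀ v, G.child b u = Sum.inl v → v ∉ l →
        G.IsTraversal v l (G.dfs k v l) := by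
      intro b l hl v hv hvl
      refine ih v l hl hvl (Nat.le_of_lt_succ (lt_of_lt_of_le (Finset.card_lt_card ?_) hk))
      have := G.label_lt hv
      rw [Finset.ssubset_iff_of_subset fun y => by simp only [Finset.mem_filter]; grind]
      exact ⟨u, by simp, by simpa using this⟩
    rw [dfs_succ]
    dsimp only
    rcases G.explore_cases false (step false _ hnd) with ⟨h₁, h₂, h₃⟩ | ⟨v, s, l, h₁, h₂, h₃⟩
    · rw [h₁, h₂]
      rcases G.explore_cases true (step true _ hnd) with ⟨g₁, g₂, g₃⟩ | ⟨v', s', l', g₁, g₂, g₃⟩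
      · rw [g₁, g₂]
        refine ⟨by simp [preorder], hnd, trivial, trivial, ?_⟩
        intro y hy b z hz
        simp only [preorder, List.mem_singleton] at hy
        subst hy
        cases b
        exacts [h₃ z hz, g₃ z hz]
      · rw [g₁]
        have hl := g₃.list
        dsimp only at hl
        refine ⟨by simp [preorder, hl, TopTree.parts], g₃.nodup, ⟨g₂, rfl, g₃.wf⟩,
          ⟨le_rfl, g₃.height⟩, ?_⟩
        intro y hy b z hz
        simp only [preorder, TopTree.parts, List.append_nil, List.singleton_append] at hy
        rcases List.mem_cons.1 hy with rfl | hy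
        · cases b
          · have := h₃ z hz; rw [hl]; exact List.mem_append_left _ this
          · rw [g₂] at hz; cases hz; simp [hl]
        · exact g₃.closed y hy b z hz
    · rw [h₁]
      have hl := h₃.list
      dsimp only at hl
      rcases G.explore_cases true (step true _ h₃.nodup) with
        ⟨g₁, g₂, g₃⟩ | ⟨v', s', l', g₁, g₂, g₃⟩
      · rw [g₁, g₂]
        refine ⟨by simp [preorder, hl, TopTree.parts], h₃.nodup, ⟨h₂, rfl, h₃.wf⟩,
          ⟨le_rfl, h₃.height⟩, ?_⟩
        intro y hy b z hz
        simp only [preorder, TopTree.parts, List.append_nil, List.singleton_append] at hy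
        rcases List.mem_cons.1 hy with rfl | hy
        · cases b
          · rw [h₂] at hz; cases hz; simp [hl]
          · exact g₃ z hz
        · exact h₃.closed y hy b z hz
      · rw [g₁]
        have hl' := g₃.list
        dsimp only at hl'
        refine ⟨by simp [preorder, hl', hl, TopTree.parts], g₃.nodup,
          ⟨h₂, g₂, rfl, rfl, rfl, rfl, h₃.wf, g₃.wf⟩, ⟨le_rfl, le_rfl, h₃.height, g₃.height⟩, ?_⟩
        intro y hy b z hz
        simp only [preorder, TopTree.parts, List.nil_append, List.append_nil,
          List.singleton_append] at hy
        rcases List.mem_cons.1 hy with rfl | hy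
        · cases b
          · rw [h₂] at hz; cases hz; simp [hl', hl]
          · rw [g₂] at hz; cases hz; simp [hl']
        · rw [← List.cons_append] at hy
          rcases List.mem_append.1 hy with hy | hy
          · have := h₃.closed y hy b z hz
            dsimp only at this ⊢
            rw [hl', List.mem_append]; exact Or.inl this
          · exact g₃.closed y hy b z hz

theorem isTraversal_root : G.IsTraversal G.root [] (G.spanningTree, G.order) :=
  G.isTraversal_dfs _ _ _ List.nodup_nil (by simp) (Finset.card_le_univ _)

theorem order_eq : G.order = G.root :: EdgeTree.preorder G.spanningTree := G.isTraversal_root.list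

theorem nodup_order : G.order.Nodup := G.isTraversal_root.nodup

/-- The traversal starts with nothing visited, so its list is closed under all edges; reachability
from the root does the rest. -/
theorem mem_order (v : V) : v ∈ G.order := by
  induction G.reachable v with
  | refl => simp [order_eq]
  | tail _ h ih =>
    rename_i y z _
    rcases h with h | h
    · exact G.isTraversal_root.closed y (G.order_eq ▸ ih) false z (by simpa [child] using h)
    · exact G.isTraversal_root.closed y (G.order_eq ▸ ih) true z (by simpa [child] using h)

theorem length_order : G.order.length = Fintype.card V := by
  rw [← List.toFinset_card_of_nodup G.nodup_order, ← Finset.card_univ]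
  congr 1
  ext v
  simp [G.mem_order v]

theorem card_pos {V : Type*} [Fintype V] {c : ℕ} (G : ZDD V c) : 0 < Fintype.card V := Fintype.card_pos_iff.2 ⟨G.root⟩

/-- The top tree is empty if there is only one branching node. -/
theorem topTree_eq_none (h : Fintype.card V = 1) : G.topTree = none := by
  have h₁ := G.length_order
  have h₂ := numEdges_le_length_order G.spanningTree
  rw [order_eq, List.length_cons] at h₁
  have h₃ : G.spanningTree = EdgeTree.leaf := numEdges_eq_zero.1 (by omega)
  rw [topTree, h₃, iterate_greedyBody_of_numEdges_le_one (by simp [numEdges])]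
  rfl

theorem exists_topTree (h : Fintype.card V ≠ 1) : ∃ T : TopTree V, G.topTree = some T ∧
    T.Wf G.IsEdge ∧ T.localOrder = G.order ∧ T.height ≤ 4 * Nat.log 2 (Fintype.card V) := by
  have hr := G.isTraversal_root
  have h₀ := G.length_order
  have h₁ := G.order_eq
  have h₂ : (EdgeTree.preorder G.spanningTree).length + 1 = Fintype.card V := by
    rw [← h₀, h₁, List.length_cons]
  obtain ⟨T, t₁, t₂, t₃, t₄⟩ := exists_single hr.wf hr.height
    (fun h' => h (by dsimp only at h'; rw [← h₂, h']; rfl)) (k := Fintype.card V)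
    (by dsimp only; omega)
  refine ⟨T, t₁, t₂, t₃.trans h₁.symm, t₄.trans ?_⟩
  exact Nat.mul_le_mul_left 4 (Nat.log_mono_right (by dsimp only; omega))

end ZDD

/-! ## Positions of nodes in clusters -/

namespace TopTree

variable {V : Type*}

theorem localOrder_length (t : TopTree V) : t.localOrder.length = t.headList.length + 1 := rfl

/-- Positions count from 0, the top boundary node being at 0. A vertical merge has three ranges: the
first part of `l`, then `r`, then the rest of `l`. The node at position `l.parts.1.length` is the
common boundary node and belongs to both of the first two ranges. -/
theorem getElem?_vert_left {l r : TopTree V} {k : ℕ} (h : k ≤ l.parts.1.length) :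
    (vert l r).localOrder[k]? = l.localOrder[k]? := by
  have hl : l.headList = l.parts.1 ++ l.parts.2 := rfl
  rw [localOrder, localOrder, headList_vert, hl, top]
  cases k with
  | zero => rfl
  | succ k =>
    rw [List.getElem?_cons_succ, List.getElem?_cons_succ, List.getElem?_append_left (by omega),
      List.getElem?_append_left (by omega)]

theorem getElem?_vert_right {l r : TopTree V} (hr : r.top = l.bot) {j : ℕ}
    (h : j ≤ r.headList.length) :
    (vert l r).localOrder[l.parts.1.length + j]? = r.localOrder[j]? := by
  obtain ⟨L, hL⟩ := l.parts_fst
  rw [localOrder, localOrder, headList_vert, top, hL]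
  cases j with
  | zero => simp [hr]
  | succ j =>
    rw [show (L ++ [l.bot]).length + (j + 1) = (L ++ [l.bot]).length + j + 1 by omega,
      List.getElem?_cons_succ, List.getElem?_cons_succ, List.getElem?_append_right (by omega),
      List.getElem?_append_left (by omega)]
    congr 1
    omega

theorem getElem?_vert_left' {l r : TopTree V} {j : ℕ} (h : l.parts.1.length < j) :
    (vert l r).localOrder[j + r.headList.length]? = l.localOrder[j]? := by
  have hl : l.headList = l.parts.1 ++ l.parts.2 := rfl
  rw [localOrder, localOrder, headList_vert, hl, top]
  obtain ⟨i, rfl⟩ := Nat.exists_eq_add_of_lt h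
  rw [show l.parts.1.length + i + 1 + r.headList.length =
    l.parts.1.length + (r.headList.length + i) + 1 by omega, List.getElem?_cons_succ,
    List.getElem?_cons_succ, List.getElem?_append_right (by omega),
    List.getElem?_append_right (by omega), List.getElem?_append_right (by omega)]
  congr 1
  simp only [headList, List.length_append]
  omega

theorem getElem?_horiz_left (b : Bool) {l r : TopTree V} {k : ℕ} (h : k ≤ l.headList.length) :
    (horiz b l r).localOrder[k]? = l.localOrder[k]? := by
  rw [localOrder, localOrder, headList_horiz, top]
  cases k with
  | zero => rfl
  | succ k =>
    rw [List.getElem?_cons_succ, List.getElem?_cons_succ, List.getElem?_append_left (by omega)]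

theorem getElem?_horiz_right (b : Bool) {l r : TopTree V} {j : ℕ} (h : 0 < j) :
    (horiz b l r).localOrder[j + l.headList.length]? = r.localOrder[j]? := by
  rw [localOrder, localOrder, headList_horiz, top]
  obtain ⟨i, rfl⟩ := Nat.exists_eq_add_of_lt h
  rw [show 0 + i + 1 + l.headList.length = l.headList.length + i + 1 by omega,
    List.getElem?_cons_succ, List.getElem?_cons_succ, List.getElem?_append_right (by omega)]
  congr 1
  omega

-- Descent to a child cluster and change of local preorders

/-- One step of the descent towards a node at position `k` (from `0`): the child and the position
of the node in it.  If the node is the common boundary node of two clusters, the arguments tell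
where to go: `tl` in vertical merges and `tr` in horizontal merges. -/
def descend (tl tr : Bool) : TopTree V → ℕ → TopTree V × ℕ
  | edge u v b, k => (edge u v b, k)
  | vert l r, k =>
    if k + tl.toNat ≤ l.parts.1.length then (l, k)
    else if k ≤ l.parts.1.length + r.headList.length then (r, k - l.parts.1.length)
    else (l, k - r.headList.length)
  | horiz _ l r, k =>
    if k ≤ l.headList.length ∧ ¬(tr = true ∧ k = 0) then (l, k) else (r, k - l.headList.length)

/-- How local preorders (from `1`) in the child turn into local preorders in the parent: those
above the first number grow by the second number. -/
def shift (tl tr : Bool) : TopTree V → ℕ → ℕ × ℕ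
  | edge _ _ _, _ => (0, 0)
  | vert l r, k =>
    if k + tl.toNat ≤ l.parts.1.length then (l.parts.1.length + 1, r.headList.length)
    else if k ≤ l.parts.1.length + r.headList.length then (0, l.parts.1.length)
    else (l.parts.1.length + 1, r.headList.length)
  | horiz _ l _, k =>
    if k ≤ l.headList.length ∧ ¬(tr = true ∧ k = 0) then (0, 0) else (1, l.headList.length)

/-- The first number is the largest local preorder that stays the same in the parent, hence the
strict comparison. -/
def shiftBy (p : ℕ × ℕ) (y : ℕ) : ℕ := if p.1 < y then y + p.2 else y

def IsInternal : TopTree V → Prop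
  | edge _ _ _ => False
  | _ => True

section descend

variable {E : V → V → Bool → Prop} {t : TopTree V} (tl tr : Bool) (k : ℕ)

theorem descend_mem_vertices : (t.descend tl tr k).1 ∈ t.vertices := by
  cases t with
  | edge u v b => simp [descend, vertices]
  | vert l r =>
    simp only [descend]
    split_ifs <;> simp [vertices, self_mem_vertices]
  | horiz b l r =>
    simp only [descend]
    split_ifs <;> simp [vertices, self_mem_vertices]

theorem height_descend (h : t.IsInternal) : (t.descend tl tr k).1.height < t.height := by
  cases t with
  | edge u v b => exact h.elim
  | vert l r =>
    simp only [descend, height]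
    split_ifs <;> simp only <;> omega
  | horiz b l r =>
    simp only [descend, height]
    split_ifs <;> simp only <;> omega

/-- Whatever the flags are, the node stays in view; they matter only for a boundary node that lies
in both children. -/
theorem getElem?_descend (ht : t.Wf E) {x : V} (hx : t.localOrder[k]? = some x) :
    (t.descend tl tr k).1.localOrder[(t.descend tl tr k).2]? = some x := by
  cases t with
  | edge u v b => exact hx
  | vert l r =>
    simp only [descend]
    split_ifs with h₁ h₂
    · rwa [getElem?_vert_left (by omega)] at hx
    · have h : l.parts.1.length ≤ k := by
        cases tl <;> simp at h₁ <;> omega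
      dsimp only
      rw [← getElem?_vert_right ht.2.2 (by omega), Nat.add_sub_cancel' h, hx]
    · dsimp only
      rw [← getElem?_vert_left' (r := r) (by omega), Nat.sub_add_cancel (by omega), hx]
  | horiz b l r =>
    simp only [descend]
    split_ifs with h
    · rwa [getElem?_horiz_left b h.1] at hx
    · dsimp only
      by_cases hk : k ≤ l.headList.length
      · have h0 : k = 0 := by by_contra h'; exact h ⟨hk, fun h'' => h' h''.2⟩
        subst h0
        simpa [localOrder, top, ht.2.2.1] using hx
      · rw [← getElem?_horiz_right b (l := l) (by omega), Nat.sub_add_cancel (by omega), hx]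

/-- This concerns every node `z` of the child, not only the one that is followed: the node to be
converted at the end is the end point of an edge, found somewhere in the last cluster. -/
theorem getElem?_shift (ht : t.Wf E) {j : ℕ} {z : V}
    (hz : (t.descend tl tr k).1.localOrder[j]? = some z) :
    ∃ i, i + 1 = shiftBy (t.shift tl tr k) (j + 1) ∧ t.localOrder[i]? = some z := by
  have hlt := (List.getElem?_eq_some_iff.1 hz).1
  rw [localOrder_length] at hlt
  have left : ∀ l r, t = vert l r → l.localOrder[j]? = some z →
      ∃ i, i + 1 = shiftBy (l.parts.1.length + 1, r.headList.length) (j + 1) ∧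
        t.localOrder[i]? = some z := by
    rintro l r rfl hz
    simp only [shiftBy]
    split_ifs with h
    · exact ⟨j + r.headList.length, by omega, by rwa [getElem?_vert_left' (by omega)]⟩
    · exact ⟨j, rfl, by rwa [getElem?_vert_left (by omega)]⟩
  cases t with
  | edge u v b => exact ⟨j, by simp [shift, shiftBy], hz⟩
  | vert l r =>
    simp only [descend, shift] at hz hlt ⊢
    split_ifs at hz hlt ⊢ with h₁ h₂
    · exact left l r rfl hz
    · refine ⟨l.parts.1.length + j, by simp [shiftBy]; omega, ?_⟩
      rwa [getElem?_vert_right ht.2.2 (by dsimp only at hlt; omega)]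
    · exact left l r rfl hz
  | horiz b l r =>
    simp only [descend, shift] at hz hlt ⊢
    split_ifs at hz hlt ⊢ with h
    · exact ⟨j, by simp [shiftBy], by rwa [getElem?_horiz_left b (by dsimp only at hlt; omega)]⟩
    · by_cases hj : j = 0
      · subst hj
        exact ⟨0, by simp [shiftBy], by simpa [localOrder, top, ht.2.2.1] using hz⟩
      · refine ⟨j + l.headList.length, ?_, ?_⟩
        · rw [shiftBy, if_pos (by dsimp only; omega)]; dsimp only; omega
        · rwa [getElem?_horiz_right b (by omega)]

/-- With both flags off, a common boundary node is followed into the cluster in which it is a head.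
A node other than the top thus remains a head, and the descent follows the tree edge towards it. -/
theorem descend_head_pos (h : t.IsInternal) (hk : 0 < k) : 0 < (t.descend false false k).2 := by
  cases t with
  | edge u v b => exact h.elim
  | vert l r =>
    obtain ⟨L, hL⟩ := l.parts_fst
    have : 0 < l.parts.1.length := by rw [hL]; simp
    simp only [descend, Bool.toNat_false, add_zero]
    split_ifs <;> simp only <;> omega
  | horiz b l r =>
    simp only [descend, Bool.false_eq_true, false_and, not_false_iff, and_true]
    split_ifs <;> simp only <;> omega

end descend

theorem mem_headList_of_pos {t : TopTree V} {k : ℕ} {x : V} (hk : 0 < k)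
    (hx : t.localOrder[k]? = some x) : x ∈ t.headList := by
  obtain ⟨j, rfl⟩ := Nat.exists_eq_add_of_lt hk
  rw [localOrder, show 0 + j + 1 = j + 1 by omega, List.getElem?_cons_succ] at hx
  exact List.mem_of_getElem? hx

theorem headList_subset {s t : TopTree V} (hs : s ∈ t.vertices) : s.headList ⊆ t.headList := by
  induction t with
  | edge u v b => simp only [vertices, List.mem_singleton] at hs; rw [hs]; exact List.Subset.refl _
  | vert l r ihl ihr =>
    simp only [vertices, List.mem_cons, List.mem_append] at hs
    intro x hx
    rcases hs with rfl | hs | hs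
    · exact hx
    · have := ihl hs hx
      rw [headList, List.mem_append] at this
      rw [headList_vert]; simp only [List.mem_append]; tauto
    · have := ihr hs hx
      rw [headList_vert]; simp only [List.mem_append]; tauto
  | horiz b l r ihl ihr =>
    simp only [vertices, List.mem_cons, List.mem_append] at hs
    intro x hx
    rw [headList_horiz, List.mem_append] at *
    rcases hs with rfl | hs | hs
    · rwa [headList_horiz, List.mem_append] at hx
    · exact Or.inl (ihl hs hx)
    · exact Or.inr (ihr hs hx)

theorem disjoint_headList_vert {l r : TopTree V} (h : (vert l r).localOrder.Nodup) {x : V}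
    (hl : x ∈ l.headList) (hr : x ∈ r.headList) : False := by
  rw [localOrder, List.nodup_cons, headList_vert] at h
  rw [headList, List.mem_append] at hl
  have := h.2
  grind

theorem disjoint_headList_horiz {b : Bool} {l r : TopTree V} (h : (horiz b l r).localOrder.Nodup)
    {x : V} (hl : x ∈ l.headList) (hr : x ∈ r.headList) : False := by
  rw [localOrder, List.nodup_cons, headList_horiz] at h
  have := h.2
  grind

/-- All clusters with a tree edge towards `x` lie on the path of the descent. -/
theorem mem_vertices_descend {E : V → V → Bool → Prop} {t s : TopTree V} (ht : t.Wf E)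
    (hn : t.localOrder.Nodup) {k : ℕ} (hk : 0 < k) {x : V} (hx : t.localOrder[k]? = some x)
    (hs : s ∈ t.vertices) (hst : s ≠ t) (hxs : x ∈ s.headList) :
    s ∈ (t.descend false false k).1.vertices := by
  have hi : t.IsInternal := by
    cases t with
    | edge u v b => exact (hst (by simpa [vertices] using hs)).elim
    | vert l r => trivial
    | horiz b l r => trivial
  have hx' := mem_headList_of_pos (descend_head_pos k hi hk) (getElem?_descend false false k ht hx)
  cases t with
  | edge u v b => exact hi.elim
  | vert l r =>
    simp only [vertices, List.mem_cons, List.mem_append, hst, false_or] at hs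
    have hl (h : s ∈ l.vertices) : x ∈ l.headList := headList_subset h hxs
    have hr (h : s ∈ r.vertices) : x ∈ r.headList := headList_subset h hxs
    have hd := fun h => disjoint_headList_vert hn (x := x) h
    simp only [descend] at hx' ⊢
    split_ifs at hx' ⊢ <;> dsimp only at hx' ⊢ <;> tauto
  | horiz b l r =>
    simp only [vertices, List.mem_cons, List.mem_append, hst, false_or] at hs
    have hl (h : s ∈ l.vertices) : x ∈ l.headList := headList_subset h hxs
    have hr (h : s ∈ r.vertices) : x ∈ r.headList := headList_subset h hxs
    have hd := fun h => disjoint_headList_horiz hn (x := x) h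
    simp only [descend] at hx' ⊢
    split_ifs at hx' ⊢ <;> dsimp only at hx' ⊢ <;> tauto

/-! ### The edges that leave a node -/

theorem bot_mem_headList (t : TopTree V) : t.bot ∈ t.headList := by
  obtain ⟨L, hL⟩ := t.parts_fst
  simp [headList, hL]

/-- Edges start in the cluster, but not in the bottom boundary node. -/
theorem mem_edges {E : V → V → Bool → Prop} {t : TopTree V} (ht : t.Wf E)
    (hn : t.localOrder.Nodup) {e : V × Bool} (he : e ∈ t.edges) :
    e.1 ∈ t.localOrder ∧ e.1 ≠ t.bot := by
  induction t with
  | edge u v b =>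
    simp only [edges, List.mem_singleton] at he
    subst he
    simp only [localOrder, headList, parts, top, bot] at hn ⊢
    simp at hn ⊢
    exact hn
  | vert l r ihl ihr =>
    have sl := localOrder_left_vert l r
    have sr := localOrder_right_vert (l := l) (r := r) ht.2.2
    rw [edges, List.mem_append] at he
    rcases he with he | he
    · obtain ⟨h₁, h₂⟩ := ihl ht.1 (hn.sublist sl) he
      refine ⟨sl.subset h₁, ?_⟩
      rw [bot]
      intro h
      rw [h] at h₁
      have h₃ := r.bot_mem_headList
      rcases List.mem_cons.1 h₁ with h₄ | h₄
      · rw [localOrder, List.nodup_cons, headList_vert] at hn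
        refine hn.1 ?_
        rw [top, ← h₄]
        simp [h₃]
      · exact disjoint_headList_vert hn h₄ h₃
    · obtain ⟨h₁, h₂⟩ := ihr ht.2.1 (hn.sublist sr) he
      exact ⟨sr.subset h₁, h₂⟩
  | horiz b l r ihl ihr =>
    have sl := localOrder_left_horiz b l r
    have sr := localOrder_right_horiz b (l := l) (r := r) ht.2.2.1
    have key : ∀ x ∈ l.headList, x ∈ r.localOrder → False := by
      intro x hx hx'
      rcases List.mem_cons.1 hx' with h | h
      · rw [localOrder, List.nodup_cons, headList_horiz] at hn
        refine hn.1 ?_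
        rw [top, ← ht.2.2.1, ← h]
        simp [hx]
      · exact disjoint_headList_horiz hn hx h
    have key' : ∀ x ∈ r.headList, x ∈ l.localOrder → False := by
      intro x hx hx'
      rcases List.mem_cons.1 hx' with h | h
      · rw [localOrder, List.nodup_cons, headList_horiz] at hn
        refine hn.1 ?_
        rw [top, ← h]
        simp [hx]
      · exact disjoint_headList_horiz hn h hx
    rw [edges, List.mem_append] at he
    rcases he with he | he
    · obtain ⟨h₁, h₂⟩ := ihl ht.1 (hn.sublist sl) he
      refine ⟨sl.subset h₁, ?_⟩
      cases b
      · exact h₂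
      · rintro h; rw [h] at h₁; exact key' _ r.bot_mem_headList h₁
    · obtain ⟨h₁, h₂⟩ := ihr ht.2.1 (hn.sublist sr) he
      refine ⟨sr.subset h₁, ?_⟩
      cases b
      · rintro h; rw [h] at h₁; exact key _ l.bot_mem_headList h₁
      · exact h₂

/-- The edges that leave the top boundary node. -/
theorem mem_firsts {E : V → V → Bool → Prop} {t : TopTree V} (ht : t.Wf E)
    (hn : t.localOrder.Nodup) {b : Bool} (he : (t.top, b) ∈ t.edges) : b ∈ t.firsts := by
  induction t with
  | edge u v b' => simpa [edges, firsts, top] using he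
  | vert l r ihl ihr =>
    have sl := localOrder_left_vert l r
    have sr := localOrder_right_vert (l := l) (r := r) ht.2.2
    rw [edges, List.mem_append] at he
    rcases he with he | he
    · exact ihl ht.1 (hn.sublist sl) he
    · obtain ⟨h₁, -⟩ := mem_edges ht.2.1 (hn.sublist sr) he
      rw [localOrder, List.nodup_cons, headList_vert] at hn
      exfalso
      refine hn.1 ?_
      simp only [top] at h₁ ⊢
      rcases List.mem_cons.1 h₁ with h | h
      · obtain ⟨L, hL⟩ := l.parts_fst
        rw [h, ht.2.2, hL]; simp
      · simp [h]
  | horiz b' l r ihl ihr =>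
    have sl := localOrder_left_horiz b' l r
    have sr := localOrder_right_horiz b' (l := l) (r := r) ht.2.2.1
    rw [edges, List.mem_append] at he
    rw [firsts, List.mem_append]
    rcases he with he | he
    · exact Or.inl (ihl ht.1 (hn.sublist sl) he)
    · exact Or.inr (ihr ht.2.1 (hn.sublist sr) (ht.2.2.1 ▸ he))

/-- The descent with `tl = true` and `tr = b` follows the `b`-edge of a node. -/
theorem mem_edges_descend {E : V → V → Bool → Prop} {t : TopTree V} (ht : t.Wf E)
    (hn : t.localOrder.Nodup) {k : ℕ} {x : V} {b : Bool} (hx : t.localOrder[k]? = some x)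
    (he : (x, b) ∈ t.edges) : (x, b) ∈ (t.descend true b k).1.edges := by
  have hx' := getElem?_descend true b k ht hx
  cases t with
  | edge u v b' => exact he
  | vert l r =>
    have sl := localOrder_left_vert l r
    have sr := localOrder_right_vert (l := l) (r := r) ht.2.2
    -- The only node common to `l` and `r` is the bottom boundary node of `l`, and no edge of `l`
    -- starts there. So the edges leaving it lie in `r`, which is where `tl = true` leads.
    have hl (h : (x, b) ∈ l.edges) : x ∉ r.localOrder := fun h' => by
      obtain ⟨h₁, h₂⟩ := mem_edges ht.1 (hn.sublist sl) h
      rcases List.mem_cons.1 h' with h₃ | h₃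
      · exact h₂ (h₃.trans ht.2.2)
      · rcases List.mem_cons.1 h₁ with h₄ | h₄
        · rw [localOrder, List.nodup_cons, headList_vert] at hn
          refine hn.1 ?_
          dsimp only at h₄
          rw [top, ← h₄]; simp [h₃]
        · exact disjoint_headList_vert hn h₄ h₃
    have hr (h : (x, b) ∈ r.edges) : ∃ j ≤ r.headList.length, k = l.parts.1.length + j := by
      obtain ⟨h₁, -⟩ := mem_edges ht.2.1 (hn.sublist sr) h
      obtain ⟨j, hj⟩ := List.mem_iff_getElem?.1 h₁
      have hj' := (List.getElem?_eq_some_iff.1 hj).1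
      rw [localOrder_length] at hj'
      refine ⟨j, by omega, ?_⟩
      rw [← getElem?_vert_right ht.2.2 (by omega)] at hj
      exact (List.getElem?_inj (List.getElem?_eq_some_iff.1 hx).1 hn).1 (hx.trans hj.symm)
    rw [edges, List.mem_append] at he
    simp only [descend, Bool.toNat_true] at hx' ⊢
    split_ifs at hx' ⊢ with h₁ h₂
    · refine he.resolve_right fun h => ?_
      obtain ⟨j, _, _⟩ := hr h; omega
    · exact he.resolve_left fun h => hl h (List.mem_of_getElem? hx')
    · refine he.resolve_right fun h => ?_
      obtain ⟨j, _, _⟩ := hr h; omega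
  | horiz b' l r =>
    have sl := localOrder_left_horiz b' l r
    have sr := localOrder_right_horiz b' (l := l) (r := r) ht.2.2.1
    have hkS (h : x ∈ l.headList) : 0 < k ∧ k ≤ l.headList.length := by
      obtain ⟨j, hj⟩ := List.mem_iff_getElem?.1 h
      have hj' := (List.getElem?_eq_some_iff.1 hj).1
      have : (horiz b' l r).localOrder[j + 1]? = some x := by
        rw [getElem?_horiz_left b' (by omega), localOrder, List.getElem?_cons_succ, hj]
      have := (List.getElem?_inj (List.getElem?_eq_some_iff.1 hx).1 hn).1 (hx.trans this.symm)
      omega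
    have h0 : k = 0 ↔ x = l.top := by
      constructor
      · rintro rfl; simpa [localOrder, top] using hx.symm
      · intro h
        refine (List.getElem?_inj (List.getElem?_eq_some_iff.1 hx).1 hn).1 (hx.trans ?_)
        simp [localOrder, top, h]
    rw [edges, List.mem_append] at he
    -- At the common top the edge labels separate the children: the left one contains only the
    -- `0`-edge and the right one only the `1`-edge, so `tr = b` makes the right choice.
    have hl (h : (x, b) ∈ l.edges) : (0 < k ∧ k ≤ l.headList.length) ∨ (k = 0 ∧ b = false) := by
      obtain ⟨h₁, -⟩ := mem_edges ht.1 (hn.sublist sl) h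
      rcases List.mem_cons.1 h₁ with h₂ | h₂
      · dsimp only at h₂
        rw [h₂] at h
        have := mem_firsts ht.1 (hn.sublist sl) h
        rw [ht.2.2.2.1] at this
        exact Or.inr ⟨h0.2 h₂, by simpa using this⟩
      · exact Or.inl (hkS h₂)
    have hr (h : (x, b) ∈ r.edges) : x ∈ r.headList ∨ (k = 0 ∧ b = true) := by
      obtain ⟨h₁, -⟩ := mem_edges ht.2.1 (hn.sublist sr) h
      rcases List.mem_cons.1 h₁ with h₂ | h₂
      · dsimp only at h₂
        rw [h₂] at h
        have := mem_firsts ht.2.1 (hn.sublist sr) h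
        rw [ht.2.2.2.2] at this
        exact Or.inr ⟨h0.2 (h₂.trans ht.2.2.1), by simpa using this⟩
      · exact Or.inl h₂
    simp only [descend] at hx' ⊢
    split_ifs at hx' ⊢ with h
    · refine he.resolve_right fun h' => ?_
      rcases hr h' with h₁ | ⟨h₁, h₂⟩
      · rcases Nat.eq_zero_or_pos k with h₂ | h₂
        · rw [localOrder, List.nodup_cons, headList_horiz] at hn
          refine hn.1 ?_
          rw [top, ← h0.1 h₂]; simp [h₁]
        · exact disjoint_headList_horiz hn (mem_headList_of_pos h₂ hx') h₁
      · exact h.2 ⟨h₂, h₁⟩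
    · refine he.resolve_left fun h' => ?_
      rcases hl h' with ⟨h₁, h₂⟩ | ⟨h₁, h₂⟩
      · exact h ⟨h₂, fun h => by omega⟩
      · exact h ⟨by omega, fun h => by simp [h₂] at h⟩

end TopTree

/-! ## Clusters of a ZDD and their keys -/

/-- In a sublist, the elements that do not come after entry `k` in the large list are its first `k +
1` entries. This reconciles a preorder defined by counting with a position in a list. -/
theorem List.Sublist.card_filter_idxOf {α : Type*} [DecidableEq α] {L M : List α}
    (h : L.Sublist M) (hM : M.Nodup) {k : ℕ} {x : α} (hx : L[k]? = some x) :
    (L.toFinset.filter fun y => M.idxOf y + 1 ≤ M.idxOf x + 1).card = k + 1 := by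
  have hL := hM.sublist h
  have hp : M.Pairwise fun a b => M.idxOf a < M.idxOf b := by
    rw [List.pairwise_iff_getElem]
    intro i j hi hj hij
    rwa [hM.idxOf_getElem, hM.idxOf_getElem]
  have hp := hp.sublist h
  obtain ⟨hk, rfl⟩ := List.getElem?_eq_some_iff.1 hx
  have : L.toFinset.filter (fun y => M.idxOf y + 1 ≤ M.idxOf L[k] + 1) =
      (L.take (k + 1)).toFinset := by
    ext y
    simp only [Finset.mem_filter, List.mem_toFinset, List.mem_take_iff_getElem,
      add_le_add_iff_right]
    constructor
    · rintro ⟨hy, hle⟩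
      obtain ⟨j, hj, rfl⟩ := List.mem_iff_getElem.1 hy
      refine ⟨j, ?_, rfl⟩
      by_contra hjk
      have := List.pairwise_iff_getElem.1 hp k j hk hj (by omega)
      omega
    · rintro ⟨j, hj, rfl⟩
      refine ⟨List.getElem_mem _, ?_⟩
      rcases Nat.lt_or_ge j k with h | h
      · exact (List.pairwise_iff_getElem.1 hp j k _ hk h).le
      · have : j = k := by omega
        subst this; rfl
  rw [this, List.toFinset_card_of_nodup (hL.sublist (List.take_sublist _ _)), List.length_take]
  omega

namespace Shape

/-- The numbers of heads before and after the nodes below the bottom boundary node. -/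
def lens : Shape → ℕ × ℕ
  | edge _ _ _ => (1, 0)
  | vert l r _ => (l.lens.1 + r.lens.1, r.lens.2 + l.lens.2)
  | horiz false l r _ => (l.lens.1, l.lens.2 + (r.lens.1 + r.lens.2))
  | horiz true l r _ => (l.lens.1 + l.lens.2 + r.lens.1, r.lens.2)

/-- The label difference of the two boundary nodes. -/
def diff : Shape → ℕ
  | edge _ d _ => d
  | vert l r _ => l.diff + r.diff
  | horiz false l _ _ => l.diff
  | horiz true _ r _ => r.diff

def infos : Shape → List EdgeInfo
  | edge _ _ i => i
  | vert _ _ i => i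
  | horiz _ _ _ i => i

end Shape

-- What a key determines about its clusters

namespace ZDD

open TopTree

variable {V : Type*} [Fintype V] [DecidableEq V] {c : ℕ} (G : ZDD V c)

/-- `t` is a cluster of the spanning tree of `G`. -/
def IsCluster (t : TopTree V) : Prop := t.Wf G.IsEdge ∧ t.localOrder.Sublist G.order

variable {G} {s t t' : TopTree V}

theorem IsCluster.nodup (ht : G.IsCluster t) : t.localOrder.Nodup := G.nodup_order.sublist ht.2

theorem IsCluster.of_mem_vertices (ht : G.IsCluster t) (hs : s ∈ t.vertices) : G.IsCluster s :=
  ⟨ht.1.of_mem_vertices hs, (localOrder_sublist ht.1 hs).trans ht.2⟩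

theorem IsCluster.left_vert {l r : TopTree V} (ht : G.IsCluster (vert l r)) : G.IsCluster l :=
  ht.of_mem_vertices (by simp [vertices, self_mem_vertices])

theorem IsCluster.localPre (ht : G.IsCluster t) {k : ℕ} {x : V}
    (hx : t.localOrder[k]? = some x) : G.localPre t x = k + 1 := by
  rw [ZDD.localPre, nodes_eq ht.1]
  exact ht.2.card_filter_idxOf G.nodup_order hx

theorem IsCluster.card_nodes (ht : G.IsCluster t) : t.nodes.card = t.headList.length + 1 := by
  rw [nodes_eq ht.1, List.toFinset_card_of_nodup ht.nodup, localOrder_length]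

theorem IsCluster.length_le (ht : G.IsCluster t) : t.headList.length + 1 ≤ Fintype.card V := by
  rw [← localOrder_length, ← G.length_order]
  exact ht.2.length_le

/-- The boundary node closes the first part of `l`, so the number stored for a vertical merge is the
length of that part, plus one for the top. -/
theorem IsCluster.localPre_vert {l r : TopTree V} (ht : G.IsCluster (vert l r)) :
    G.localPre l r.top = l.parts.1.length + 1 := by
  refine ht.left_vert.localPre ?_
  rw [← getElem?_vert_left le_rfl, ← Nat.add_zero l.parts.1.length,
    getElem?_vert_right ht.1.2.2 (Nat.zero_le _)]
  rfl

theorem getElem?_order_pre {x : V} {i : ℕ} (h : G.order[i]? = some x) : G.pre x = i + 1 := by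
  obtain ⟨hi, rfl⟩ := List.getElem?_eq_some_iff.1 h
  rw [pre, G.nodup_order.idxOf_getElem]

theorem getElem?_pre (x : V) : G.order[G.pre x - 1]? = some x := by
  rw [pre, Nat.add_sub_cancel, List.getElem?_eq_some_iff]
  exact ⟨List.idxOf_lt_length_of_mem (G.mem_order x), List.getElem_idxOf _⟩

theorem pre_pos (x : V) : 0 < G.pre x := Nat.succ_pos _

theorem pre_le (x : V) : G.pre x ≤ Fintype.card V := by
  rw [← G.length_order]
  exact List.idxOf_lt_length_of_mem (G.mem_order x)

/-- Differences add up along the path between the boundary nodes. Truncated subtraction does no harm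
because labels increase along edges. -/
theorem label_top_add_diff (ht : t.Wf G.IsEdge) :
    G.label t.bot = G.label t.top + (G.key t).diff := by
  induction t with
  | edge u v b =>
    have := G.label_lt ht
    simp only [bot, top, key, Shape.diff]
    omega
  | vert l r ihl ihr =>
    have h₁ := ihl ht.1
    have h₂ := ihr ht.2.1
    rw [ht.2.2] at h₂
    simp only [bot, top, key, Shape.diff]
    omega
  | horiz b l r ihl ihr =>
    have h₁ := ihl ht.1
    have h₂ := ihr ht.2.1
    rw [ht.2.2.1] at h₂
    cases b <;> simpa only [bot, top, key, Shape.diff]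

/-- Identified clusters therefore have equal sizes and their bottom boundary nodes at equal
positions. -/
theorem lens_key (t : TopTree V) :
    (G.key t).lens = (t.parts.1.length, t.parts.2.length) := by
  induction t with
  | edge u v b => rfl
  | vert l r ihl ihr => simp [key, Shape.lens, ihl, ihr, parts]
  | horiz b l r ihl ihr => cases b <;> simp [key, Shape.lens, ihl, ihr, parts, add_assoc]

theorem parts_length_of_key (h : G.key s = G.key t) : s.parts.1.length = t.parts.1.length := by
  have := lens_key (G := G) s
  rw [h, lens_key] at this
  exact (congrArg Prod.fst this).symm

theorem headList_length_of_key (h : G.key s = G.key t) :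
    s.headList.length = t.headList.length := by
  have := lens_key (G := G) s
  rw [h, lens_key, Prod.mk.injEq] at this
  simp only [headList, List.length_append]
  omega

theorem infos_key (t : TopTree V) : (G.key t).infos = (G.assigned t).map (G.edgeInfo t) := by
  cases t <;> rfl

/-- The information about the complement edges kept in a vertex. -/
def innerInfos (G : ZDD V c) (t : TopTree V) : List EdgeInfo := (G.innerEdges t).map (G.edgeInfo t)

/-- Whether edges are kept depends on the number of clusters with the same key, hence again on the
key only. -/
theorem innerInfos_of_key (h : G.key s = G.key t) : G.innerInfos s = G.innerInfos t := by
  have h₁ : G.shared s = G.shared t := by simp only [shared, h]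
  have h₂ := infos_key (G := G) s
  rw [h, infos_key] at h₂
  simp only [innerInfos, innerEdges, h₁]
  split_ifs
  · exact h₂.symm
  · rfl

theorem key_eq_vert {l r : TopTree V} (h : G.key s = G.key (vert l r)) :
    ∃ l' r', s = vert l' r' ∧ G.key l' = G.key l ∧ G.key r' = G.key r := by
  cases s with
  | edge u v b => simp [key] at h
  | vert l' r' => simp only [key, Shape.vert.injEq] at h; exact ⟨l', r', rfl, h.1, h.2.1⟩
  | horiz b l' r' => simp [key] at h

theorem key_eq_horiz {b : Bool} {l r : TopTree V} (h : G.key s = G.key (horiz b l r)) :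
    ∃ l' r', s = horiz b l' r' ∧ G.key l' = G.key l ∧ G.key r' = G.key r := by
  cases s with
  | edge u v b => simp [key] at h
  | vert l' r' => simp [key] at h
  | horiz b' l' r' =>
    simp only [key, Shape.horiz.injEq] at h
    exact ⟨l', r', by rw [h.1], h.2.1, h.2.2.1⟩

theorem key_eq_edge {u v : V} {b : Bool} (h : G.key s = G.key (edge u v b)) :
    ∃ u' v', s = edge u' v' b ∧ G.label v' - G.label u' = G.label v - G.label u := by
  cases s with
  | edge u' v' b' =>
    simp only [key, Shape.edge.injEq] at h
    exact ⟨u', v', by rw [h.1], h.2.1⟩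
  | vert l' r' => simp [key] at h
  | horiz b' l' r' => simp [key] at h

/-- The label difference stored for a vertical merge. -/
theorem labelDiff_of_key {l r l' r' : TopTree V} (ht : (vert l r).Wf G.IsEdge)
    (ht' : (vert l' r').Wf G.IsEdge) (h : G.key l' = G.key l) :
    G.label r.top = G.label l.top + (G.label r'.top - G.label l'.top) := by
  have h₁ := label_top_add_diff ht.1
  have h₂ := label_top_add_diff ht'.1
  rw [ht.2.2, ht'.2.2, h₁, h₂, h]
  omega

/-! ### Complement edges -/

theorem mem_complementEdges {e : V × Bool} : e ∈ G.complementEdges ↔ e ∉ G.treeEdges := by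
  simp only [complementEdges, List.mem_filter, List.mem_flatMap, decide_eq_true_eq,
    and_iff_right_iff_imp]
  intro _
  refine ⟨e.1, G.mem_order _, ?_⟩
  obtain ⟨x, b⟩ := e
  cases b <;> simp

/-- Complement edges are ordered by starting points and types. -/
theorem pairwise_complementEdges : G.complementEdges.Pairwise fun e e' =>
    2 * G.pre e.1 + e.2.toNat < 2 * G.pre e'.1 + e'.2.toNat := by
  refine List.Pairwise.filter _ ?_
  rw [List.pairwise_flatMap]
  refine ⟨fun u _ => by simp, ?_⟩
  rw [List.pairwise_iff_getElem]
  intro i j hi hj hij e he e' he'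
  have h₁ : G.pre e.1 = i + 1 := getElem?_order_pre (by
    rw [List.getElem?_eq_getElem hi]; simp at he; rcases he with rfl | rfl <;> rfl)
  have h₂ : G.pre e'.1 = j + 1 := getElem?_order_pre (by
    rw [List.getElem?_eq_getElem hj]; simp at he'; rcases he' with rfl | rfl <;> rfl)
  have := Bool.toNat_le e.2
  omega

theorem assigned_sublist (t : TopTree V) : (G.assigned t).Sublist G.complementEdges := by
  cases t <;> exact List.filter_sublist

theorem innerEdges_subset_assigned (t : TopTree V) : (G.innerEdges t).Sublist (G.assigned t) := by
  rw [innerEdges]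
  split_ifs
  · exact List.Sublist.refl _
  · exact List.nil_sublist _

theorem innerEdges_sublist (t : TopTree V) : (G.innerEdges t).Sublist G.complementEdges :=
  (innerEdges_subset_assigned t).trans (assigned_sublist t)

/-- Both ends of an edge assigned to a cluster are lower ends of its edges. -/
theorem mem_assigned {e : V × Bool} (he : e ∈ G.assigned t) : e.1 ∈ t.headList ∧
    ∀ y, G.child e.2 e.1 = Sum.inl y → y ∈ t.headList := by
  cases t with
  | edge u v b =>
    simp only [assigned, List.mem_filter, decide_eq_true_eq] at he
    refine ⟨by simp [headList, parts, he.2.1], fun y hy => ?_⟩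
    have := he.2.2
    rw [hy] at this
    simp at this
  | vert l r =>
    simp only [assigned, List.mem_filter] at he
    cases hc : G.child e.2 e.1 with
    | inr τ => rw [hc] at he; simp at he
    | inl y =>
      rw [hc] at he
      simp only [decide_eq_true_eq, mem_heads] at he
      have hl : ∀ z ∈ l.headList, z ∈ (vert l r).headList :=
        headList_subset (by simp [vertices, self_mem_vertices])
      have hr : ∀ z ∈ r.headList, z ∈ (vert l r).headList :=
        headList_subset (by simp [vertices, self_mem_vertices])
      rcases he.2 with h | h
      · exact ⟨hl _ h.1, fun z hz => by cases hz; exact hr _ h.2⟩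
      · exact ⟨hr _ h.1, fun z hz => by cases hz; exact hl _ h.2⟩
  | horiz b l r =>
    simp only [assigned, List.mem_filter] at he
    cases hc : G.child e.2 e.1 with
    | inr τ => rw [hc] at he; simp at he
    | inl y =>
      rw [hc] at he
      simp only [decide_eq_true_eq, mem_heads] at he
      have hl : ∀ z ∈ l.headList, z ∈ (horiz b l r).headList :=
        headList_subset (by simp [vertices, self_mem_vertices])
      have hr : ∀ z ∈ r.headList, z ∈ (horiz b l r).headList :=
        headList_subset (by simp [vertices, self_mem_vertices])
      rcases he.2 with h | h
      · exact ⟨hl _ h.1, fun z hz => by cases hz; exact hr _ h.2⟩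
      · exact ⟨hr _ h.1, fun z hz => by cases hz; exact hl _ h.2⟩

theorem mem_innerEdges {e : V × Bool} (he : e ∈ G.innerEdges t) : e.1 ∈ t.headList ∧
    ∀ y, G.child e.2 e.1 = Sum.inl y → y ∈ t.headList :=
  mem_assigned ((innerEdges_subset_assigned t).subset he)

/-- The value by which the stored edges of a cluster are sorted. -/
def infoKey (i : EdgeInfo) : ℕ := 2 * i.src + i.bit.toNat

theorem exists_position {x : V} (h : x ∈ t.headList) :
    ∃ k, 0 < k ∧ t.localOrder[k]? = some x := by
  obtain ⟨j, hj⟩ := List.mem_iff_getElem?.1 h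
  exact ⟨j + 1, Nat.succ_pos j, by rw [localOrder, List.getElem?_cons_succ, hj]⟩

theorem IsCluster.lt_iff (ht : G.IsCluster t) {i j : ℕ} {x y : V} (hx : t.localOrder[i]? = some x)
    (hy : t.localOrder[j]? = some y) : i < j ↔ G.pre x < G.pre y := by
  have hp : t.localOrder.Pairwise fun a b => G.pre a < G.pre b := by
    refine List.Pairwise.sublist ht.2 ?_
    rw [List.pairwise_iff_getElem]
    intro i j hi hj hij
    rw [getElem?_order_pre (List.getElem?_eq_getElem hi),
      getElem?_order_pre (List.getElem?_eq_getElem hj)]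
    omega
  obtain ⟨hi, rfl⟩ := List.getElem?_eq_some_iff.1 hx
  obtain ⟨hj, rfl⟩ := List.getElem?_eq_some_iff.1 hy
  have h := List.pairwise_iff_getElem.1 hp
  refine ⟨h i j hi hj, fun hlt => ?_⟩
  by_contra hij
  rcases Nat.lt_or_ge j i with h' | h'
  · have := h j i hj hi h'; omega
  · have : i = j := by omega
    subst this; omega

/-- Local positions compare like global preorders, so the stored order is strictly increasing in
local terms as well, as binary search requires. -/
theorem pairwise_innerInfos (ht : G.IsCluster t) :
    (G.innerInfos t).Pairwise fun i j => infoKey i < infoKey j := by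
  rw [innerInfos, List.pairwise_map]
  refine List.Pairwise.imp_of_mem ?_ (pairwise_complementEdges.sublist (innerEdges_sublist t))
  intro e e' he he' h
  obtain ⟨i, -, hi⟩ := exists_position (mem_innerEdges he).1
  obtain ⟨j, -, hj⟩ := exists_position (mem_innerEdges he').1
  have h₁ := ht.lt_iff hi hj
  have h₂ := ht.lt_iff hj hi
  have := Bool.toNat_le e.2
  have := Bool.toNat_le e'.2
  simp only [infoKey, edgeInfo, ht.localPre hi, ht.localPre hj]
  omega

/-- The edge with a given starting point and type. -/
theorem mem_innerEdges_of_infoKey (ht : G.IsCluster t) {k : ℕ} {x : V}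
    (hx : t.localOrder[k]? = some x) {b : Bool} {i : EdgeInfo} (hi : i ∈ G.innerInfos t)
    (hk : infoKey i = 2 * (k + 1) + b.toNat) :
    (x, b) ∈ G.innerEdges t ∧ i = G.edgeInfo t (x, b) := by
  obtain ⟨e, he, rfl⟩ := List.mem_map.1 hi
  obtain ⟨j, -, hj⟩ := exists_position (mem_innerEdges he).1
  simp only [infoKey, edgeInfo, ht.localPre hj] at hk
  have := Bool.toNat_le e.2
  have := Bool.toNat_le b
  have hjk : j = k := by omega
  have hb : e.2 = b := by
    have : e.2.toNat = b.toNat := by omega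
    revert this; cases e.2 <;> cases b <;> simp
  subst hjk
  rw [hx] at hj
  cases hj
  subst hb
  exact ⟨he, rfl⟩

theorem infoKey_edgeInfo (ht : G.IsCluster t) {k : ℕ} {x : V}
    (hx : t.localOrder[k]? = some x) (b : Bool) :
    infoKey (G.edgeInfo t (x, b)) = 2 * (k + 1) + b.toNat := by
  simp only [infoKey, edgeInfo, ht.localPre hx]

end ZDD

/-! ## The unfolded top DAG -/

namespace PTree

variable {α : Type*} {β : Type*}

def label : PTree α → α
  | dummy a => a
  | leaf a => a
  | node a _ _ => a

/-- `At P L I s`: the subtree `s` occurs in `P`, the leaves and internal vertices that precede its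
root in preorder being `L` and `I`. -/
inductive At (P : PTree α) : List (Bool × α) → List α → PTree α → Prop
  | root : At P [] [] P
  | left {L I a l r} : At P L I (node a l r) → At P L (I ++ [a]) l
  | right {L I a l r} : At P L I (node a l r) → At P (L ++ l.leaves) (I ++ a :: l.internals) r

theorem length_vertices (P : PTree α) :
    P.vertices.length = P.leaves.length + P.internals.length := by
  induction P with
  | dummy a => rfl
  | leaf a => rfl
  | node a l r ihl ihr =>
    simp only [vertices, leaves, internals, List.length_cons, List.length_append]
    omega

variable {P s u : PTree α} {L L' : List (Bool × α)} {I I' : List α}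

theorem At.trans (h : At P L I s) (h' : At s L' I' u) : At P (L ++ L') (I ++ I') u := by
  induction h' with
  | root => simpa using h
  | left _ ih => rw [← List.append_assoc]; exact ih.left
  | right _ ih => rw [← List.append_assoc, ← List.append_assoc]; exact ih.right

theorem At.leaves (h : At P L I s) : ∃ B, P.leaves = L ++ (s.leaves ++ B) := by
  induction h with
  | root => exact ⟨[], by simp⟩
  | left _ ih => obtain ⟨B, hB⟩ := ih; exact ⟨_, by rw [hB, PTree.leaves, List.append_assoc]⟩
  | right _ ih => obtain ⟨B, hB⟩ := ih; exact ⟨B, by rw [hB, PTree.leaves]; simp⟩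

theorem At.internals (h : At P L I s) : ∃ B, P.internals = I ++ (s.internals ++ B) := by
  induction h with
  | root => exact ⟨[], by simp⟩
  | left _ ih => obtain ⟨B, hB⟩ := ih; exact ⟨_, by rw [hB, PTree.internals]; simp; rfl⟩
  | right _ ih => obtain ⟨B, hB⟩ := ih; exact ⟨B, by rw [hB, PTree.internals]; simp⟩

theorem At.vertices (h : At P L I s) :
    ∃ A B, P.vertices = A ++ (s.vertices ++ B) ∧ A.length = L.length + I.length := by
  induction h with
  | root => exact ⟨[], [], by simp⟩
  | @left L I a l r _ ih =>
    obtain ⟨A, B, hB, hA⟩ := ih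
    refine ⟨A ++ [(false, a)], r.vertices ++ B, by rw [hB, PTree.vertices]; simp, ?_⟩
    simp only [List.length_append, List.length_singleton, hA]
    omega
  | @right L I a l r _ ih =>
    obtain ⟨A, B, hB, hA⟩ := ih
    refine ⟨A ++ ((false, a) :: l.vertices), B, by rw [hB, PTree.vertices]; simp, ?_⟩
    simp only [List.length_append, List.length_cons, hA, length_vertices]
    omega

/-- A vertex number is the number of preceding leaves plus that of preceding internal vertices;
splitting it this way gives the ranks needed to address the arrays. -/
theorem exists_at {j : ℕ} {v : Bool × α} (h : P.vertices[j]? = some v) :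
    ∃ L I s, At P L I s ∧ L.length + I.length = j ∧ s.vertices[0]? = some v := by
  induction P generalizing j with
  | dummy a =>
    rcases j with _ | j
    · exact ⟨[], [], _, .root, rfl, h⟩
    · simp [vertices] at h
  | leaf a =>
    rcases j with _ | j
    · exact ⟨[], [], _, .root, rfl, h⟩
    · simp [vertices] at h
  | node a l r ihl ihr =>
    rcases j with _ | j
    · exact ⟨[], [], _, .root, rfl, h⟩
    · rw [vertices, List.getElem?_cons_succ] at h
      rcases Nat.lt_or_ge j l.vertices.length with hj | hj
      · rw [List.getElem?_append_left hj] at h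
        obtain ⟨L, I, s, h₁, h₂, h₃⟩ := ihl h
        refine ⟨_, _, s, (At.root.left).trans h₁, ?_, h₃⟩
        simp; omega
      · rw [List.getElem?_append_right hj] at h
        obtain ⟨L, I, s, h₁, h₂, h₃⟩ := ihr h
        refine ⟨_, _, s, (At.root.right).trans h₁, ?_, h₃⟩
        rw [length_vertices] at h₂ hj
        simp; omega

theorem mem_vertices_of_at (h : At P L I s) {v : Bool × α} (hv : v ∈ s.vertices) :
    v ∈ P.vertices := by
  obtain ⟨A, B, hB, -⟩ := h.vertices
  rw [hB]; simp [hv]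

theorem label_mem_vertices (s : PTree α) : ∃ b, (b, s.label) ∈ s.vertices := by
  cases s <;> simp [label, vertices]

/-- For all vertices in preorder: the number of the right child (`0` for leaves), the number of
leaves that precede the vertex, and the number of leaves that precede the end of its subtree.
The first vertex has number `i`, and `n` leaves precede it. -/
def nodeTable (i n : ℕ) : PTree α → List (ℕ × ℕ × ℕ)
  | dummy _ => [(0, n, n + 1)]
  | leaf _ => [(0, n, n + 1)]
  | node _ l r =>
    (i + 1 + l.vertices.length, n, n + l.leaves.length + r.leaves.length) ::
      (nodeTable (i + 1) n l ++ nodeTable (i + 1 + l.vertices.length) (n + l.leaves.length) r)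

theorem length_nodeTable (i n : ℕ) (P : PTree α) :
    (P.nodeTable i n).length = P.vertices.length := by
  induction P generalizing i n with
  | dummy a => rfl
  | leaf a => rfl
  | node a l r ihl ihr => simp [nodeTable, vertices, ihl, ihr]

theorem At.nodeTable (h : At P L I s) : ∃ A B, P.nodeTable 0 0 =
    A ++ (s.nodeTable (L.length + I.length) L.length ++ B) ∧ A.length = L.length + I.length := by
  induction h with
  | root => exact ⟨[], [], by simp⟩
  | @left L I a l r _ ih =>
    obtain ⟨A, B, hB, hA⟩ := ih
    refine ⟨A ++ [(L.length + I.length + 1 + l.vertices.length, L.length,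
      L.length + l.leaves.length + r.leaves.length)],
      r.nodeTable (L.length + I.length + 1 + l.vertices.length) (L.length + l.leaves.length) ++ B,
      ?_, ?_⟩
    · rw [hB, PTree.nodeTable, List.append_assoc, List.cons_append, List.append_assoc,
        List.length_append, List.length_singleton, Nat.add_assoc L.length, List.singleton_append]
    · simp only [List.length_append, List.length_singleton, hA]
      omega
  | @right L I a l r _ ih =>
    obtain ⟨A, B, hB, hA⟩ := ih
    refine ⟨A ++ ((L.length + I.length + 1 + l.vertices.length, L.length,
      L.length + l.leaves.length + r.leaves.length) ::
        l.nodeTable (L.length + I.length + 1) L.length), B, ?_, ?_⟩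
    · rw [hB, PTree.nodeTable, List.append_assoc, List.cons_append, List.cons_append,
        List.append_assoc]
      congr 3
      simp only [List.length_append, List.length_cons, length_vertices]
      rw [show L.length + I.length + 1 + (l.leaves.length + l.internals.length) =
        L.length + l.leaves.length + (I.length + (l.internals.length + 1)) by omega]
    · simp only [List.length_append, List.length_cons, hA, length_nodeTable, length_vertices]
      omega

theorem le_of_mem_nodeTable {i n : ℕ} {x : ℕ × ℕ × ℕ} (hx : x ∈ P.nodeTable i n) :
    x.1 ≤ i + P.vertices.length ∧ x.2.1 ≤ n + P.vertices.length ∧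
      x.2.2 ≤ n + P.vertices.length := by
  induction P generalizing i n with
  | dummy a => simp only [nodeTable, List.mem_singleton] at hx; simp [hx, vertices]
  | leaf a => simp only [nodeTable, List.mem_singleton] at hx; simp [hx, vertices]
  | node a l r ihl ihr =>
    have h₁ := l.length_vertices
    have h₂ := r.length_vertices
    simp only [nodeTable, List.mem_cons, List.mem_append] at hx
    simp only [vertices, List.length_cons, List.length_append]
    rcases hx with rfl | hx | hx
    · dsimp only; omega
    · have := ihl hx; omega
    · have := ihr hx; omega

theorem length_bp (P : PTree α) : P.bp.length = 2 * P.vertices.length := by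
  induction P with
  | dummy a => rfl
  | leaf a => rfl
  | node a l r ihl ihr =>
    simp only [bp, vertices, List.length_append, List.length_cons, List.length_nil, ihl, ihr]
    omega

/-- The balanced parentheses sequence determines the shape of the tree. -/
theorem nodeTable_eq_of_bp (P : PTree α) : ∀ (Q : PTree β) (x y : List Bool),
    P.bp ++ x = Q.bp ++ y → x = y ∧ P.vertices.length = Q.vertices.length ∧
      P.leaves.length = Q.leaves.length ∧ ∀ i n, P.nodeTable i n = Q.nodeTable i n := by
  -- Every sequence begins with an opening parenthesis, so the second bit tells a leaf from an
  -- internal vertex. Dummies and proper leaves look alike, but they also have the same table. The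
  -- tails `x` and `y` let the two subtrees be split off one after the other.
  have hc : ∀ {γ : Type _} (Q : PTree γ), ∃ z, Q.bp = true :: z := fun Q => by
    cases Q <;> simp [bp]
  have hc' : ∀ Q : PTree β, ∃ z, Q.bp = true :: z := fun Q => by
    cases Q <;> simp [bp]
  induction P with
  | dummy a =>
    intro Q x y h
    cases Q with
    | dummy b => simpa [bp, vertices, leaves, nodeTable] using h
    | leaf b => simpa [bp, vertices, leaves, nodeTable] using h
    | node b l r =>
      obtain ⟨z, hz⟩ := hc' l
      simp [bp, hz] at h
  | leaf a =>
    intro Q x y h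
    cases Q with
    | dummy b => simpa [bp, vertices, leaves, nodeTable] using h
    | leaf b => simpa [bp, vertices, leaves, nodeTable] using h
    | node b l r =>
      obtain ⟨z, hz⟩ := hc' l
      simp [bp, hz] at h
  | node a l r ihl ihr =>
    intro Q x y h
    cases Q with
    | dummy b =>
      obtain ⟨z, hz⟩ := hc l
      simp [bp, hz] at h
    | leaf b =>
      obtain ⟨z, hz⟩ := hc l
      simp [bp, hz] at h
    | node b l' r' =>
      simp only [bp, List.append_assoc, List.cons_append, List.nil_append,
        List.cons.injEq, true_and] at h
      obtain ⟨h₁, v₁, l₁, t₁⟩ := ihl _ _ _ h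
      obtain ⟨h₂, v₂, l₂, t₂⟩ := ihr _ _ _ h₁
      refine ⟨by simpa using h₂, by simp [vertices, v₁, v₂], by simp [leaves, l₁, l₂], ?_⟩
      intro i n
      simp only [nodeTable, t₁, t₂, v₁, l₁, l₂]

/-- The shape of a tree. -/
def erase : PTree α → PTree Unit
  | dummy _ => dummy ()
  | leaf _ => leaf ()
  | node _ l r => node () l.erase r.erase

theorem bp_erase (P : PTree α) : P.erase.bp = P.bp := by
  induction P with
  | dummy a => rfl
  | leaf a => rfl
  | node a l r ihl ihr => simp [erase, bp, ihl, ihr]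

end PTree

-- Clusters at the vertices of the unfolded top DAG

namespace TopTree

open PTree

variable {V : Type*} [DecidableEq V]

/-- The vertices of the tree are labelled with clusters according to the merges. -/
def Labelled : PTree (TopTree V) → Prop
  | dummy _ => True
  | leaf t => ∃ u v b, t = edge u v b
  | node t l r => Labelled l ∧ Labelled r ∧
      (t = vert l.label r.label ∨ ∃ b, t = horiz b l.label r.label)

theorem Labelled.of_at {P s : PTree (TopTree V)} {L I} (hP : Labelled P) (h : At P L I s) :
    Labelled s := by
  induction h with
  | root => exact hP
  | left _ ih => exact ih.1
  | right _ ih => exact ih.2.1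

theorem labelled_unfold (key : TopTree V → Shape) (t : TopTree V) (seen : List Shape) :
    (t.unfold key seen).1.label = t ∧ Labelled (t.unfold key seen).1 := by
  induction t generalizing seen with
  | edge u v b =>
    rw [unfold]
    split
    · exact ⟨rfl, trivial⟩
    · exact ⟨rfl, u, v, b, rfl⟩
  | vert l r ihl ihr =>
    rw [unfold]
    split
    · exact ⟨rfl, trivial⟩
    · refine ⟨rfl, (ihl _).2, (ihr _).2, Or.inl ?_⟩
      rw [(ihl _).1, (ihr _).1]
  | horiz b l r ihl ihr =>
    rw [unfold]
    split
    · exact ⟨rfl, trivial⟩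
    · refine ⟨rfl, (ihl _).2, (ihr _).2, Or.inr ⟨b, ?_⟩⟩
      rw [(ihl _).1, (ihr _).1]

theorem mem_vertices_of_unfold (key : TopTree V → Shape) (t : TopTree V) (seen : List Shape)
    {p : Bool × TopTree V} (hp : p ∈ (t.unfold key seen).1.vertices) : p.2 ∈ t.vertices := by
  induction t generalizing seen with
  | edge u v b =>
    rw [unfold] at hp
    split at hp <;> simp only [PTree.vertices, List.mem_singleton] at hp <;> simp [hp, vertices]
  | vert l r ihl ihr =>
    rw [unfold] at hp
    split at hp
    · simp only [PTree.vertices, List.mem_singleton] at hp; simp [hp, vertices]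
    · simp only [PTree.vertices, List.mem_cons, List.mem_append] at hp
      simp only [vertices, List.mem_cons, List.mem_append]
      rcases hp with rfl | hp | hp
      exacts [Or.inl rfl, Or.inr (Or.inl (ihl _ hp)), Or.inr (Or.inr (ihr _ hp))]
  | horiz b l r ihl ihr =>
    rw [unfold] at hp
    split at hp
    · simp only [PTree.vertices, List.mem_singleton] at hp; simp [hp, vertices]
    · simp only [PTree.vertices, List.mem_cons, List.mem_append] at hp
      simp only [vertices, List.mem_cons, List.mem_append]
      rcases hp with rfl | hp | hp
      exacts [Or.inl rfl, Or.inr (Or.inl (ihl _ hp)), Or.inr (Or.inr (ihr _ hp))]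

theorem length_vertices_unfold (key : TopTree V → Shape) (t : TopTree V) (seen : List Shape) :
    (t.unfold key seen).1.vertices.length ≤ t.vertices.length := by
  induction t generalizing seen with
  | edge u v b => rw [unfold]; split <;> simp [PTree.vertices, vertices]
  | vert l r ihl ihr =>
    rw [unfold]
    split
    · simp [PTree.vertices, vertices]
    · simp only [PTree.vertices, vertices, List.length_cons, List.length_append]
      exact Nat.succ_le_succ (Nat.add_le_add (ihl _) (ihr _))
  | horiz b l r ihl ihr =>
    rw [unfold]
    split
    · simp [PTree.vertices, vertices]
    · simp only [PTree.vertices, vertices, List.length_cons, List.length_append]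
      exact Nat.succ_le_succ (Nat.add_le_add (ihl _) (ihr _))

/-- Each key in the list was there at the start or comes from a proper vertex, and each dummy has
its key in the list. Starting from the empty list, every dummy thus has a proper vertex to point to.
-/
theorem unfold_seen (key : TopTree V → Shape) (t : TopTree V) (seen : List Shape) :
    seen ⊆ (t.unfold key seen).2 ∧
    (∀ k ∈ (t.unfold key seen).2,
      k ∈ seen ∨ ∃ a, (false, a) ∈ (t.unfold key seen).1.vertices ∧ key a = k) ∧
    ∀ a, (true, a) ∈ (t.unfold key seen).1.vertices → key a ∈ (t.unfold key seen).2 := by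
  have merge : ∀ (t l r : TopTree V) (seen : List Shape),
      (∀ seen, seen ⊆ (l.unfold key seen).2 ∧ (∀ k ∈ (l.unfold key seen).2,
        k ∈ seen ∨ ∃ a, (false, a) ∈ (l.unfold key seen).1.vertices ∧ key a = k) ∧
        ∀ a, (true, a) ∈ (l.unfold key seen).1.vertices → key a ∈ (l.unfold key seen).2) →
      (∀ seen, seen ⊆ (r.unfold key seen).2 ∧ (∀ k ∈ (r.unfold key seen).2,
        k ∈ seen ∨ ∃ a, (false, a) ∈ (r.unfold key seen).1.vertices ∧ key a = k) ∧
        ∀ a, (true, a) ∈ (r.unfold key seen).1.vertices → key a ∈ (r.unfold key seen).2) →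
      ∀ p, p = l.unfold key (key t :: seen) → ∀ q, q = r.unfold key p.2 →
      seen ⊆ q.2 ∧ (∀ k ∈ q.2, k ∈ seen ∨ ∃ a, (false, a) ∈ (PTree.node t p.1 q.1).vertices ∧
        key a = k) ∧ ∀ a, (true, a) ∈ (PTree.node t p.1 q.1).vertices → key a ∈ q.2 := by
    intro t l r seen hl hr p hp q hq
    obtain ⟨l₁, l₂, l₃⟩ := hl (key t :: seen)
    rw [← hp] at l₁ l₂ l₃
    obtain ⟨r₁, r₂, r₃⟩ := hr p.2
    rw [← hq] at r₁ r₂ r₃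
    refine ⟨fun k hk => r₁ (l₁ (List.mem_cons_of_mem _ hk)), fun k hk => ?_, fun a ha => ?_⟩
    · simp only [PTree.vertices, List.mem_cons, List.mem_append]
      rcases r₂ k hk with h | ⟨a, ha, h⟩
      · rcases l₂ k h with h | ⟨a, ha, h⟩
        · rcases List.mem_cons.1 h with h | h
          · exact Or.inr ⟨t, Or.inl rfl, h.symm⟩
          · exact Or.inl h
        · exact Or.inr ⟨a, Or.inr (Or.inl ha), h⟩
      · exact Or.inr ⟨a, Or.inr (Or.inr ha), h⟩
    · simp only [PTree.vertices, List.mem_cons, List.mem_append] at ha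
      rcases ha with h | h | h
      · simp at h
      · exact r₁ (l₃ a h)
      · exact r₃ a h
  induction t generalizing seen with
  | edge u v b =>
    rw [unfold]
    split
    · simp [PTree.vertices]; assumption
    · simp only [PTree.vertices, List.mem_cons]; grind
  | vert l r ihl ihr =>
    rw [unfold]
    split
    · simp [PTree.vertices]; assumption
    · exact merge (vert l r) l r seen ihl ihr _ rfl _ rfl
  | horiz b l r ihl ihr =>
    rw [unfold]
    split
    · simp [PTree.vertices]; assumption
    · exact merge (horiz b l r) l r seen ihl ihr _ rfl _ rfl

/-- The number of dummies in a list of leaves. -/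
def dummyCount (X : List (Bool × TopTree V)) : ℕ := (X.map Prod.fst).count true

/-- The sum of the cluster sizes of the dummies in a list of leaves. -/
def dummySum (X : List (Bool × TopTree V)) : ℕ :=
  ((X.filter fun p => p.1).map fun p => p.2.nodes.card).sum

theorem dummyCount_append (X Y : List (Bool × TopTree V)) :
    dummyCount (X ++ Y) = dummyCount X + dummyCount Y := by
  simp [dummyCount]

theorem dummySum_append (X Y : List (Bool × TopTree V)) :
    dummySum (X ++ Y) = dummySum X + dummySum Y := by
  simp [dummySum]

/-- The size of a cluster in terms of the leaves below its vertex. -/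
theorem headList_length_label {s : PTree (TopTree V)} (hs : Labelled s)
    (hc : ∀ p ∈ s.vertices, p.2.nodes.card = p.2.headList.length + 1) :
    s.label.headList.length + 2 * dummyCount s.leaves = s.leaves.length + dummySum s.leaves := by
  -- A proper leaf contributes one head, a dummy the size of its cluster minus one; the identity is
  -- additive to avoid subtraction.
  induction s with
  | dummy a =>
    have := hc (true, a) (by simp [PTree.vertices])
    simp [PTree.label, PTree.leaves, dummyCount, dummySum] at this ⊢
    omega
  | leaf a =>
    obtain ⟨u, v, b, rfl⟩ := hs
    simp [PTree.label, PTree.leaves, dummyCount, dummySum, headList, parts]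
  | node a l r ihl ihr =>
    have h₁ := ihl hs.1 fun p hp => hc p (by simp [PTree.vertices, hp])
    have h₂ := ihr hs.2.1 fun p hp => hc p (by simp [PTree.vertices, hp])
    have h₃ : a.headList.length = l.label.headList.length + r.label.headList.length := by
      rcases hs.2.2 with rfl | ⟨b, rfl⟩
      · simp only [headList_vert, List.length_append]
        simp only [headList, List.length_append]
        omega
      · simp only [headList_horiz, List.length_append]
    simp only [PTree.label, PTree.leaves, dummyCount_append, dummySum_append, List.length_append]
    omega

end TopTree

/-! ## Representation of bit sequences and memory layout -/

/-- Triples stored one after the other. -/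
def interleave (T : List (ℕ × ℕ × ℕ)) : List ℕ := T.flatMap fun x => [x.1, x.2.1, x.2.2]

theorem length_interleave (T : List (ℕ × ℕ × ℕ)) : (interleave T).length = 3 * T.length := by
  induction T with
  | nil => rfl
  | cons x T ih => simp only [interleave, List.flatMap_cons, List.length_append] at ih ⊢; simp; omega

theorem getElem?_interleave {T : List (ℕ × ℕ × ℕ)} {i : ℕ} {x : ℕ × ℕ × ℕ} (h : T[i]? = some x) :
    (interleave T)[3 * i + 0]? = some x.1 ∧ (interleave T)[3 * i + 1]? = some x.2.1 ∧
      (interleave T)[3 * i + 2]? = some x.2.2 := by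
  induction T generalizing i with
  | nil => simp at h
  | cons y T ih =>
    cases i with
    | zero => simp at h; subst h; simp [interleave]
    | succ i =>
      rw [List.getElem?_cons_succ] at h
      exact ih h

theorem forall_mem_interleave {T : List (ℕ × ℕ × ℕ)} {p : ℕ → Prop}
    (h : ∀ x ∈ T, p x.1 ∧ p x.2.1 ∧ p x.2.2) : ∀ z ∈ interleave T, p z := by
  intro z hz
  obtain ⟨x, hx, hz⟩ := List.mem_flatMap.1 hz
  have := h x hx
  simp only [List.mem_cons, List.not_mem_nil, or_false] at hz
  rcases hz with rfl | rfl | rfl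
  exacts [this.1, this.2.1, this.2.2]

/-- The number of ones before the `j`-th zero of a bit sequence. -/
def onesBefore : List Bool → ℕ → ℕ
  | _, 0 => 0
  | [], _ + 1 => 0
  | true :: B, j + 1 => onesBefore B (j + 1) + 1
  | false :: B, j + 1 => onesBefore B j

theorem onesBefore_le (B : List Bool) (j : ℕ) : onesBefore B j ≤ B.length := by
  induction B generalizing j with
  | nil => cases j <;> simp [onesBefore]
  | cons b B ih =>
    cases j with
    | zero => simp [onesBefore]
    | succ j =>
      cases b
      · exact (ih j).trans (Nat.le_succ _)
      · exact Nat.succ_le_succ (ih (j + 1))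

theorem onesBefore_unary (k : ℕ) (B : List Bool) (j : ℕ) :
    onesBefore (unary k ++ B) (j + 1) = k + onesBefore B j := by
  induction k with
  | zero => simp [unary, onesBefore]
  | succ k ih =>
    rw [unary, List.replicate_succ, List.cons_append, List.cons_append, onesBefore]
    rw [unary] at ih
    rw [ih]
    omega

/-- Select on a unary code yields prefix sums, that is, the places where the blocks of the
accompanying arrays begin. -/
theorem onesBefore_flatMap_unary {α : Type*} (f : α → ℕ) (l : List α) {j : ℕ}
    (hj : j ≤ l.length) :
    onesBefore (l.flatMap fun a => unary (f a)) j = ((l.take j).map f).sum := by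
  induction l generalizing j with
  | nil => simp at hj; simp [hj, onesBefore]
  | cons a l ih =>
    cases j with
    | zero => simp [onesBefore]
    | succ j =>
      rw [List.flatMap_cons, onesBefore_unary, ih (by simpa using hj)]
      simp

theorem length_flatMap_unary {α : Type*} (f : α → ℕ) (l : List α) :
    (l.flatMap fun a => unary (f a)).length = l.length + (l.map f).sum := by
  induction l with
  | nil => rfl
  | cons a l ih =>
    rw [List.flatMap_cons, List.length_append, ih]
    simp [unary]
    omega

/-- For every position: the bit, the number of ones before it, and, for select queries,
the number of ones before the zero with that number. -/
def bitTable (B : List Bool) : List (ℕ × ℕ × ℕ) :=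
  -- The additional row at position `B.length` is needed for the end of the last block when all
  -- counts are zero.
  (List.range (B.length + 1)).map fun i =>
    ((B.getD i false).toNat, (B.take i).count true, onesBefore B i)

theorem getElem?_bitTable {B : List Bool} {i : ℕ} (h : i ≤ B.length) :
    (bitTable B)[i]? = some ((B.getD i false).toNat, (B.take i).count true, onesBefore B i) := by
  simp [bitTable, Nat.lt_succ_of_le h]

/-- The representation of bitvectors: tables for access, rank and select. -/
def bvEnc (B : List Bool) : List ℕ := interleave (bitTable B)

theorem bvEnc_le (B : List Bool) : (bvEnc B).length ≤ 3 * (B.length + 1) ∧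
    ∀ z ∈ bvEnc B, z ≤ 3 * (B.length + 1) := by
  refine ⟨by simp [bvEnc, length_interleave, bitTable], ?_⟩
  refine forall_mem_interleave fun x hx => ?_
  obtain ⟨i, -, rfl⟩ := List.mem_map.1 hx
  have h₁ := onesBefore_le B i
  have h₂ : (B.take i).count true ≤ B.length :=
    List.count_le_length.trans (List.length_take_le' _ _)
  have h₃ := Bool.toNat_le (B.getD i false)
  exact ⟨by dsimp only; omega, by dsimp only; omega, by dsimp only; omega⟩

open Classical in
/-- The representation of balanced parentheses sequences: tables for the navigation in the tree
that is described by the sequence. -/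
noncomputable def bpEnc (B : List Bool) : List ℕ :=
  -- Any tree with this sequence will do, since the table depends only on the sequence.
  if h : ∃ P : PTree Unit, P.bp = B then interleave (h.choose.nodeTable 0 0) else []

theorem bpEnc_bp {α : Type*} (P : PTree α) : bpEnc P.bp = interleave (P.nodeTable 0 0) := by
  have h : ∃ Q : PTree Unit, Q.bp = P.bp := ⟨P.erase, P.bp_erase⟩
  rw [bpEnc, dif_pos h]
  obtain ⟨-, -, -, ht⟩ := h.choose.nodeTable_eq_of_bp P [] [] (by rw [h.choose_spec])
  rw [ht]

theorem bpEnc_le (B : List Bool) : (bpEnc B).length ≤ 3 * (B.length + 1) ∧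
    ∀ z ∈ bpEnc B, z ≤ 3 * (B.length + 1) := by
  by_cases h : ∃ P : PTree Unit, P.bp = B
  · obtain ⟨P, rfl⟩ := h
    rw [bpEnc_bp, length_interleave, PTree.length_nodeTable, PTree.length_bp]
    refine ⟨by omega, forall_mem_interleave fun x hx => ?_⟩
    have := PTree.le_of_mem_nodeTable hx
    omega
  · rw [bpEnc, dif_neg h]
    simp

/-- The start address of an array in the layout. -/
def segStart (segs : List (List ℕ)) (j : ℕ) : ℕ :=
  segs.length + ((segs.take j).map List.length).sum

theorem getElem?_layout_start {segs : List (List ℕ)} {j : ℕ} (hj : j < segs.length) :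
    (layout segs)[j]? = some (segStart segs j) := by
  rw [layout, List.getElem?_append_left (by simpa using hj)]
  simp [hj, segStart]

theorem getElem?_layout {segs : List (List ℕ)} {j k : ℕ} {S : List ℕ} (hj : segs[j]? = some S)
    (hk : k < S.length) : (layout segs)[segStart segs j + k]? = S[k]? := by
  obtain ⟨hj', rfl⟩ := List.getElem?_eq_some_iff.1 hj
  have h : segs.flatten = (segs.take j).flatten ++ (segs[j] ++ (segs.drop (j + 1)).flatten) := by
    rw [← List.flatten_cons, ← List.drop_eq_getElem_cons hj', ← List.flatten_append,
      List.take_append_drop]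
  rw [layout, segStart, List.getElem?_append_right (by simp; omega)]
  simp only [List.length_map, List.length_range]
  rw [h, List.getElem?_append_right (by rw [List.length_flatten]; omega), List.length_flatten,
    List.getElem?_append_left (by omega)]
  congr 1
  omega

theorem segStart_add_length_le {segs : List (List ℕ)} {j : ℕ} {S : List ℕ}
    (hj : segs[j]? = some S) : segStart segs j + S.length ≤ (layout segs).length := by
  obtain ⟨hj', rfl⟩ := List.getElem?_eq_some_iff.1 hj
  have h : segs.flatten = (segs.take j).flatten ++ (segs[j] ++ (segs.drop (j + 1)).flatten) := by
    rw [← List.flatten_cons, ← List.drop_eq_getElem_cons hj', ← List.flatten_append,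
      List.take_append_drop]
  rw [layout, h]
  simp only [segStart, List.length_append, List.length_map, List.length_range, List.length_flatten]
  omega

theorem forall_mem_layout {segs : List (List ℕ)} {p : ℕ → Prop}
    (h₁ : ∀ n ≤ (layout segs).length, p n) (h₂ : ∀ S ∈ segs, ∀ z ∈ S, p z) :
    ∀ z ∈ layout segs, p z := by
  intro z hz
  rw [layout, List.mem_append] at hz
  rcases hz with hz | hz
  · obtain ⟨j, hj, rfl⟩ := List.mem_map.1 hz
    have hj' : j < segs.length := List.mem_range.1 hj
    have := segStart_add_length_le (List.getElem?_eq_getElem hj')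
    exact h₁ _ (le_trans (Nat.le_add_right _ _) this)
  · obtain ⟨S, hS, hz⟩ := List.mem_flatten.1 hz
    exact h₂ S hS z hz

-- Reading the arrays in memory

namespace WordRAM

/-- The memory holds the given arrays; all addresses and entries are at most `U`, which is far below
the number of words. -/
structure Holds (w U : ℕ) (segs : List (List ℕ)) (m : ℕ → ℕ) : Prop where
  mem : ∀ i v, (layout segs)[i]? = some v → m i = v
  length_le : (layout segs).length ≤ U
  le : ∀ z ∈ layout segs, z ≤ U
  lt : 100 * (U + 1) < 2 ^ w

/-- The `e`-th entry of array number `j`. -/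
def seg (j : ℕ) (e : Exp) : Exp := .rd (.rd (.lit j) + e)

/-- Component number `d` of the `e`-th triple of array number `j`. -/
def tri (j : ℕ) (e : Exp) (d : ℕ) : Exp := seg j (.lit 3 * e + .lit d)

variable {w U : ℕ} {segs : List (List ℕ)} {σ : Store}

/-- The arrays occupy addresses below `U`, so the stack at the upper end of the address space does
not disturb them. -/
theorem Holds.write {m : ℕ → ℕ} (h : Holds w U segs m) {a n : ℕ} (ha : U ≤ a) :
    Holds w U segs (Function.update m a n) := by
  refine ⟨fun i v hi => ?_, h.length_le, h.le, h.lt⟩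
  have := (List.getElem?_eq_some_iff.1 hi).1
  have := h.length_le
  rw [Function.update_of_ne (by omega)]
  exact h.mem i v hi

/-- The start address comes from the directory. The bound on the value read is what the later
overflow conditions rest on. -/
theorem Holds.ev_seg (h : Holds w U segs σ.m) {j : ℕ} {S : List ℕ} (hj : segs[j]? = some S)
    {e : Exp} {k v : ℕ} (he : e.ev w σ = k) (hk : S[k]? = some v) :
    (seg j e).ev w σ = v ∧ v ≤ U := by
  obtain ⟨hk', -⟩ := List.getElem?_eq_some_iff.1 hk
  have hj' := (List.getElem?_eq_some_iff.1 hj).1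
  have h₁ := segStart_add_length_le hj
  have h₂ := getElem?_layout hj hk'
  rw [hk] at h₂
  have h₃ : segs.length ≤ (layout segs).length := by simp [layout]
  have h₄ := h.length_le
  have h₅ := h.lt
  refine ⟨?_, h.le v (List.mem_of_getElem? h₂)⟩
  rw [seg, Exp.ev_rd (Exp.ev_add ((Exp.ev_rd (Exp.ev_lit (by omega))).trans
    (h.mem _ _ (getElem?_layout_start hj'))) he (by omega)), h.mem _ _ h₂]

theorem Holds.ev_tri (h : Holds w U segs σ.m) {j : ℕ} {T : List (ℕ × ℕ × ℕ)}
    (hj : segs[j]? = some (interleave T))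
    {e : Exp} {k : ℕ} {v : ℕ × ℕ × ℕ} (he : e.ev w σ = k) (hk : T[k]? = some v) :
    ((tri j e 0).ev w σ = v.1 ∧ v.1 ≤ U) ∧ ((tri j e 1).ev w σ = v.2.1 ∧ v.2.1 ≤ U) ∧
      ((tri j e 2).ev w σ = v.2.2 ∧ v.2.2 ≤ U) ∧ k ≤ U := by
  have hk' := (List.getElem?_eq_some_iff.1 hk).1
  have h₁ := segStart_add_length_le hj
  rw [length_interleave] at h₁
  have h₄ := h.length_le
  have h₅ := h.lt
  obtain ⟨e₀, e₁, e₂⟩ := getElem?_interleave hk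
  have key (d : ℕ) (hd : d < 3) : (Exp.lit 3 * e + Exp.lit d).ev w σ = 3 * k + d :=
    Exp.ev_add (Exp.ev_mul (Exp.ev_lit (by omega)) he (by omega)) (Exp.ev_lit (by omega)) (by omega)
  exact ⟨h.ev_seg hj (key 0 (by omega)) e₀, h.ev_seg hj (key 1 (by omega)) e₁,
    h.ev_seg hj (key 2 (by omega)) e₂, by omega⟩

end WordRAM

/-! ## Entries of the arrays of a top ZDD -/

theorem getElem?_flatMap_block {α β : Type*} (f : α → List β) (A B : List α) (a : α) {m : ℕ}
    (hm : m < (f a).length) :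
    ((A ++ a :: B).flatMap f)[(A.map fun a => (f a).length).sum + m]? = (f a)[m]? := by
  have : (A.flatMap f).length = (A.map fun a => (f a).length).sum := by
    rw [List.length_flatMap]
  rw [List.flatMap_append, List.flatMap_cons, ← this, List.getElem?_append_right (by omega),
    List.getElem?_append_left (by omega)]
  congr 1
  omega

theorem getElem?_filterMap_block {α β : Type*} (f : α → Option β) (A B : List α) {a : α} {b : β}
    (h : f a = some b) : ((A ++ a :: B).filterMap f)[(A.filterMap f).length]? = some b := by
  simp [List.filterMap_append, h]

namespace PTree

variable {α : Type*} {P s : PTree α} {L : List (Bool × α)} {I : List α}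

theorem At.getElem?_nodeTable (h : At P L I s) : ∃ x, (P.nodeTable 0 0)[L.length + I.length]? =
    some x ∧ x.2.1 = L.length ∧ x.2.2 = L.length + s.leaves.length ∧
      x.1 = match s with
        | node _ l _ => L.length + I.length + 1 + l.vertices.length
        | _ => 0 := by
  obtain ⟨A, B, h₁, h₂⟩ := h.nodeTable
  rw [h₁, List.getElem?_append_right (by omega), h₂, Nat.sub_self]
  cases s with
  | dummy a => exact ⟨_, rfl, rfl, rfl, rfl⟩
  | leaf a => exact ⟨_, rfl, rfl, rfl, rfl⟩
  | node a l r => exact ⟨_, rfl, rfl, by simp [PTree.leaves, add_assoc], rfl⟩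

end PTree

namespace TopTree

open PTree

variable {V : Type*} [DecidableEq V]

def isHoriz : TopTree V → Bool
  | horiz _ _ _ => true
  | _ => false

/-- The number of horizontal merges in a list. -/
def horizCount (I : List (TopTree V)) : ℕ := (I.map isHoriz).count true

theorem horizCount_le (I : List (TopTree V)) : horizCount I ≤ I.length := by
  rw [horizCount]
  exact List.count_le_length.trans (by simp)

theorem dummyCount_le (L : List (Bool × TopTree V)) : dummyCount L ≤ L.length := by
  rw [dummyCount]
  exact List.count_le_length.trans (by simp)

theorem Labelled.isInternal {P : PTree (TopTree V)} (h : Labelled P) :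
    ∀ t ∈ P.internals, t.IsInternal := by
  induction P with
  | dummy a => simp [PTree.internals]
  | leaf a => simp [PTree.internals]
  | node a l r ihl ihr =>
    intro t ht
    simp only [PTree.internals, List.mem_cons, List.mem_append] at ht
    rcases ht with rfl | ht | ht
    · rcases h.2.2 with h | ⟨b, h⟩ <;> rw [h] <;> trivial
    · exact ihl h.1 t ht
    · exact ihr h.2.1 t ht

theorem Labelled.isEdge {P : PTree (TopTree V)} (h : Labelled P) :
    ∀ t, (false, t) ∈ P.leaves → ∃ u v b, t = edge u v b := by
  induction P with
  | dummy a => simp [PTree.leaves]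
  | leaf a => intro t ht; simp [PTree.leaves] at ht; exact ht ▸ h
  | node a l r ihl ihr =>
    intro t ht
    simp only [PTree.leaves, List.mem_append] at ht
    rcases ht with ht | ht
    · exact ihl h.1 t ht
    · exact ihr h.2.1 t ht

/-- An internal vertex that is not a horizontal merge is a vertical one, so its index in an array
for vertical merges is a position minus a rank. -/
theorem length_filterMap_internals {β : Type*} (f : TopTree V → TopTree V → β)
    {I : List (TopTree V)} (h : ∀ t ∈ I, t.IsInternal) :
    (I.filterMap fun t => match t with
      | vert l r => some (f l r)
      | _ => none).length + horizCount I = I.length := by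
  induction I with
  | nil => rfl
  | cons t I ih =>
    have h₁ := h t (by simp)
    have h₂ := ih fun t ht => h t (by simp [ht])
    cases t with
    | edge u v b => exact h₁.elim
    | vert l r => simp [horizCount, isHoriz] at h₂ ⊢; omega
    | horiz b l r => simp [horizCount, isHoriz] at h₂ ⊢; omega

theorem length_filterMap_leaves {β : Type*} (f : V → V → Bool → β)
    {L : List (Bool × TopTree V)} (h : ∀ t, (false, t) ∈ L → ∃ u v b, t = edge u v b) :
    (L.filterMap fun p => match p with
      | (false, edge u v b) => some (f u v b)
      | _ => none).length + dummyCount L = L.length := by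
  induction L with
  | nil => rfl
  | cons p L ih =>
    have h₂ := ih fun t ht => h t (by simp [ht])
    obtain ⟨d, t⟩ := p
    cases d
    · obtain ⟨u, v, b, rfl⟩ := h t (by simp)
      simp [dummyCount] at h₂ ⊢; omega
    · simp [dummyCount] at h₂ ⊢; omega

end TopTree

-- Array entries belonging to a vertex of the unfolded top DAG

namespace ZDD

open TopTree PTree

variable {V : Type*} [Fintype V] [DecidableEq V] {c : ℕ} {G : ZDD V c}
  {P s : PTree (TopTree V)} {L : List (Bool × TopTree V)} {I : List (TopTree V)}

/-- The facts about the unfolded top DAG that the queries rely on. -/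
structure IsDag (G : ZDD V c) (P : PTree (TopTree V)) : Prop where
  eq : G.dagTree = some P
  labelled : Labelled P
  isCluster : ∀ p ∈ P.vertices, G.IsCluster p.2

theorem exists_dag {T : TopTree V} (hT : G.topTree = some T) (hc : G.IsCluster T) :
    ∃ P, G.IsDag P ∧ P.label = T ∧ P.vertices.length ≤ T.vertices.length := by
  refine ⟨(T.unfold G.key []).1, ⟨by rw [dagTree, hT]; rfl, (labelled_unfold _ _ _).2, ?_⟩,
    (labelled_unfold _ _ _).1, length_vertices_unfold _ _ _⟩
  exact fun p hp => hc.of_mem_vertices (mem_vertices_of_unfold _ _ _ hp)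

namespace IsDag

variable (h : G.IsDag P)
include h

theorem dagVertices : G.dagVertices = P.vertices := by rw [ZDD.dagVertices, h.eq]; rfl

theorem dagLeaves : G.dagLeaves = P.leaves := by rw [ZDD.dagLeaves, h.eq]; rfl

theorem dagInternals : G.dagInternals = P.internals := by rw [ZDD.dagInternals, h.eq]; rfl

theorem dagDummies : G.dagDummies = (P.leaves.filter fun p => p.1).map Prod.snd := by
  rw [ZDD.dagDummies, h.dagLeaves]

theorem isCluster_label (hs : At P L I s) : G.IsCluster s.label := by
  obtain ⟨b, hb⟩ := s.label_mem_vertices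
  exact h.isCluster _ (mem_vertices_of_at hs hb)

theorem bDummy {L B : List (Bool × TopTree V)} (hL : P.leaves = L ++ B) :
    ∃ x, (bitTable G.topZDD.bDummy)[L.length]? = some x ∧ x.2.1 = dummyCount L ∧
      ∀ p, B[0]? = some p → x.1 = p.1.toNat := by
  have hd : G.topZDD.bDummy = L.map Prod.fst ++ B.map Prod.fst := by
    rw [topZDD, h.dagLeaves, hL]; simp
  refine ⟨_, getElem?_bitTable (by rw [hd]; simp), ?_, ?_⟩
  · rw [hd, List.take_left' (by simp)]; rfl
  · intro p hp
    have : (G.topZDD.bDummy)[L.length]? = some p.1 := by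
      rw [hd, List.getElem?_append_right (by simp)]
      simp [hp]
    rw [List.getD_eq_getElem?_getD, this]
    rfl

/-- The array starts with the size of the first dummy and not with 0: hence the index shifted by one
and the exclusion of the empty prefix. -/
theorem clsize {L B : List (Bool × TopTree V)} (hL : P.leaves = L ++ B)
    (hd : dummyCount L ≠ 0) : G.topZDD.clsize[dummyCount L - 1]? = some (dummySum L) := by
  have hlen : (L.filter fun p => p.1).length = dummyCount L := by
    rw [dummyCount, List.count_eq_countP, List.countP_map, List.countP_eq_length_filter]
    congr 1
    exact List.filter_congr fun p _ => by cases hp : p.1 <;> simp [hp]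
  have hD : G.dagDummies = (L.filter fun p => p.1).map Prod.snd ++
      (B.filter fun p => p.1).map Prod.snd := by
    rw [h.dagDummies, hL]; simp
  have hlt : dummyCount L - 1 < G.dagDummies.length := by
    rw [hD]; simp only [List.length_append, List.length_map]; omega
  simp only [topZDD, List.getElem?_map, List.getElem?_range hlt, Option.map_some]
  rw [show dummyCount L - 1 + 1 = dummyCount L by omega, hD,
    List.take_left' (by rw [List.length_map, hlen]), dummySum, List.map_map]
  rfl

theorem dstDummy {t : TopTree V} (hs : At P L I (dummy t)) :
    G.topZDD.dstDummy[dummyCount L]? = some (G.dagPre t) := by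
  obtain ⟨B, hL⟩ := hs.leaves
  have hlen : (L.filter fun p => p.1).length = dummyCount L := by
    rw [dummyCount, List.count_eq_countP, List.countP_map, List.countP_eq_length_filter]
    congr 1
    exact List.filter_congr fun p _ => by cases hp : p.1 <;> simp [hp]
  simp only [topZDD, h.dagDummies, hL, PTree.leaves]
  rw [List.filter_append, List.map_append, List.map_append, List.getElem?_append_right
    (by simp [hlen])]
  simp [hlen]

/-- The search for the first proper vertex with the key succeeds by `unfold_seen`, and its result is
not a dummy, so following one pointer is enough. -/
theorem dagPre {t : TopTree V} (hs : At P L I (dummy t)) : ∃ L' I' s', At P L' I' s' ∧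
    L'.length + I'.length + 1 = G.dagPre t ∧ G.key s'.label = G.key t ∧ ∀ t', s' ≠ dummy t' := by
  have hex : ∃ a, (false, a) ∈ P.vertices ∧ G.key a = G.key t := by
    have heq := h.eq
    rw [dagTree, Option.map_eq_some_iff] at heq
    obtain ⟨T, -, hT⟩ := heq
    obtain ⟨-, h₂, h₃⟩ := unfold_seen G.key T []
    rw [hT] at h₂ h₃
    have := h₃ t (mem_vertices_of_at hs (by simp [PTree.vertices]))
    simpa using h₂ _ this
  obtain ⟨a, ha, hk⟩ := hex
  have hlt : P.vertices.findIdx (fun p => !p.1 && decide (G.key p.2 = G.key t)) <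
      P.vertices.length := List.findIdx_lt_length.2 ⟨_, ha, by simp [hk]⟩
  have hp := List.findIdx_getElem (w := hlt)
  obtain ⟨L', I', s', h₁, h₂, h₃⟩ := exists_at (List.getElem?_eq_getElem hlt)
  refine ⟨L', I', s', h₁, by rw [ZDD.dagPre, h.dagVertices, h₂], ?_⟩
  simp only [Bool.and_eq_true, Bool.not_eq_true', decide_eq_true_eq] at hp
  have h₄ : ∃ b, s'.vertices[0]? = some (b, s'.label) ∧ (b = false → ∀ t', s' ≠ dummy t') := by
    cases s' <;> simp [PTree.vertices, PTree.label]
  obtain ⟨b, h₄, h₅⟩ := h₄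
  rw [h₃] at h₄
  have h₆ := Option.some.inj h₄
  rw [h₆] at hp
  exact ⟨hp.2, h₅ hp.1⟩

/-- The index among the proper leaves is the number of preceding leaves minus that of preceding
dummies. -/
theorem labelSpan {u v : V} {b : Bool} (hs : At P L I (leaf (edge u v b))) :
    G.topZDD.labelSpan[L.length - dummyCount L]? = some (G.label v - G.label u) := by
  obtain ⟨B, hL⟩ := hs.leaves
  have h₁ := length_filterMap_leaves (fun u v _ => G.label v - G.label u) (L := L)
    fun t ht => h.labelled.isEdge t (by rw [hL]; simp [ht])
  rw [← h₁, Nat.add_sub_cancel]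
  simp only [topZDD, h.dagLeaves, hL, PTree.leaves, List.singleton_append]
  exact getElem?_filterMap_block _ L B rfl

theorem bH {t : TopTree V} {l r : PTree (TopTree V)} (hs : At P L I (node t l r)) :
    ∃ x, (bitTable G.topZDD.bH)[I.length]? = some x ∧ x.2.1 = horizCount I ∧
      x.1 = t.isHoriz.toNat := by
  obtain ⟨B, hI⟩ := hs.internals
  have hd : G.topZDD.bH = I.map isHoriz ++ t.isHoriz ::
      (l.internals ++ r.internals ++ B).map isHoriz := by
    rw [topZDD, h.dagInternals, hI, PTree.internals, List.map_append, List.cons_append,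
      List.map_cons]
    rfl
  refine ⟨_, getElem?_bitTable (by rw [hd]; simp), ?_, ?_⟩
  · rw [hd, List.take_left' (by simp)]; rfl
  · rw [List.getD_eq_getElem?_getD, hd, List.getElem?_append_right (by simp)]
    simp

theorem preorderDiff {t₁ t₂ : TopTree V} {l r : PTree (TopTree V)}
    (hs : At P L I (node (vert t₁ t₂) l r)) :
    G.topZDD.preorderDiff[I.length - horizCount I]? = some (G.localPre t₁ t₂.top) := by
  obtain ⟨B, hI⟩ := hs.internals
  have h₁ := length_filterMap_internals (fun l r => G.localPre l r.top) (I := I)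
    fun t ht => h.labelled.isInternal t (by rw [hI]; simp [ht])
  rw [← h₁, Nat.add_sub_cancel]
  simp only [topZDD, h.dagInternals, hI, PTree.internals, List.cons_append]
  exact getElem?_filterMap_block _ I _ rfl

theorem labelDiff {t₁ t₂ : TopTree V} {l r : PTree (TopTree V)}
    (hs : At P L I (node (vert t₁ t₂) l r)) :
    G.topZDD.labelDiff[I.length - horizCount I]? = some (G.label t₂.top - G.label t₁.top) := by
  obtain ⟨B, hI⟩ := hs.internals
  have h₁ := length_filterMap_internals (fun l r => G.label r.top - G.label l.top) (I := I)
    fun t ht => h.labelled.isInternal t (by rw [hI]; simp [ht])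
  rw [← h₁, Nat.add_sub_cancel]
  simp only [topZDD, h.dagInternals, hI, PTree.internals, List.cons_append]
  exact getElem?_filterMap_block _ I _ rfl

/-- The size of a cluster in terms of the leaf numbers and dummy counts at the two ends
of its subtree. -/
theorem size_eq (hs : At P L I s) : s.label.headList.length + 1 +
    (L.length + dummySum L + 2 * dummyCount (L ++ s.leaves)) =
      1 + (L.length + s.leaves.length) + dummySum (L ++ s.leaves) + 2 * dummyCount L := by
  have := headList_length_label (h.labelled.of_at hs) fun p hp =>
    (h.isCluster p (mem_vertices_of_at hs hp)).card_nodes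
  rw [dummyCount_append, dummySum_append]
  omega

/-- The stored complement edges of a vertex form a block. -/
theorem block (hs : At P L I s) (hn : ∀ t, s ≠ dummy t) : ∃ o x y,
    (bitTable G.topZDD.bEdge)[L.length + I.length]? = some x ∧
    (bitTable G.topZDD.bEdge)[L.length + I.length + 1]? = some y ∧
    x.2.2 = o ∧ y.2.2 = o + (G.innerInfos s.label).length ∧
    ∀ m i, (G.innerInfos s.label)[m]? = some i → G.topZDD.srcIn[o + m]? = some i.src ∧
      G.topZDD.dstIn[o + m]? = some i.dst ∧ G.topZDD.typeIn[o + m]? = some i.bit := by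
  obtain ⟨A, B, hA, hl⟩ := hs.vertices
  have hv : ∃ B', s.vertices = (false, s.label) :: B' := by
    cases s with
    | dummy t => exact (hn t rfl).elim
    | leaf t => exact ⟨_, rfl⟩
    | node t l r => exact ⟨_, rfl⟩
  obtain ⟨B', hB'⟩ := hv
  rw [hB', List.cons_append] at hA
  have hlen : ∀ p : Bool × TopTree V,
      (if p.1 then [] else (G.innerEdges p.2).map fun e => (p.2, e)).length =
        if p.1 then 0 else (G.innerEdges p.2).length := fun p => by split_ifs <;> simp
  have hle : (P.vertices).length ≤ G.topZDD.bEdge.length := by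
    simp only [topZDD, h.dagVertices, length_flatMap_unary]; omega
  have hvl : A.length + 1 ≤ P.vertices.length := by rw [hA]; simp
  refine ⟨(A.map fun p => if p.1 then 0 else (G.innerEdges p.2).length).sum, _, _,
    getElem?_bitTable (by omega), getElem?_bitTable (by omega), ?_, ?_, ?_⟩
  · simp only [topZDD, h.dagVertices]
    rw [onesBefore_flatMap_unary _ _ (by omega), hA, List.take_left' hl]
  · simp only [topZDD, h.dagVertices]
    rw [onesBefore_flatMap_unary _ _ (by omega), hA, ← hl, List.take_append]
    simp [innerInfos, List.take_of_length_le]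
  · intro m i hi
    rw [innerInfos, List.getElem?_map, Option.map_eq_some_iff] at hi
    obtain ⟨e, he, rfl⟩ := hi
    have hm := (List.getElem?_eq_some_iff.1 he).1
    have key : G.storedEdges[(A.map fun p => if p.1 then 0 else (G.innerEdges p.2).length).sum + m]? =
        some (s.label, e) := by
      have := getElem?_flatMap_block (fun p : Bool × TopTree V =>
        if p.1 then [] else (G.innerEdges p.2).map fun e => (p.2, e)) A (B' ++ B) (false, s.label)
        (m := m) (by simpa using hm)
      simp only [hlen] at this
      rw [storedEdges, h.dagVertices, hA, this]
      simp [he]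
    simp [topZDD, key, edgeInfo]

end IsDag

/-! ### Complement edges in the root -/

/-- The complement edges in the root that leave `x`. -/
def rootBlock (G : ZDD V c) (x : V) : List (V × Bool) :=
  [(x, false), (x, true)].filter fun e => e ∈ G.rootEdges

/-- The edges in the root arise by filtering a concatenation of pairs, one for each node in
preorder, so they form consecutive blocks of length at most two. -/
theorem rootEdges_eq : G.rootEdges = G.order.flatMap G.rootBlock := by
  have h : G.rootEdges = (G.order.flatMap fun u => [(u, false), (u, true)]).filter
      fun e => e ∈ G.rootEdges := by
    have hs : ∀ e ∈ G.complementEdges, (decide (e ∈ G.rootEdges)) =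
        decide (¬ ∃ t ∈ G.clusters, e ∈ G.innerEdges t) := by
      intro e he
      simp only [rootEdges, List.mem_filter, he, true_and, decide_eq_true_eq]
    have hs' : G.rootEdges = G.complementEdges.filter fun e => e ∈ G.rootEdges := by
      conv_lhs => rw [rootEdges]
      exact List.filter_congr fun e he => (hs e he).symm
    conv_lhs => rw [hs', complementEdges, List.filter_filter]
    refine List.filter_congr fun e he => ?_
    by_cases hr : e ∈ G.rootEdges
    · have := (List.filter_sublist.subset hr : e ∈ G.complementEdges)
      rw [mem_complementEdges] at this
      simp [hr, this]
    · simp [hr]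
  rw [h, List.filter_flatMap]
  rfl

theorem countP_rootEdges (x : V) :
    (G.rootEdges.countP fun e => e.1 = x) = (G.rootBlock x).length := by
  have h : ∀ y, ((G.rootBlock y).countP fun e => e.1 = x) =
      if y = x then (G.rootBlock x).length else 0 := by
    intro y
    have hy : ∀ e ∈ G.rootBlock y, e.1 = y := by
      intro e he
      have := List.filter_sublist.subset he
      simp at this
      rcases this with rfl | rfl <;> rfl
    split_ifs with hyx
    · subst hyx
      rw [List.countP_eq_length]
      simpa using hy
    · rw [List.countP_eq_zero]
      intro e he
      simp [hy e he, hyx]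
  rw [rootEdges_eq, List.countP_flatMap]
  simp only [Function.comp_def, h]
  have : ∀ l : List V, l.Nodup → x ∈ l →
      (l.map fun y => if y = x then (G.rootBlock x).length else 0).sum =
        (G.rootBlock x).length := by
    intro l hl hx
    induction l with
    | nil => simp at hx
    | cons z l ih =>
      rw [List.nodup_cons] at hl
      rcases List.mem_cons.1 hx with rfl | hx
      · have : (l.map fun y => if y = x then (G.rootBlock x).length else 0).sum = 0 := by
          refine List.sum_eq_zero fun n hn => ?_
          obtain ⟨y, hy, rfl⟩ := List.mem_map.1 hn
          rw [if_neg]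
          rintro rfl
          exact hl.1 hy
        simp [this]
      · have hz : z ≠ x := fun h => hl.1 (h ▸ hx)
        simp [hz, ih hl.2 hx]
  exact this _ G.nodup_order (G.mem_order x)

/-- Preorders count from 1, so `G.pre x - 1` blocks come first and the block of `x` lies between two
consecutive select values. -/
theorem root_block (x : V) : ∃ o y z,
    (bitTable G.topZDD.bSrcRoot)[G.pre x - 1]? = some y ∧
    (bitTable G.topZDD.bSrcRoot)[G.pre x]? = some z ∧
    y.2.2 = o ∧ z.2.2 = o + (G.rootBlock x).length ∧
    ∀ m e, (G.rootBlock x)[m]? = some e →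
      G.topZDD.dstRoot[o + m]? = some (G.code (G.child e.2 e.1)) ∧
      G.topZDD.typeRoot[o + m]? = some e.2 := by
  have hx := G.getElem?_pre x
  have hp := G.pre_pos x
  have hlt := (List.getElem?_eq_some_iff.1 hx).1
  obtain ⟨A, B, hA, hl⟩ : ∃ A B, G.order = A ++ x :: B ∧ A.length = G.pre x - 1 := by
    refine ⟨G.order.take (G.pre x - 1), G.order.drop (G.pre x), ?_, by simp; omega⟩
    have h₁ := (List.getElem?_eq_some_iff.1 hx).2
    conv_lhs => rw [← List.take_append_drop (G.pre x - 1) G.order, List.drop_eq_getElem_cons hlt,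
      h₁]
    rw [Nat.sub_add_cancel hp]
  have hle : G.order.length ≤ G.topZDD.bSrcRoot.length := by
    simp only [topZDD, length_flatMap_unary]; omega
  refine ⟨(A.map fun u => (G.rootBlock u).length).sum, _, _,
    getElem?_bitTable (by omega), getElem?_bitTable (by omega), ?_, ?_, ?_⟩
  · simp only [topZDD]
    rw [onesBefore_flatMap_unary _ _ (by omega)]
    simp only [countP_rootEdges]
    rw [hA, List.take_left' hl]
  · simp only [topZDD]
    rw [onesBefore_flatMap_unary _ _ (by omega)]
    simp only [countP_rootEdges]
    rw [hA, show G.pre x = A.length + 1 by omega, List.take_append]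
    simp [List.take_of_length_le]
  · intro m e he
    have hm := (List.getElem?_eq_some_iff.1 he).1
    have key : G.rootEdges[(A.map fun u => (G.rootBlock u).length).sum + m]? = some e := by
      rw [rootEdges_eq, hA, getElem?_flatMap_block _ _ _ _ hm, he]
    simp [topZDD, key]

theorem mem_rootBlock {x : V} {e : V × Bool} :
    e ∈ G.rootBlock x ↔ e.1 = x ∧ e ∈ G.rootEdges := by
  obtain ⟨y, b⟩ := e
  cases b <;> simp [rootBlock]

theorem pairwise_rootBlock (x : V) :
    (G.rootBlock x).Pairwise fun e e' => e.2.toNat < e'.2.toNat := by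
  refine List.Pairwise.filter _ ?_
  simp

end ZDD

/-! ## Building blocks of the query programs -/

/-- The arrays of a top ZDD in memory. -/
noncomputable def TopZDD.segs (D : TopZDD) : List (List ℕ) :=
  [D.header, bpEnc D.bp, bvEnc D.bDummy, D.clsize, D.dstDummy, D.labelSpan,
    D.typeSpan.map Bool.toNat, bvEnc D.bH, D.preorderDiff, D.labelDiff, bvEnc D.bSrcRoot,
    D.dstRoot, D.typeRoot.map Bool.toNat, bvEnc D.bEdge, D.srcIn, D.dstIn,
    D.typeIn.map Bool.toNat]

namespace WordRAM

/-- The memory and all variables outside of `X` have not changed. -/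
def Frame (X : List Var) (σ σ' : Store) : Prop := σ'.m = σ.m ∧ ∀ y, y ∉ X → σ'.v y = σ.v y

theorem Frame.refl {X : List Var} {σ : Store} : Frame X σ σ := ⟨rfl, fun _ _ => rfl⟩

theorem Frame.set {X : List Var} {σ σ' : Store} (h : Frame X σ σ') {x : Var} (hx : x ∈ X) (n : ℕ) :
    Frame X σ (σ'.set x n) :=
  ⟨h.1, fun y hy => by
    have : y ≠ x := fun h => hy (h ▸ hx)
    simp [this, h.2 y hy]⟩

theorem Frame.trans {X Y : List Var} {σ σ' σ'' : Store} (h : Frame X σ σ') (h' : Frame Y σ' σ'')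
    (hs : X ⊆ Y) : Frame Y σ σ'' :=
  ⟨h'.1.trans h.1, fun y hy => (h'.2 y hy).trans (h.2 y fun h => hy (hs h))⟩

/-! ### Binary search -/

/-- Search for the value of `target` among the increasing values `key i` with `lo ≤ i < hi`;
if it is found, its index is stored in `lo`. -/
def search (key : Exp → Exp) (target : Exp) : Prog :=
  .seq (asg .bnd (.var .hi)) <|
  .seq (asg .cmp (.lt (.var .lo) (.var .hi))) <|
  .seq (whileVar .cmp (
    .seq (asg .mid ((.var .lo + .var .hi) / .lit 2)) <|
    .seq (cond (.lt (key (.var .mid)) target)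
      (asg .lo (.var .mid + .lit 1))
      (asg .hi (.var .mid)))
    (asg .cmp (.lt (.var .lo) (.var .hi))))) <|
  cond (.lt (.var .lo) (.var .bnd))
    (asg .found (.eq (key (.var .lo)) target))
    (asg .found (.lit 0))

def searchVars : List Var := [.lo, .hi, .mid, .bnd, .cmp, .found]

/-- Halving the interval is measured by the exponent `k` in `b - a < 2 ^ k`; entries before `a` are
too small and those from `b` on are large enough. Keys and target are evaluated anew in every
iteration, so their values must be known in all stores that differ only in the search variables. -/
theorem tot_search {w L o tv : ℕ} {σ : Store} {key : Exp → Exp} {target : Exp} {K : List ℕ}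
    (hK : K.Pairwise (· < ·)) (hw : 4 * (o + K.length + 1) < 2 ^ w) (hL : K.length < 2 ^ L)
    (hlo : σ.v .lo = o) (hhi : σ.v .hi = o + K.length)
    (hkey : ∀ σ' e m n, Frame searchVars σ σ' → e.ev w σ' = o + m → K[m]? = some n →
      (key e).ev w σ' = n)
    (htv : ∀ σ', Frame searchVars σ σ' → target.ev w σ' = tv) :
    Tot w L (search key target) σ fun σ' => Frame searchVars σ σ' ∧
      ((σ'.v .found = 1 ∧ ∃ m, K[m]? = some tv ∧ σ'.v .lo = o + m) ∨
        (σ'.v .found = 0 ∧ tv ∉ K)) := by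
  have hp := List.pairwise_iff_getElem.1 hK
  let I (k : ℕ) (τ : Store) : Prop := Frame searchVars σ τ ∧ τ.v .bnd = o + K.length ∧
    ∃ a b, τ.v .lo = o + a ∧ τ.v .hi = o + b ∧ a ≤ b ∧ b ≤ K.length ∧ b - a < 2 ^ k ∧
      (τ.v .cmp = if o + a < o + b then 1 else 0) ∧
      (∀ (m : ℕ) (hm : m < K.length), m < a → K[m] < tv) ∧
      (∀ (m : ℕ) (hm : m < K.length), b ≤ m → tv ≤ K[m])
  refine Tot.seq (Tot.asg (Exp.ev_var _) ?_)
  refine Tot.seq (Tot.asg (Exp.ev_lt (Exp.ev_var _) (Exp.ev_var _)) ?_)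
  have h₀ : I L ((σ.set .bnd (σ.v .hi)).set .cmp
      (if (σ.set .bnd (σ.v .hi)).v .lo < (σ.set .bnd (σ.v .hi)).v .hi then 1 else 0)) := by
    refine ⟨(Frame.refl.set (by decide) _).set (by decide) _, by simpa using hhi, 0, K.length, ?_⟩
    refine ⟨by simpa using hlo, by simpa using hhi, Nat.zero_le _, le_rfl, by simpa using hL,
      by simp [hlo, hhi], fun m hm h => by omega, fun m hm h => by omega⟩
  refine Tot.seq (Tot.mono (Tot.while I ?_ le_rfl h₀) ?_)
  · rintro k τ ⟨hF, hbnd, a, b, ha, hb, hab, hbK, hk, hcmp, hl, hr⟩ hne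
    have hlt : a < b := by
      by_contra h
      rw [if_neg (by omega)] at hcmp
      exact hne hcmp
    obtain ⟨j, rfl⟩ : ∃ j, k = j + 1 := by
      cases k with
      | zero => rw [pow_zero] at hk; omega
      | succ j => exact ⟨j, rfl⟩
    refine ⟨j, Nat.lt_succ_self j, ?_⟩
    have hmid : ((Exp.var Var.lo + .var .hi) / .lit 2).ev w τ = o + (a + b) / 2 := by
      rw [Exp.ev_div (Exp.ev_add ((Exp.ev_var _).trans ha) ((Exp.ev_var _).trans hb) (by omega))
        (Exp.ev_lit (by omega))]
      omega
    refine Tot.seq (Tot.asg hmid ?_)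
    have hm : (a + b) / 2 < K.length := by omega
    have hF' := hF.set (x := .mid) (by decide) (o + (a + b) / 2)
    rw [pow_succ] at hk
    refine Tot.seq (Tot.condP (Exp.ev_lt (hkey _ _ _ _ hF' (by simp [Exp.ev_var])
      (List.getElem?_eq_getElem hm)) (htv _ hF')) ?_ ?_)
    · intro hc
      refine Tot.asg (n := o + ((a + b) / 2 + 1)) (Exp.ev_add (x := o + (a + b) / 2)
        (by simp [Exp.ev_var]) (Exp.ev_lit (by omega)) (by omega)) ?_
      refine Tot.asg (Exp.ev_lt (Exp.ev_var _) (Exp.ev_var _)) ?_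
      refine ⟨(hF'.set (by decide) _).set (by decide) _, by simpa using hbnd, (a + b) / 2 + 1, b,
        by simp, by simpa using hb, by omega, hbK, by omega, by simp [hb], ?_, hr⟩
      intro m hm' hlt
      rcases Nat.lt_or_ge m ((a + b) / 2) with h | h
      · exact (hp m _ hm' hm h).trans hc
      · have : m = (a + b) / 2 := by omega
        subst this; exact hc
    · intro hc
      refine Tot.asg (n := o + (a + b) / 2) (by simp [Exp.ev_var]) ?_
      refine Tot.asg (Exp.ev_lt (Exp.ev_var _) (Exp.ev_var _)) ?_
      refine ⟨(hF'.set (by decide) _).set (by decide) _, by simpa using hbnd, a, (a + b) / 2,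
        by simpa using ha, by simp, by omega, by omega, by omega, by simp [ha], hl, ?_⟩
      intro m hm' hle
      rcases Nat.lt_or_ge ((a + b) / 2) m with h | h
      · have := hp _ m hm hm' h
        omega
      · have : m = (a + b) / 2 := by omega
        subst this; omega
  · rintro τ ⟨⟨k, hF, hbnd, a, b, ha, hb, hab, hbK, hk, hcmp, hl, hr⟩, hz⟩
    have hge : a = b := by
      by_contra h
      rw [if_pos (by omega)] at hcmp
      omega
    subst hge
    -- The variable `bnd` still holds the original upper end, which prevents reading an entry beyond
    -- the block.
    refine Tot.condP (Exp.ev_lt ((Exp.ev_var _).trans ha) ((Exp.ev_var _).trans hbnd)) ?_ ?_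
    · intro hlt
      have hm : a < K.length := by omega
      refine Tot.asg (Exp.ev_eq (hkey _ _ _ _ hF ((Exp.ev_var _).trans ha)
        (List.getElem?_eq_getElem hm)) (htv _ hF)) ?_
      refine ⟨hF.set (by decide) _, ?_⟩
      by_cases he : K[a] = tv
      · exact Or.inl ⟨by simp [he], a, by rw [List.getElem?_eq_getElem hm, he], by simpa using ha⟩
      · refine Or.inr ⟨by simp [he], fun hmem => ?_⟩
        obtain ⟨m, hm', hv⟩ := List.mem_iff_getElem.1 hmem
        have h₁ := hr a hm le_rfl
        rcases lt_trichotomy m a with h | h | h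
        · have := hl m hm' h; omega
        · subst h; exact he hv
        · have := hp a m hm hm' h; omega
    · intro hlt
      refine Tot.asg (Exp.ev_lit (by omega)) ?_
      refine ⟨hF.set (by decide) _, Or.inr ⟨by simp, fun hmem => ?_⟩⟩
      obtain ⟨m, hm', hv⟩ := List.mem_iff_getElem.1 hmem
      have := hl m hm' (by omega)
      omega

/-! ### The stack -/

/-- The stack grows downwards from the largest address. -/
def Stack (w : ℕ) (m : ℕ → ℕ) : List (ℕ × ℕ) → Prop
  | [] => True
  | p :: S => m (2 ^ w - (2 * S.length + 1)) = p.1 ∧ m (2 ^ w - (2 * S.length + 2)) = p.2 ∧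
      Stack w m S

/-- The list begins with the pair pushed last, so folding from the left passes from the deepest
cluster up to the root. -/
def unwind (S : List (ℕ × ℕ)) (y : ℕ) : ℕ := S.foldl (fun y p => TopTree.shiftBy p y) y

theorem Stack.update {w : ℕ} {m : ℕ → ℕ} {S : List (ℕ × ℕ)} (h : Stack w m S) {j n : ℕ}
    (hj : 2 * S.length < j) (hw : j ≤ 2 ^ w) : Stack w (Function.update m (2 ^ w - j) n) S := by
  induction S with
  | nil => trivial
  | cons p S ih =>
    rw [List.length_cons] at hj
    refine ⟨?_, ?_, ih h.2.2 (by omega)⟩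
    · rw [Function.update_of_ne (by omega)]; exact h.1
    · rw [Function.update_of_ne (by omega)]; exact h.2.1

def push (a b : Exp) : Prog :=
  .seq (wr (.lit 0 - (.lit 2 * .var .sp + .lit 1)) a) <|
  .seq (wr (.lit 0 - (.lit 2 * .var .sp + .lit 2)) b) (asg .sp (.var .sp + .lit 1))

/-- Addresses at the upper end are obtained by subtraction from 0 with wrap-around, so the program
does not depend on the word length. -/
theorem ev_stack {w n d : ℕ} {σ : Store} (hn : σ.v .sp = n) (hd : 0 < d)
    (hw : 2 * n + d + 2 < 2 ^ w) :
    (Exp.lit 0 - (.lit 2 * .var .sp + .lit d)).ev w σ = 2 ^ w - (2 * n + d) :=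
  Exp.ev_neg (Exp.ev_lit (by omega)) (Exp.ev_add (Exp.ev_mul (Exp.ev_lit (by omega))
    ((Exp.ev_var _).trans hn) (by omega)) (Exp.ev_lit (by omega)) (by omega)) (by omega)

/-- The value of `b` is required for every memory because it is evaluated after the first component
has been written. -/
theorem tot_push {w L U n₁ n₂ : ℕ} {segs : List (List ℕ)} {σ : Store} {Q : Store → Prop}
    {S : List (ℕ × ℕ)} {a b : Exp} (hS : Stack w σ.m S) (hsp : σ.v .sp = S.length)
    (hσ : Holds w U segs σ.m) (hU : S.length ≤ U) (ha : a.ev w σ = n₁)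
    (hb : ∀ m, b.ev w ⟨σ.v, m⟩ = n₂)
    (h : ∀ m, Stack w m ((n₁, n₂) :: S) → Holds w U segs m →
      Q ((⟨σ.v, m⟩ : Store).set .sp (S.length + 1))) : Tot w L (push a b) σ Q := by
  have hlt := hσ.lt
  refine Tot.seq (Tot.wr (ev_stack hsp (by omega) (by omega)) ha ?_)
  refine Tot.seq (Tot.wr (ev_stack (by simpa using hsp) (by omega) (by omega)) (hb _) ?_)
  refine Tot.asg (Exp.ev_add (by simpa [Exp.ev_var] using hsp) (Exp.ev_lit (by omega))
    (by omega)) ?_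
  refine h _ ⟨?_, ?_, ?_⟩ ?_
  · rw [Function.update_of_ne (by omega)]
    simp [Store.write]
  · simp [Store.write]
  · exact (hS.update (by omega) (by omega)).update (by omega) (by omega)
  · exact (hσ.write (by omega)).write (by omega)

/-- Convert the local preorder in `out` into a global one by means of the stack. -/
def unwindProg : Prog :=
  whileVar .sp (
    .seq (asg .sp (.var .sp - .lit 1)) <|
    cond (.lt (.rd (.lit 0 - (.lit 2 * .var .sp + .lit 1))) (.var .out))
      (asg .out (.var .out + .rd (.lit 0 - (.lit 2 * .var .sp + .lit 2)))) .skip)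

theorem le_shiftBy (p : ℕ × ℕ) (y : ℕ) : y ≤ TopTree.shiftBy p y := by
  rw [TopTree.shiftBy]; split_ifs <;> omega

/-- Shifts never decrease a number, so all intermediate values are bounded by the final one and
cannot overflow. -/
theorem le_unwind (S : List (ℕ × ℕ)) (y : ℕ) : y ≤ unwind S y := by
  induction S generalizing y with
  | nil => exact le_rfl
  | cons p S ih => exact (le_shiftBy p y).trans (ih _)

theorem tot_unwind {w L U z : ℕ} {σ : Store} {S : List (ℕ × ℕ)} (hS : Stack w σ.m S)
    (hsp : σ.v .sp = S.length) (hL : S.length ≤ L) (hU : S.length ≤ U) (hz : z ≤ U)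
    (hw : 100 * (U + 1) < 2 ^ w) (hout : unwind S (σ.v .out) = z) :
    Tot w L unwindProg σ fun σ' => σ'.v .out = z := by
  let I (k : ℕ) (τ : Store) : Prop := τ.m = σ.m ∧ ∃ S : List (ℕ × ℕ), Stack w τ.m S ∧
    τ.v .sp = S.length ∧ k = S.length ∧ k ≤ U ∧ unwind S (τ.v .out) = z
  refine Tot.mono (Tot.while I ?_ hL ⟨rfl, S, hS, hsp, rfl, hU, hout⟩) ?_
  · rintro k τ ⟨hm, S, hS, hsp, rfl, hU, hout⟩ hne
    cases S with
    | nil => exact (hne hsp).elim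
    | cons p S =>
      obtain ⟨h₁, h₂, h₃⟩ := hS
      rw [List.length_cons] at *
      refine ⟨S.length, Nat.lt_succ_self _, ?_⟩
      refine Tot.seq (Tot.asg (n := S.length) ((Exp.ev_sub ((Exp.ev_var _).trans hsp)
        (Exp.ev_lit (by omega)) (by omega) (by omega)).trans (by omega)) ?_)
      have hle := le_unwind S (TopTree.shiftBy p (τ.v .out))
      have hout' : unwind S (TopTree.shiftBy p (τ.v .out)) = z := hout
      rw [hout'] at hle
      refine Tot.condP (Exp.ev_lt ((Exp.ev_rd (ev_stack (by simp) (by omega) (by omega))).trans h₁)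
        (Exp.ev_var _)) ?_ ?_
      · intro hc
        have hs : TopTree.shiftBy p (τ.v .out) = τ.v .out + p.2 := by
          rw [TopTree.shiftBy, if_pos (by simpa using hc)]
        refine Tot.asg (Exp.ev_add (x := τ.v .out) (by simp [Exp.ev_var])
          ((Exp.ev_rd (ev_stack (by simp) (by omega) (by omega))).trans h₂) (by omega)) ?_
        exact ⟨hm, S, h₃, by simp, rfl, by omega, by simpa [hs] using hout'⟩
      · intro hc
        have hs : TopTree.shiftBy p (τ.v .out) = τ.v .out := by
          rw [TopTree.shiftBy, if_neg (by simpa using hc)]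
        refine Tot.skip ⟨hm, S, h₃, by simp, rfl, by omega, by simpa [hs] using hout'⟩
  · rintro τ ⟨⟨k, -, S, -, hsp, -, -, hout⟩, hz'⟩
    rw [hz'] at hsp
    rw [List.length_eq_zero_iff.1 hsp.symm] at hout
    exact hout

end WordRAM

/-! ## Navigation in the unfolded top DAG -/

namespace PTree

variable {α : Type*}

/-- The number of the right child, or `0` for a leaf. -/
def rightChild (n : ℕ) : PTree α → ℕ
  | node _ l _ => n + 1 + l.vertices.length
  | _ => 0

end PTree

namespace WordRAM

/-- Replace a dummy by the vertex it points to; then store the number of its right child and the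
number of leaves that precede it. -/
def resolve : Prog :=
  .seq (asg .right (tri 1 (.var .node) 0)) <|
  .seq (asg .cnt (tri 1 (.var .node) 1)) <|
  cond (.eq (.var .right) (.lit 0))
    (cond (tri 2 (.var .cnt) 0)
      (.seq (asg .node (seg 4 (tri 2 (.var .cnt) 1) - .lit 1)) <|
       .seq (asg .right (tri 1 (.var .node) 0)) (asg .cnt (tri 1 (.var .node) 1))) .skip) .skip

/-- Store in `siz` the number of nodes of the cluster at vertex number `e`. -/
def sizeOf (e : Exp) : Prog :=
  .seq (asg .lo (tri 1 e 1)) <|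
  .seq (asg .hi (tri 1 e 2)) <|
  .seq (asg .base (tri 2 (.var .lo) 1)) <|
  .seq (asg .mid (tri 2 (.var .hi) 1)) <|
  .seq (cond (.var .base) (asg .siz (seg 3 (.var .base - .lit 1))) (asg .siz (.lit 0))) <|
  .seq (cond (.var .mid) (asg .bnd (seg 3 (.var .mid - .lit 1))) (asg .bnd (.lit 0))) <|
  -- This is `size_eq`: `lo` and `hi` are leaf counts at the two ends of the subtree, `base` and
  -- `mid` the dummy counts, `siz` and `bnd` the dummy sums. All terms are collected before the
  -- single subtraction, so nothing becomes negative.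
  asg .siz (.lit 1 + .var .hi + .var .bnd + .lit 2 * .var .base -
    (.var .lo + .var .siz + .lit 2 * .var .mid))

def sizeVars : List Var := [.lo, .hi, .base, .mid, .siz, .bnd]

/-- One step of the descent, see `TopTree.descend`. -/
def step (tl tr : Bool) : Prog :=
  .seq (asg .base (.var .node - .var .cnt)) <|
  cond (tri 7 (.var .base) 0)
    (.seq (sizeOf (.var .node + .lit 1)) <|
      cond (.lt (.var .pos) (.var .siz + .lit 1))
        (cond (if tr then .eq (.var .pos) (.lit 1) else .lit 0)
          (.seq (push (.lit 1) (.var .siz - .lit 1)) (asg .node (.var .right)))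
          (.seq (push (.lit 0) (.lit 0)) (asg .node (.var .node + .lit 1))))
        (.seq (push (.lit 1) (.var .siz - .lit 1)) <|
          .seq (asg .pos (.var .pos + .lit 1 - .var .siz)) (asg .node (.var .right))))
    (.seq (asg .base (.var .base - tri 7 (.var .base) 1)) <|
      .seq (asg .dep (seg 8 (.var .base))) <|
      .seq (asg .dif (seg 9 (.var .base))) <|
      .seq (sizeOf (.var .right)) <|
      -- Since `pos` is `k + 1` and `dep` is `l.parts.1.length + 1`, this tests `k + tl.toNat ≤
      -- l.parts.1.length`.
      cond (.lt (.var .pos) (.var .dep + .lit (1 - tl.toNat)))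
        (.seq (push (.var .dep) (.var .siz - .lit 1)) (asg .node (.var .node + .lit 1)))
        (cond (.lt (.var .pos) (.var .dep + .var .siz))
          (.seq (push (.lit 0) (.var .dep - .lit 1)) <|
            .seq (asg .pos (.var .pos + .lit 1 - .var .dep)) <|
            .seq (asg .acc (.var .acc + .var .dif)) (asg .node (.var .right)))
          (.seq (push (.var .dep) (.var .siz - .lit 1)) <|
            .seq (asg .pos (.var .pos + .lit 1 - .var .siz)) (asg .node (.var .node + .lit 1)))))

end WordRAM

-- Correctness of dummy resolution and size computation

namespace ZDD.IsDag

open WordRAM PTree TopTree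

variable {V : Type*} [Fintype V] [DecidableEq V] {c : ℕ} {G : ZDD V c}
  {P s : PTree (TopTree V)} {L : List (Bool × TopTree V)} {I : List (TopTree V)} {w N U : ℕ}
  {σ : Store}

theorem segs_bp (h : G.IsDag P) : G.topZDD.segs[1]? = some (interleave (P.nodeTable 0 0)) := by
  have : G.topZDD.bp = P.bp := by simp [topZDD, h.eq]
  rw [← bpEnc_bp, ← this]
  rfl

theorem ev_node (h : G.IsDag P) (hσ : Holds w U G.topZDD.segs σ.m) (hs : At P L I s) {e : Exp}
    (he : e.ev w σ = L.length + I.length) :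
    (tri 1 e 0).ev w σ = s.rightChild (L.length + I.length) ∧ (tri 1 e 1).ev w σ = L.length ∧
      (tri 1 e 2).ev w σ = L.length + s.leaves.length ∧
      s.rightChild (L.length + I.length) ≤ U ∧ L.length + s.leaves.length ≤ U ∧
      L.length + I.length ≤ U := by
  obtain ⟨x, hx, h₁, h₂, h₃⟩ := hs.getElem?_nodeTable
  obtain ⟨⟨e₀, b₀⟩, ⟨e₁, b₁⟩, ⟨e₂, b₂⟩, b⟩ := hσ.ev_tri h.segs_bp he hx
  have h₃' : x.1 = s.rightChild (L.length + I.length) := by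
    rw [h₃]; cases s <;> rfl
  rw [h₃'] at e₀ b₀
  rw [h₁] at e₁
  rw [h₂] at e₂ b₂
  exact ⟨e₀, e₁, e₂, b₀, b₂, b⟩

theorem ev_dummy (h : G.IsDag P) (hσ : Holds w U G.topZDD.segs σ.m) {X B : List (Bool × TopTree V)}
    (hX : P.leaves = X ++ B) {e : Exp} (he : e.ev w σ = X.length) :
    (tri 2 e 1).ev w σ = dummyCount X ∧ ∀ p, B[0]? = some p → (tri 2 e 0).ev w σ = p.1.toNat := by
  obtain ⟨x, hx, h₁, h₂⟩ := h.bDummy hX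
  obtain ⟨⟨e₀, -⟩, ⟨e₁, -⟩, -, -⟩ := hσ.ev_tri (j := 2) rfl he hx
  exact ⟨e₁.trans h₁, fun p hp => e₀.trans (h₂ p hp)⟩

def resolveVars : List Var := [.node, .right, .cnt]

theorem tot_resolve (h : G.IsDag P) (hσ : Holds w U G.topZDD.segs σ.m) (hs : At P L I s)
    (hn : σ.v .node = L.length + I.length) :
    Tot w N resolve σ fun σ' => Frame resolveVars σ σ' ∧ ∃ L' I' s', At P L' I' s' ∧
      σ'.v .node = L'.length + I'.length ∧ G.key s'.label = G.key s.label ∧ (∀ t, s' ≠ dummy t) ∧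
      σ'.v .right = s'.rightChild (L'.length + I'.length) ∧ σ'.v .cnt = L'.length := by
  have hlt := hσ.lt
  obtain ⟨e₀, e₁, -, b₀, b₁, b⟩ := h.ev_node hσ hs (e := .var .node) hn
  refine Tot.seq (Tot.asg e₀ ?_)
  obtain ⟨-, e₁', -⟩ := h.ev_node (σ := σ.set .right (s.rightChild (L.length + I.length))) hσ hs
    (e := .var .node) (by simpa [Exp.ev_var] using hn)
  refine Tot.seq (Tot.asg e₁' ?_)
  have hF : Frame resolveVars σ ((σ.set .right (s.rightChild (L.length + I.length))).set .cnt
      L.length) := (Frame.refl.set (by decide) _).set (by decide) _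
  -- Vertex 0 is the root and never a right child, so 0 can mark leaves.
  refine Tot.condP (P := s.rightChild (L.length + I.length) = 0)
    (Exp.ev_eq (by simp [Exp.ev_var]) (Exp.ev_lit (by omega))) ?_ ?_
  · intro hc
    obtain ⟨B, hL⟩ := hs.leaves
    have hcnt : (Exp.var Var.cnt).ev w ((σ.set .right (s.rightChild (L.length + I.length))).set .cnt
      L.length) = L.length := by simp [Exp.ev_var]
    obtain ⟨d₁, d₀⟩ := h.ev_dummy (σ := (σ.set .right (s.rightChild (L.length + I.length))).set .cnt
      L.length) hσ hL hcnt
    have stay (h' : ∀ t, s ≠ dummy t) : ∃ L' I' s', At P L' I' s' ∧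
        ((σ.set .right (s.rightChild (L.length + I.length))).set .cnt L.length).v .node =
          L'.length + I'.length ∧ G.key s'.label = G.key s.label ∧ (∀ t, s' ≠ dummy t) ∧
        ((σ.set .right (s.rightChild (L.length + I.length))).set .cnt L.length).v .right =
          s'.rightChild (L'.length + I'.length) ∧
        ((σ.set .right (s.rightChild (L.length + I.length))).set .cnt L.length).v .cnt =
          L'.length :=
      ⟨L, I, s, hs, by simpa using hn, rfl, h', by simp, by simp⟩
    cases s with
    | dummy t =>
      refine Tot.cond (d₀ (true, t) rfl) (fun _ => ?_) (fun h => by simp at h)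
      have hdst := h.dstDummy hs
      obtain ⟨L', I', s', h₁, h₂, h₃, h₄⟩ := h.dagPre hs
      obtain ⟨v₁, v₂⟩ := hσ.ev_seg (j := 4)
        (σ := (σ.set .right ((dummy t).rightChild (L.length + I.length))).set .cnt L.length)
        rfl d₁ hdst
      refine Tot.seq (Tot.asg (n := L'.length + I'.length) ((Exp.ev_sub v₁ (Exp.ev_lit (by omega))
        (by omega) (by omega)).trans (by omega)) ?_)
      obtain ⟨f₀, -⟩ := h.ev_node (σ := (((σ.set .right ((dummy t).rightChild
        (L.length + I.length))).set .cnt L.length).set .node (L'.length + I'.length))) hσ h₁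
        (e := .var .node) (by simp [Exp.ev_var])
      refine Tot.seq (Tot.asg f₀ ?_)
      obtain ⟨-, f₁, -⟩ := h.ev_node (σ := (((σ.set .right ((dummy t).rightChild
        (L.length + I.length))).set .cnt L.length).set .node (L'.length + I'.length)).set .right
        (s'.rightChild (L'.length + I'.length))) hσ h₁
        (e := .var .node) (by simp [Exp.ev_var])
      refine Tot.asg f₁ ?_
      exact ⟨((hF.set (by decide) _).set (by decide) _).set (by decide) _, L', I', s', h₁,
        by simp, h₃, h₄, by simp, by simp⟩
    | leaf t =>
      refine Tot.cond (d₀ (false, t) rfl) (fun h => by simp at h) (fun _ => ?_)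
      exact Tot.skip ⟨hF, stay (by simp)⟩
    | node t l r => simp [rightChild] at hc
  · intro hc
    refine Tot.skip ⟨hF, L, I, s, hs, by simpa using hn, rfl, ?_, by simp, by simp⟩
    rintro t rfl
    exact hc rfl

/-- The expression `e` is evaluated twice, the second time after `lo` has been overwritten, so its
value is required throughout the frame. -/
theorem tot_sizeOf (h : G.IsDag P) (hσ : Holds w U G.topZDD.segs σ.m) (hs : At P L I s) {e : Exp}
    (he : ∀ σ', Frame sizeVars σ σ' → e.ev w σ' = L.length + I.length) :
    Tot w N (sizeOf e) σ fun σ' => Frame sizeVars σ σ' ∧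
      σ'.v .siz = s.label.headList.length + 1 := by
  have hlt := hσ.lt
  obtain ⟨B, hL⟩ := hs.leaves
  have hL' : P.leaves = (L ++ s.leaves) ++ B := by rw [hL, List.append_assoc]
  obtain ⟨-, e₁, -, -, b₂, -⟩ := h.ev_node hσ hs (he σ Frame.refl)
  refine Tot.seq (Tot.asg e₁ ?_)
  set σ₁ := σ.set .lo L.length with h₁
  have F₁ : Frame sizeVars σ σ₁ := Frame.refl.set (by decide) _
  obtain ⟨-, -, e₂, -⟩ := h.ev_node (σ := σ₁) hσ hs (he σ₁ F₁)
  refine Tot.seq (Tot.asg e₂ ?_)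
  set σ₂ := σ₁.set .hi (L.length + s.leaves.length) with h₂
  have F₂ : Frame sizeVars σ σ₂ := F₁.set (by decide) _
  obtain ⟨e₃, -⟩ := h.ev_dummy (σ := σ₂) hσ hL (e := .var .lo) (by simp [Exp.ev_var, h₂, h₁])
  refine Tot.seq (Tot.asg e₃ ?_)
  set σ₃ := σ₂.set .base (dummyCount L) with h₃
  have F₃ : Frame sizeVars σ σ₃ := F₂.set (by decide) _
  obtain ⟨e₄, -⟩ := h.ev_dummy (σ := σ₃) hσ hL' (e := .var .hi)
    (by simp [Exp.ev_var, h₃, h₂])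
  refine Tot.seq (Tot.asg e₄ ?_)
  set σ₄ := σ₃.set .mid (dummyCount (L ++ s.leaves)) with h₄
  have F₄ : Frame sizeVars σ σ₄ := F₃.set (by decide) _
  have c₁ := dummyCount_le L
  have c₂ := dummyCount_le (L ++ s.leaves)
  rw [List.length_append] at c₂
  -- Without preceding dummies there is no entry to read; the program uses 0, which is the right
  -- sum.
  have zero : ∀ X : List (Bool × TopTree V), dummyCount X = 0 → dummySum X = 0 := by
    intro X hX
    rw [dummyCount, List.count_eq_zero] at hX
    have : X.filter (fun p => p.1) = [] := by
      rw [List.filter_eq_nil_iff]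
      intro p hp hp'
      exact hX (List.mem_map.2 ⟨p, hp, hp'⟩)
    rw [dummySum, this]; rfl
  -- A nonzero sum is itself an entry in memory, so the general bound on entries excludes overflow.
  have bound : ∀ X B : List (Bool × TopTree V), P.leaves = X ++ B → dummySum X ≤ U := by
    intro X B hX
    by_cases hd : dummyCount X = 0
    · rw [zero X hd]; exact Nat.zero_le _
    · have := h.clsize hX hd
      have hj : G.topZDD.segs[3]? = some G.topZDD.clsize := rfl
      have hk := (List.getElem?_eq_some_iff.1 this).1
      exact hσ.le _ (List.mem_of_getElem? ((getElem?_layout hj hk).trans this))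
  have s₁ := bound L _ hL
  have s₂ := bound _ _ hL'
  refine Tot.seq (Tot.mono (Q := fun σ' => σ' = σ₄.set .siz (dummySum L))
    (Tot.cond (n := dummyCount L) (by simp [Exp.ev_var, h₄, h₃]) (fun hd => ?_) fun hd => ?_) ?_)
  · exact Tot.asg (hσ.ev_seg (j := 3) (σ := σ₄) rfl (Exp.ev_sub (x := dummyCount L)
      (by simp [Exp.ev_var, h₄, h₃])
      (Exp.ev_lit (by omega)) (by omega) (by omega)) (h.clsize hL hd)).1 rfl
  · exact Tot.asg (Exp.ev_lit (by omega)) (by rw [zero L hd])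
  rintro _ rfl
  refine Tot.seq (Tot.mono (Q := fun σ' => σ' = (σ₄.set .siz (dummySum L)).set .bnd
    (dummySum (L ++ s.leaves)))
    (Tot.cond (n := dummyCount (L ++ s.leaves)) (by simp [Exp.ev_var, h₄]) (fun hd => ?_)
      fun hd => ?_) ?_)
  · exact Tot.asg (hσ.ev_seg (j := 3) (σ := σ₄.set .siz (dummySum L)) rfl (Exp.ev_sub
      (x := dummyCount (L ++ s.leaves)) (by simp [Exp.ev_var, h₄])
      (Exp.ev_lit (by omega)) (by omega) (by omega)) (h.clsize hL' hd)).1 rfl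
  · exact Tot.asg (Exp.ev_lit (by omega)) (by rw [zero _ hd])
  rintro _ rfl
  have hsz := h.size_eq hs
  refine Tot.asg (n := s.label.headList.length + 1) ((Exp.ev_sub
    (x := 1 + (L.length + s.leaves.length) + dummySum (L ++ s.leaves) + 2 * dummyCount L)
    (y := L.length + dummySum L + 2 * dummyCount (L ++ s.leaves)) ?_ ?_ (by omega)
    (by omega)).trans (by omega)) ⟨((F₄.set (by decide) _).set (by decide) _).set (by decide) _,
      by simp⟩
  · exact Exp.ev_add (Exp.ev_add (Exp.ev_add (Exp.ev_lit (by omega))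
      (by simp [Exp.ev_var, h₄, h₃, h₂]) (by omega)) (by simp [Exp.ev_var]) (by omega))
      (Exp.ev_mul (Exp.ev_lit (by omega)) (by simp [Exp.ev_var, h₄, h₃]) (by omega)) (by omega)
  · exact Exp.ev_add (Exp.ev_add (x := L.length) (y := dummySum L)
      (by simp [Exp.ev_var, h₄, h₃, h₂, h₁])
      (by simp [Exp.ev_var]) (by omega)) (Exp.ev_mul (Exp.ev_lit (by omega))
        (by simp [Exp.ev_var, h₄]) (by omega)) (by omega)

end ZDD.IsDag

/-! ## The descent -/

namespace ZDD

open WordRAM PTree TopTree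

variable {V : Type*} [Fintype V] [DecidableEq V] {c : ℕ} {G : ZDD V c}
  {P : PTree (TopTree V)} {w N U H : ℕ} {σ σ' : Store} {x : V} {t : TopTree V} {k : ℕ}

/-- During a descent, `pos` is the local preorder of `x` in the current cluster `t`, `acc` is the
label of its top boundary node, and the stack describes the passage from local to global
preorders. -/
structure Path (G : ZDD V c) (w U H : ℕ) (x : V) (t : TopTree V) (k : ℕ) (σ : Store) : Prop where
  holds : Holds w U G.topZDD.segs σ.m
  cluster : G.IsCluster t
  elem : t.localOrder[k]? = some x
  pos : σ.v .pos = k + 1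
  acc : σ.v .acc = G.label t.top
  stack : ∃ S, Stack w σ.m S ∧ σ.v .sp = S.length ∧ S.length + t.height ≤ H ∧
    ∀ j z, t.localOrder[j]? = some z → unwind S (j + 1) = G.pre z

/-- The variable `node` is the number of a vertex that stands for `t`, possibly of a dummy. -/
def NodeAt (G : ZDD V c) (P : PTree (TopTree V)) (t : TopTree V) (σ : Store) : Prop :=
  ∃ L I s, At P L I s ∧ σ.v .node = L.length + I.length ∧ G.key s.label = G.key t

/-- The variable `node` is the number of a proper vertex that stands for `t`. -/
def Resolved (G : ZDD V c) (P : PTree (TopTree V)) (t : TopTree V) (σ : Store) : Prop :=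
  ∃ L I s, At P L I s ∧ σ.v .node = L.length + I.length ∧ G.key s.label = G.key t ∧
    (∀ t, s ≠ dummy t) ∧ σ.v .right = s.rightChild (L.length + I.length) ∧ σ.v .cnt = L.length

theorem Path.of_frame (h : Path G w U H x t k σ) {X : List Var} (hF : Frame X σ σ')
    (h₁ : .pos ∉ X) (h₂ : .acc ∉ X) (h₃ : .sp ∉ X) : Path G w U H x t k σ' := by
  obtain ⟨a, b, c, d, e, f⟩ := h
  exact ⟨by rwa [hF.1], b, c, by rwa [hF.2 _ h₁], by rwa [hF.2 _ h₂],
    by rwa [hF.1, hF.2 _ h₃]⟩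

theorem Resolved.of_frame (h : Resolved G P t σ) {X : List Var} (hF : Frame X σ σ')
    (h₁ : .node ∉ X) (h₂ : .right ∉ X) (h₃ : .cnt ∉ X) : Resolved G P t σ' := by
  obtain ⟨L, I, s, a, b, c, d, e, f⟩ := h
  exact ⟨L, I, s, a, by rwa [hF.2 _ h₁], c, d, by rwa [hF.2 _ h₂], by rwa [hF.2 _ h₃]⟩

theorem IsDag.tot_resolve_path (h : G.IsDag P) (hp : Path G w U H x t k σ) (hn : NodeAt G P t σ) :
    Tot w N resolve σ fun σ' => Frame IsDag.resolveVars σ σ' ∧ Path G w U H x t k σ' ∧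
      Resolved G P t σ' := by
  obtain ⟨L, I, s, hs, hn, hk⟩ := hn
  refine (h.tot_resolve hp.holds hs hn).mono ?_
  rintro σ' ⟨hF, L', I', s', h₁, h₂, h₃, h₄⟩
  exact ⟨hF, hp.of_frame hF (by decide) (by decide) (by decide), L', I', s', h₁, h₂, h₃.trans hk, h₄⟩

/-- The vertex is internal if and only if it has a right child. -/
theorem IsDag.resolved_right (h : G.IsDag P) (hr : Resolved G P t σ) :
    σ.v .right ≠ 0 ↔ t.IsInternal := by
  obtain ⟨L, I, s, hs, -, hk, hd, hr, -⟩ := hr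
  have hl := h.labelled.of_at hs
  cases s with
  | dummy t' => exact (hd t' rfl).elim
  | leaf t' =>
    obtain ⟨u, v, b, rfl⟩ := hl
    obtain ⟨u', v', rfl, -⟩ := key_eq_edge hk.symm
    simp [hr, rightChild, IsInternal]
  | node t' l r =>
    have : t.IsInternal := by
      rcases hl.2.2 with rfl | ⟨b, rfl⟩
      · obtain ⟨_, _, rfl, -⟩ := key_eq_vert hk.symm; trivial
      · obtain ⟨_, _, rfl, -⟩ := key_eq_horiz hk.symm; trivial
    simp [hr, rightChild, this]

/-- The stack grows by one pair while the height drops by at least one, so `H` keeps bounding their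
sum; the new pair composes with the old conversion by `getElem?_shift`. -/
theorem Path.child (hp : Path G w U H x t k σ) (hi : t.IsInternal) (tl tr : Bool)
    {S : List (ℕ × ℕ)} (hH : S.length + t.height ≤ H)
    (hS : ∀ j z, t.localOrder[j]? = some z → unwind S (j + 1) = G.pre z)
    (h₁ : Holds w U G.topZDD.segs σ'.m) (h₂ : Stack w σ'.m (t.shift tl tr k :: S))
    (h₃ : σ'.v .sp = S.length + 1) (h₄ : σ'.v .pos = (t.descend tl tr k).2 + 1)
    (h₅ : σ'.v .acc = G.label (t.descend tl tr k).1.top) :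
    Path G w U H x (t.descend tl tr k).1 (t.descend tl tr k).2 σ' := by
  refine ⟨h₁, hp.cluster.of_mem_vertices (descend_mem_vertices tl tr k),
    getElem?_descend tl tr k hp.cluster.1 hp.elem, h₄, h₅, _, h₂, h₃, ?_, ?_⟩
  · have := height_descend tl tr k hi
    rw [List.length_cons]
    omega
  · intro j z hz
    obtain ⟨i, hi, hz'⟩ := getElem?_shift tl tr k hp.cluster.1 hz
    have := hS i z hz'
    rwa [hi] at this

def keptVars : List Var := [.inp, .found, .run, .out]

/-- The arrays describe the representative `s.label`, while the descent takes place in the cluster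
`t` of the actual occurrence. Only their keys agree, but the merge type, the sizes of the children,
the position of the boundary node and the label difference depend only on keys, so each value read
is right for `t`. The cases are those of `descend`. -/
theorem IsDag.tot_step (h : G.IsDag P) (hp : Path G w U H x t k σ) (hr : Resolved G P t σ)
    (hi : t.IsInternal) (hV : Fintype.card V ≤ U) (hc : c ≤ U) (hH : H ≤ U) (tl tr : Bool) :
    Tot w N (step tl tr) σ fun σ' =>
      Path G w U H x (t.descend tl tr k).1 (t.descend tl tr k).2 σ' ∧
      NodeAt G P (t.descend tl tr k).1 σ' ∧ ∀ y ∈ keptVars, σ'.v y = σ.v y := by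
  have hlt := hp.holds.lt
  obtain ⟨S, hS, hsp, hSH, hSu⟩ := hp.stack
  obtain ⟨L, I, s, hs, hn, hk, hnd, hright, hcnt⟩ := id hr
  have hposlt : k + 1 ≤ U := by
    have h₁ := (List.getElem?_eq_some_iff.1 hp.elem).1
    have h₂ := hp.cluster.length_le
    rw [localOrder_length] at h₁
    omega
  have hlen := hp.cluster.length_le
  have hne := (h.resolved_right hr).2 hi
  obtain ⟨t₀, sl, sr, rfl⟩ : ∃ t₀ sl sr, s = node t₀ sl sr := by
    cases s with
    | dummy => simp [rightChild] at hright; exact (hne hright).elim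
    | leaf => simp [rightChild] at hright; exact (hne hright).elim
    | node t₀ sl sr => exact ⟨t₀, sl, sr, rfl⟩
  have hl := hs.left
  have hrr := hs.right
  have hlidx : L.length + (I ++ [t₀]).length = L.length + I.length + 1 := by simp; omega
  have hridx : (L ++ sl.leaves).length + (I ++ t₀ :: sl.internals).length =
      (node t₀ sl sr).rightChild (L.length + I.length) := by
    simp [rightChild, PTree.length_vertices]; omega
  obtain ⟨-, -, -, bl₀, -, bl⟩ := h.ev_node (e := .lit (L.length + I.length)) hp.holds hs
    (Exp.ev_lit (by
      obtain ⟨-, -, -, -, -, b⟩ := h.ev_node (e := .var .node) hp.holds hs hn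
      omega))
  have hlab := (h.labelled.of_at hs).2.2
  refine Tot.seq (Tot.asg (n := I.length) ((Exp.ev_sub ((Exp.ev_var _).trans hn)
    ((Exp.ev_var _).trans hcnt) (by omega) (by omega)).trans (by omega)) ?_)
  obtain ⟨y, hy, hy₁, hy₂⟩ := h.bH hs
  obtain ⟨⟨e₀, -⟩, ⟨e₁, -⟩, -⟩ := hp.holds.ev_tri (σ := σ.set .base I.length) (j := 7) rfl
    (e := .var .base) (by simp [Exp.ev_var]) hy
  rw [hy₂] at e₀
  rw [hy₁] at e₁
  have F₁ : Frame [.base] σ (σ.set .base I.length) := Frame.refl.set (by decide) _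
  refine Tot.cond e₀ (fun hh => ?_) fun hh => ?_
  · obtain ⟨b, l, r, rfl⟩ : ∃ b l r, t = horiz b l r := by
      rcases hlab with h' | ⟨b, h'⟩
      · simp [h', isHoriz] at hh
      · simp only [PTree.label] at hk
        rw [h'] at hk
        obtain ⟨l, r, h₁, -⟩ := key_eq_horiz hk.symm
        exact ⟨b, l, r, h₁⟩
    obtain ⟨l', r', h₀, hkl, hkr⟩ := key_eq_horiz hk
    have hlr : l' = sl.label ∧ r' = sr.label := by
      simp only [PTree.label] at h₀
      rcases hlab with h' | ⟨b', h'⟩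
      · rw [h'] at h₀; cases h₀
      · rw [h'] at h₀; cases h₀; exact ⟨rfl, rfl⟩
    obtain ⟨rfl, rfl⟩ := hlr
    rw [headList_horiz, List.length_append] at hlen
    refine Tot.seq ((h.tot_sizeOf (N := N) (σ := σ.set .base I.length) hp.holds hl
      (e := .var .node + .lit 1) ?_).mono ?_)
    · intro σ' hF
      rw [hlidx]
      exact Exp.ev_add ((Exp.ev_var _).trans ((hF.2 _ (by decide)).trans (by simpa using hn)))
        (Exp.ev_lit (by omega)) (by omega)
    rintro σ₁ ⟨F₂, hsiz⟩
    rw [headList_length_of_key hkl] at hsiz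
    have F := F₁.trans F₂ (Y := sizeVars) (by decide)
    have hp₁ := hp.of_frame F (by decide) (by decide) (by decide)
    have hr₁ := hr.of_frame F (by decide) (by decide) (by decide)
    have hS₁ : Stack w σ₁.m S := by rw [F.1]; exact hS
    have hsp₁ : σ₁.v .sp = S.length := (F.2 _ (by decide)).trans hsp
    have hn₁ : σ₁.v .node = L.length + I.length := (F.2 _ (by decide)).trans hn
    have hright₁ := (F.2 .right (by decide)).trans hright
    have hkeep : ∀ y ∈ keptVars, σ₁.v y = σ.v y := fun y hy => F.2 y (by
      revert hy; cases y <;> decide)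
    have hpos := hp₁.pos
    refine Tot.condP (Exp.ev_lt (Exp.ev_var _) (Exp.ev_add ((Exp.ev_var _).trans hsiz)
      (Exp.ev_lit (by omega)) (by omega))) (fun hc₁ => ?_) fun hc₁ => ?_
    -- Only the common top, with local preorder 1, is diverted to the right child, and only if `tr`
    -- is set.
    · have hke : (if tr then Exp.eq (.var .pos) (.lit 1) else Exp.lit 0).ev w σ₁ =
          if tr = true ∧ k = 0 then 1 else 0 := by
        cases tr
        · simpa using Exp.ev_lit (x := 0) (by omega)
        · simp only [if_true, true_and]
          rw [Exp.ev_eq ((Exp.ev_var _).trans hpos) (Exp.ev_lit (by omega))]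
          congr 1
          simp
      refine Tot.condP hke (fun hc₂ => ?_) fun hc₂ => ?_
      · have hd : (horiz b l r).descend tl tr k = (r, k - l.headList.length) := by
          simp only [descend]; rw [if_neg (by tauto)]
        have hsh : (horiz b l r).shift tl tr k = (1, l.headList.length) := by
          simp only [shift]; rw [if_neg (by tauto)]
        rw [hd]
        refine Tot.seq (tot_push (n₁ := 1) (n₂ := l.headList.length) hS₁ hsp₁ hp₁.holds (by omega)
          (Exp.ev_lit (by omega)) (fun m => (Exp.ev_sub (x := l.headList.length + 1)
            (by simpa [Exp.ev_var] using hsiz) (Exp.ev_lit (by omega)) (by omega)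
            (by omega)).trans (by omega)) fun m hm₁ hm₂ => ?_)
        refine Tot.asg (Exp.ev_var _) ?_
        have := hp₁.child hi tl tr hSH hSu (σ' := ((⟨σ₁.v, m⟩ : Store).set .sp (S.length + 1)).set
          .node (σ₁.v .right)) hm₂ (by rw [hsh]; exact hm₁) (by simp)
          (by rw [hd]; simp; omega)
          (by rw [hd]; simp [hp₁.acc, top, hp.cluster.1.2.2.1])
        rw [hd] at this
        refine ⟨this, ⟨_, _, sr, hrr, by simp only [Store.set_v, if_true]; rw [hridx]; exact hright₁,
          hkr⟩, fun y hy => ?_⟩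
        rw [← hkeep y hy]
        revert hy; cases y <;> simp [keptVars]
      · have hd : (horiz b l r).descend tl tr k = (l, k) := by
          simp only [descend]; rw [if_pos ⟨by omega, hc₂⟩]
        have hsh : (horiz b l r).shift tl tr k = (0, 0) := by
          simp only [shift]; rw [if_pos ⟨by omega, hc₂⟩]
        rw [hd]
        refine Tot.seq (tot_push (n₁ := 0) (n₂ := 0) hS₁ hsp₁ hp₁.holds (by omega)
          (Exp.ev_lit (by omega)) (fun m => Exp.ev_lit (by omega)) fun m hm₁ hm₂ => ?_)
        refine Tot.asg (n := L.length + I.length + 1) (Exp.ev_add (by simpa [Exp.ev_var] using hn₁)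
          (Exp.ev_lit (by omega)) (by omega)) ?_
        have := hp₁.child hi tl tr hSH hSu (σ' := ((⟨σ₁.v, m⟩ : Store).set .sp (S.length + 1)).set
          .node (L.length + I.length + 1)) hm₂ (by rw [hsh]; exact hm₁) (by simp)
          (by rw [hd]; simp; omega)
          (by rw [hd]; simp [hp₁.acc, top])
        rw [hd] at this
        refine ⟨this, ⟨_, _, sl, hl, by simp only [Store.set_v, if_true]; rw [hlidx], hkl⟩,
          fun y hy => ?_⟩
        rw [← hkeep y hy]
        revert hy; cases y <;> simp [keptVars]
    · have hd : (horiz b l r).descend tl tr k = (r, k - l.headList.length) := by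
        simp only [descend]; rw [if_neg (by omega)]
      have hsh : (horiz b l r).shift tl tr k = (1, l.headList.length) := by
        simp only [shift]; rw [if_neg (by omega)]
      rw [hd]
      refine Tot.seq (tot_push (n₁ := 1) (n₂ := l.headList.length) hS₁ hsp₁ hp₁.holds (by omega)
        (Exp.ev_lit (by omega)) (fun m => (Exp.ev_sub (x := l.headList.length + 1)
          (by simpa [Exp.ev_var] using hsiz) (Exp.ev_lit (by omega)) (by omega)
          (by omega)).trans (by omega)) fun m hm₁ hm₂ => ?_)
      refine Tot.seq (Tot.asg (n := k - l.headList.length + 1) ((Exp.ev_sub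
        (Exp.ev_add (x := k + 1) (by simpa [Exp.ev_var] using hpos) (Exp.ev_lit (by omega))
          (by omega)) (y := l.headList.length + 1) (by simpa [Exp.ev_var] using hsiz) (by omega)
        (by omega)).trans (by omega)) ?_)
      refine Tot.asg (n := σ₁.v .right) (by simp [Exp.ev_var]) ?_
      have := hp₁.child hi tl tr hSH hSu (σ' := (((⟨σ₁.v, m⟩ : Store).set .sp (S.length + 1)).set
        .pos (k - l.headList.length + 1)).set
        .node (σ₁.v .right)) hm₂ (by rw [hsh]; exact hm₁) (by simp)
        (by rw [hd]; simp)
        (by rw [hd]; simp [hp₁.acc, top, hp.cluster.1.2.2.1])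
      rw [hd] at this
      refine ⟨this, ⟨_, _, sr, hrr, by simp only [Store.set_v, if_true]; rw [hridx]; exact hright₁,
        hkr⟩, fun y hy => ?_⟩
      rw [← hkeep y hy]
      revert hy; cases y <;> simp [keptVars]
  · obtain ⟨l, r, rfl⟩ : ∃ l r, t = vert l r := by
      rcases hlab with h' | ⟨b, h'⟩
      · simp only [PTree.label] at hk
        rw [h'] at hk
        obtain ⟨l, r, h₁, -⟩ := key_eq_vert hk.symm
        exact ⟨l, r, h₁⟩
      · simp [h', isHoriz] at hh
    obtain ⟨l', r', h₀, hkl, hkr⟩ := key_eq_vert hk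
    simp only [PTree.label] at h₀
    have hlr : l' = sl.label ∧ r' = sr.label := by
      rcases hlab with h' | ⟨b', h'⟩
      · rw [h'] at h₀; cases h₀; exact ⟨rfl, rfl⟩
      · rw [h'] at h₀; cases h₀
    obtain ⟨rfl, rfl⟩ := hlr
    subst h₀
    have hc₀ : G.IsCluster (vert sl.label sr.label) := h.isCluster_label hs
    have hdep := h.preorderDiff hs
    -- The entry was stored for the representative; equality of the keys of the upper clusters
    -- carries it over to `l`.
    rw [hc₀.localPre_vert, parts_length_of_key hkl] at hdep
    have hdif := h.labelDiff hs
    have hlabel := labelDiff_of_key hp.cluster.1 hc₀.1 hkl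
    set δ := G.label sr.label.top - G.label sl.label.top with hδ
    have hlabr := G.label_le r.top
    have hhead : (vert l r).headList.length = l.parts.1.length + r.headList.length +
        l.parts.2.length := by
      rw [headList_vert]; simp [add_assoc]
    rw [hhead] at hlen
    have hhc := horizCount_le I
    refine Tot.seq (Tot.asg (n := I.length - horizCount I) (Exp.ev_sub (x := I.length)
      (by simp [Exp.ev_var]) e₁ (by omega) (by omega)) ?_)
    refine Tot.seq (Tot.asg (hp.holds.ev_seg (j := 8) (σ := (σ.set .base I.length).set .base
      (I.length - horizCount I)) rfl (e := .var .base) (by simp [Exp.ev_var]) hdep).1 ?_)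
    refine Tot.seq (Tot.asg (hp.holds.ev_seg (j := 9) (σ := ((σ.set .base I.length).set .base
      (I.length - horizCount I)).set .dep (l.parts.1.length + 1)) rfl (e := .var .base)
      (by simp [Exp.ev_var]) hdif).1 ?_)
    set σ₀ := (((σ.set .base I.length).set .base
      (I.length - horizCount I)).set .dep (l.parts.1.length + 1)).set .dif δ with hσ₀
    have F₀ : Frame [.base, .dep, .dif] σ σ₀ := (((Frame.refl.set (by decide) _).set (by decide)
      _).set (by decide) _).set (by decide) _
    refine Tot.seq ((h.tot_sizeOf (N := N) (σ := σ₀) hp.holds hrr (e := .var .right) ?_).mono ?_)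
    · intro σ' hF
      rw [hridx]
      exact (Exp.ev_var _).trans ((hF.2 _ (by decide)).trans
        ((F₀.2 _ (by decide)).trans hright))
    rintro σ₁ ⟨F₂, hsiz⟩
    rw [headList_length_of_key hkr] at hsiz
    have hdep₁ : σ₁.v .dep = l.parts.1.length + 1 := (F₂.2 _ (by decide)).trans (by simp [hσ₀])
    have hdif₁ : σ₁.v .dif = δ := (F₂.2 _ (by decide)).trans (by simp [hσ₀])
    have F := (F₀.trans Frame.refl (Y := [.base, .dep, .dif] ++ sizeVars) (by decide)).trans
      (F₂.trans Frame.refl (Y := [.base, .dep, .dif] ++ sizeVars) (by decide)) (List.Subset.refl _)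
    have hp₁ := hp.of_frame F (by decide) (by decide) (by decide)
    have hS₁ : Stack w σ₁.m S := by rw [F.1]; exact hS
    have hsp₁ : σ₁.v .sp = S.length := (F.2 _ (by decide)).trans hsp
    have hn₁ : σ₁.v .node = L.length + I.length := (F.2 _ (by decide)).trans hn
    have hright₁ := (F.2 .right (by decide)).trans hright
    have hkeep : ∀ y ∈ keptVars, σ₁.v y = σ.v y := fun y hy => F.2 y (by
      revert hy; cases y <;> decide)
    have hpos := hp₁.pos
    have hacc := hp₁.acc
    have htl := Bool.toNat_le tl
    simp only [top] at hacc
    refine Tot.condP (Exp.ev_lt ((Exp.ev_var _).trans hpos) (Exp.ev_add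
      ((Exp.ev_var _).trans hdep₁) (Exp.ev_lit (by omega)) (by omega))) (fun hc₁ => ?_)
      fun hc₁ => ?_
    · have hd : (vert l r).descend tl tr k = (l, k) := by
        simp only [descend]; rw [if_pos (by omega)]
      have hsh : (vert l r).shift tl tr k = (l.parts.1.length + 1, r.headList.length) := by
        simp only [shift]; rw [if_pos (by omega)]
      rw [hd]
      refine Tot.seq (tot_push (n₁ := l.parts.1.length + 1) (n₂ := r.headList.length) hS₁ hsp₁
        hp₁.holds (by omega) ((Exp.ev_var _).trans hdep₁)
        (fun m => (Exp.ev_sub (x := r.headList.length + 1)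
          (by simpa [Exp.ev_var] using hsiz) (Exp.ev_lit (by omega)) (by omega)
          (by omega)).trans (by omega)) fun m hm₁ hm₂ => ?_)
      refine Tot.asg (n := L.length + I.length + 1) (Exp.ev_add (by simpa [Exp.ev_var] using hn₁)
        (Exp.ev_lit (by omega)) (by omega)) ?_
      have := hp₁.child hi tl tr hSH hSu (σ' := ((⟨σ₁.v, m⟩ : Store).set .sp (S.length + 1)).set
        .node (L.length + I.length + 1)) hm₂ (by rw [hsh]; exact hm₁) (by simp)
        (by rw [hd]; simpa using hpos)
        (by rw [hd]; simpa using hacc)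
      rw [hd] at this
      refine ⟨this, ⟨_, _, sl, hl, by simp only [Store.set_v, if_true]; rw [hlidx], hkl⟩,
        fun y hy => ?_⟩
      rw [← hkeep y hy]
      revert hy; cases y <;> simp [keptVars]
    · refine Tot.condP (Exp.ev_lt ((Exp.ev_var _).trans hpos) (Exp.ev_add
        ((Exp.ev_var _).trans hdep₁) ((Exp.ev_var _).trans hsiz) (by omega))) (fun hc₂ => ?_)
        fun hc₂ => ?_
      · have hd : (vert l r).descend tl tr k = (r, k - l.parts.1.length) := by
          simp only [descend]; rw [if_neg (by omega), if_pos (by omega)]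
        have hsh : (vert l r).shift tl tr k = (0, l.parts.1.length) := by
          simp only [shift]; rw [if_neg (by omega), if_pos (by omega)]
        rw [hd]
        refine Tot.seq (tot_push (n₁ := 0) (n₂ := l.parts.1.length) hS₁ hsp₁
          hp₁.holds (by omega) (Exp.ev_lit (by omega))
          (fun m => (Exp.ev_sub (x := l.parts.1.length + 1)
            (by simpa [Exp.ev_var] using hdep₁) (Exp.ev_lit (by omega)) (by omega)
            (by omega)).trans (by omega)) fun m hm₁ hm₂ => ?_)
        refine Tot.seq (Tot.asg (n := k - l.parts.1.length + 1) ((Exp.ev_sub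
          (Exp.ev_add (x := k + 1) (by simpa [Exp.ev_var] using hpos) (Exp.ev_lit (by omega))
            (by omega)) (y := l.parts.1.length + 1) (by simpa [Exp.ev_var] using hdep₁) (by omega)
          (by omega)).trans (by omega)) ?_)
        refine Tot.seq (Tot.asg (n := G.label r.top) ((Exp.ev_add (x := G.label l.top) (y := δ)
          (by simpa [Exp.ev_var] using hacc) (by simpa [Exp.ev_var] using hdif₁)
          (by omega)).trans hlabel.symm) ?_)
        refine Tot.asg (n := σ₁.v .right) (by simp [Exp.ev_var]) ?_
        have := hp₁.child hi tl tr hSH hSu (σ' := ((((⟨σ₁.v, m⟩ : Store).set .sp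
          (S.length + 1)).set .pos (k - l.parts.1.length + 1)).set .acc (G.label r.top)).set
          .node (σ₁.v .right)) hm₂ (by rw [hsh]; exact hm₁) (by simp)
          (by rw [hd]; simp)
          (by rw [hd]; simp)
        rw [hd] at this
        refine ⟨this, ⟨_, _, sr, hrr, by simp only [Store.set_v, if_true]; rw [hridx]; exact hright₁,
          hkr⟩, fun y hy => ?_⟩
        rw [← hkeep y hy]
        revert hy; cases y <;> simp [keptVars]
      · have hd : (vert l r).descend tl tr k = (l, k - r.headList.length) := by
          simp only [descend]; rw [if_neg (by omega), if_neg (by omega)]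
        have hsh : (vert l r).shift tl tr k = (l.parts.1.length + 1, r.headList.length) := by
          simp only [shift]; rw [if_neg (by omega), if_neg (by omega)]
        rw [hd]
        refine Tot.seq (tot_push (n₁ := l.parts.1.length + 1) (n₂ := r.headList.length) hS₁ hsp₁
          hp₁.holds (by omega) ((Exp.ev_var _).trans hdep₁)
          (fun m => (Exp.ev_sub (x := r.headList.length + 1)
            (by simpa [Exp.ev_var] using hsiz) (Exp.ev_lit (by omega)) (by omega)
            (by omega)).trans (by omega)) fun m hm₁ hm₂ => ?_)
        refine Tot.seq (Tot.asg (n := k - r.headList.length + 1) ((Exp.ev_sub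
          (Exp.ev_add (x := k + 1) (by simpa [Exp.ev_var] using hpos) (Exp.ev_lit (by omega))
            (by omega)) (y := r.headList.length + 1) (by simpa [Exp.ev_var] using hsiz) (by omega)
          (by omega)).trans (by omega)) ?_)
        refine Tot.asg (n := L.length + I.length + 1) (Exp.ev_add (by simpa [Exp.ev_var] using hn₁)
          (Exp.ev_lit (by omega)) (by omega)) ?_
        have := hp₁.child hi tl tr hSH hSu (σ' := (((⟨σ₁.v, m⟩ : Store).set .sp (S.length + 1)).set
          .pos (k - r.headList.length + 1)).set
          .node (L.length + I.length + 1)) hm₂ (by rw [hsh]; exact hm₁) (by simp)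
          (by rw [hd]; simp)
          (by rw [hd]; simpa using hacc)
        rw [hd] at this
        refine ⟨this, ⟨_, _, sl, hl, by simp only [Store.set_v, if_true]; rw [hlidx], hkl⟩,
          fun y hy => ?_⟩
        rw [← hkeep y hy]
        revert hy; cases y <;> simp [keptVars]

end ZDD

/-! ## The query programs -/

namespace WordRAM

/-- Start at the root of the unfolded top DAG. -/
def start : Prog :=
  .seq (asg .node (.lit 0)) <|
  .seq (asg .sp (.lit 0)) <|
  .seq (asg .run (.lit 1)) <|
  .seq (asg .pos (.var .inp)) (asg .acc (seg 0 (.lit 1)))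

/-- Descend to a leaf. -/
def walk (tl tr : Bool) : Prog :=
  whileVar .run (.seq resolve (cond (.var .right) (step tl tr) (asg .run (.lit 0))))

/-- Search for the edge with label `b` that leaves the current node, among the complement edges kept
at the current vertex. -/
def visit (b : Bool) : Prog :=
  .seq (asg .lo (tri 13 (.var .node) 2)) <|
  .seq (asg .hi (tri 13 (.var .node + .lit 1) 2)) <|
  search (fun e => .lit 2 * seg 14 e + seg 16 e) (.lit 2 * .var .pos + .lit b.toNat)

/-- Descend until the edge with label `b` is found. -/
def searchWalk (b : Bool) : Prog :=
  whileVar .run (.seq resolve <| .seq (visit b) <|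
    cond (.var .found) (asg .run (.lit 0))
      (cond (.var .right) (step false false) (asg .run (.lit 0))))

/-- Search for the edge with label `b` among those kept at the root. -/
def rootSearch (b : Bool) : Prog :=
  .seq (asg .lo (tri 10 (.var .inp - .lit 1) 2)) <|
  .seq (asg .hi (tri 10 (.var .inp) 2)) <|
  search (seg 12) (.lit b.toNat)

/-- The program for the label of a node. -/
def levelProg : Prog :=
  cond (.eq (seg 0 (.lit 0)) (.lit 1)) (asg .inp (seg 0 (.lit 1))) <|
  .seq start <| .seq (walk false false) <|
  .seq (cond (.eq (.var .pos) (.lit 1)) .skip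
    (asg .acc (.var .acc + seg 5 (.var .cnt - tri 2 (.var .cnt) 1))))
  (asg .inp (.var .acc))

/-- The program for the end point of the edge with label `b`. -/
def edgeProg (b : Bool) : Prog :=
  .seq (rootSearch b) <|
  cond (.var .found) (asg .inp (seg 11 (.var .lo))) <|
  .seq start <| .seq (searchWalk b) <|
  .seq (cond (.var .found) (asg .out (seg 15 (.var .lo)))
    (.seq start <| .seq (walk true b) (asg .out (.lit 2)))) <|
  .seq (cond (.lt (seg 0 (.lit 0)) (.var .out)) .skip unwindProg) (asg .inp (.var .out))

end WordRAM

-- Descent from the root to a leaf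

namespace ZDD

open WordRAM PTree TopTree

variable {V : Type*} [Fintype V] [DecidableEq V] {c : ℕ} {G : ZDD V c}
  {P : PTree (TopTree V)} {w N U H : ℕ} {σ σ' : Store} {x : V} {t T : TopTree V} {k : ℕ}

/-- In the root cluster local and global preorders coincide, so an empty stack is correct. -/
theorem tot_start (hT : P.label = T) (hc : G.IsCluster T)
    (ho : T.localOrder = G.order) (hH : T.height ≤ H) (hσ : Holds w U G.topZDD.segs σ.m)
    (hx : σ.v .inp = G.pre x) :
    Tot w N start σ fun σ' => Path G w U H x T (G.pre x - 1) σ' ∧ NodeAt G P T σ' ∧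
      σ'.v .run = 1 ∧ σ'.v .inp = σ.v .inp := by
  have hlt := hσ.lt
  have htop : T.top = G.root := by
    rw [order_eq] at ho
    exact (List.cons.inj ho).1
  have hpos := G.pre_pos x
  refine Tot.seq (Tot.asg (Exp.ev_lit (by omega)) ?_)
  refine Tot.seq (Tot.asg (Exp.ev_lit (by omega)) ?_)
  refine Tot.seq (Tot.asg (Exp.ev_lit (by omega)) ?_)
  refine Tot.seq (Tot.asg (Exp.ev_var _) ?_)
  refine Tot.asg (n := G.label G.root) (hσ.ev_seg (j := 0) (σ := ((((σ.set .node 0).set .sp 0).set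
    .run 1).set .pos _)) rfl (Exp.ev_lit (by omega)) rfl).1 ?_
  refine ⟨⟨hσ, hc, by rw [ho]; exact G.getElem?_pre x, ?_, ?_, [], trivial, by simp, by simpa,
    fun j z hz => ?_⟩, ⟨[], [], P, .root, by simp, by rw [hT]⟩, by simp, by simp⟩
  · simp [hx]; omega
  · simp [htop]
  · rw [ho] at hz
    exact (G.getElem?_order_pre hz).symm

/-- The property `J` of cluster and position is a parameter: the label query needs none, the query
for a tree edge carries the membership of the edge. The iterations number at most one per level,
plus one that stops at the leaf. -/
theorem IsDag.tot_walk (h : G.IsDag P) (hV : Fintype.card V ≤ U) (hc : c ≤ U) (hH : H ≤ U)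
    {tl tr : Bool} (J : TopTree V → ℕ → Prop)
    (hJ : ∀ t k, G.IsCluster t → t.IsInternal → t.localOrder[k]? = some x → J t k →
      J (t.descend tl tr k).1 (t.descend tl tr k).2)
    (hN : t.height + 1 ≤ N) (hp : Path G w U H x t k σ) (hn : NodeAt G P t σ)
    (hrun : σ.v .run = 1) (h₀ : J t k) :
    Tot w N (walk tl tr) σ fun σ' => ∃ t k, Path G w U H x t k σ' ∧ Resolved G P t σ' ∧
      J t k ∧ ¬t.IsInternal := by
  let I (n : ℕ) (τ : Store) : Prop :=
    (τ.v .run = 1 ∧ ∃ t k, Path G w U H x t k τ ∧ NodeAt G P t τ ∧ J t k ∧ t.height + 1 ≤ n) ∨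
    (τ.v .run = 0 ∧ ∃ t k, Path G w U H x t k τ ∧ Resolved G P t τ ∧ J t k ∧ ¬t.IsInternal)
  refine (Tot.while I ?_ hN (Or.inl ⟨hrun, t, k, hp, hn, h₀, le_rfl⟩)).mono ?_
  · rintro n τ (⟨hrun, t, k, hp, hn, hj, hle⟩ | ⟨h, -⟩) hne
    swap
    · exact (hne h).elim
    have hlt := hp.holds.lt
    refine ⟨t.height, hle, Tot.seq ((h.tot_resolve_path hp hn).mono ?_)⟩
    rintro τ₁ ⟨F, hp₁, hr₁⟩
    refine Tot.cond (Exp.ev_var _) (fun hi => ?_) fun hi => ?_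
    · have hi := (h.resolved_right hr₁).1 hi
      refine (h.tot_step hp₁ hr₁ hi hV hc hH tl tr).mono ?_
      rintro τ₂ ⟨hp₂, hn₂, hk⟩
      exact Or.inl ⟨by rw [hk _ (by decide), F.2 _ (by decide), hrun], _, _, hp₂, hn₂,
        hJ t k hp.cluster hi hp.elem hj, height_descend tl tr k hi⟩
    · have hi := fun h' => hi |> (h.resolved_right hr₁).2 h'
      exact Tot.asg (Exp.ev_lit (by omega)) (Or.inr ⟨by simp, t, k,
        hp₁.of_frame (X := [.run]) (Frame.refl.set (by decide) _) (by decide) (by decide)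
          (by decide),
        hr₁.of_frame (X := [.run]) (Frame.refl.set (by decide) _) (by decide) (by decide)
          (by decide), hj, hi⟩)
  · rintro τ ⟨⟨n, ⟨h, -⟩ | ⟨-, h⟩⟩, h'⟩
    · omega
    · exact h

end ZDD

-- Search for complement edges

namespace ZDD

open WordRAM PTree TopTree

variable {V : Type*} [Fintype V] [DecidableEq V] {c : ℕ} {G : ZDD V c}
  {P : PTree (TopTree V)} {w N U H : ℕ} {σ σ' : Store} {x : V} {t T : TopTree V} {k : ℕ}

/-- The index of an entry of the arrays for the edges kept in vertices other than the root, namely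
of the entry for the edge with label `b` that leaves `x`, in the cluster `t`. -/
def IsEntry (G : ZDD V c) (t : TopTree V) (x : V) (b : Bool) (n : ℕ) : Prop :=
  (x, b) ∈ G.innerEdges t ∧ G.topZDD.dstIn[n]? = some (G.edgeInfo t (x, b)).dst

/-- The block searched is that of the representative; it coincides with the information for `t`, and
starting point together with type identifies an edge. -/
theorem IsDag.tot_visit (h : G.IsDag P) (hp : Path G w U H x t k σ) (hr : Resolved G P t σ)
    (hV : Fintype.card V ≤ U) (hN : (G.innerInfos t).length < 2 ^ N) (b : Bool) :
    Tot w N (visit b) σ fun σ' => Frame searchVars σ σ' ∧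
      ((σ'.v .found = 1 ∧ IsEntry G t x b (σ'.v .lo)) ∨
        (σ'.v .found = 0 ∧ (x, b) ∉ G.innerEdges t)) := by
  have hlt := hp.holds.lt
  have hk₁ : k < Fintype.card V := by
    have h₁ := (List.getElem?_eq_some_iff.1 hp.elem).1
    have h₂ := hp.cluster.length_le
    rw [localOrder_length] at h₁
    omega
  have hb := Bool.toNat_le b
  obtain ⟨L, I, s, hs, hn, hk, hd, -, -⟩ := hr
  obtain ⟨o, y, z, hy, hz, hy₁, hz₁, hent⟩ := h.block hs hd
  rw [innerInfos_of_key hk] at hz₁ hent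
  obtain ⟨-, -, ⟨e₁, b₁⟩, b₀⟩ := hp.holds.ev_tri (j := 13) rfl (e := .var .node) hn hy
  rw [hy₁] at e₁ b₁
  refine Tot.seq (Tot.asg e₁ ?_)
  have F₁ : Frame searchVars σ (σ.set .lo o) := Frame.refl.set (by decide) _
  obtain ⟨-, -, ⟨e₂, b₂⟩, -⟩ := hp.holds.ev_tri (j := 13) (σ := σ.set .lo o) rfl
    (e := .var .node + .lit 1) (Exp.ev_add (x := L.length + I.length) (by simp [Exp.ev_var, hn])
      (Exp.ev_lit (by omega)) (by omega)) hz
  rw [hz₁] at e₂ b₂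
  refine Tot.seq (Tot.asg e₂ ?_)
  have F₂ := F₁.set (x := .hi) (by decide) (o + (G.innerInfos t).length)
  set σ₂ := (σ.set .lo o).set .hi (o + (G.innerInfos t).length) with hσ₂
  refine (tot_search (o := o) (tv := 2 * (k + 1) + b.toNat)
    (K := (G.innerInfos t).map infoKey)
    (List.pairwise_map.2 (pairwise_innerInfos hp.cluster)) (by rw [List.length_map]; omega)
    (by rwa [List.length_map]) (by simp [hσ₂]) (by simp [hσ₂]) ?_ ?_).mono ?_
  · intro τ e m n F he hm
    rw [List.getElem?_map, Option.map_eq_some_iff] at hm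
    obtain ⟨i, hi, rfl⟩ := hm
    have hτ : Holds w U G.topZDD.segs τ.m := by rw [F.1]; exact hp.holds
    obtain ⟨h₁, -, h₂⟩ := hent m i hi
    obtain ⟨v₁, w₁⟩ := hτ.ev_seg (j := 14) rfl he h₁
    obtain ⟨v₂, -⟩ := hτ.ev_seg (j := 16) rfl he (S := G.topZDD.typeIn.map Bool.toNat)
      (v := i.bit.toNat) (by rw [List.getElem?_map, h₂]; rfl)
    have := Bool.toNat_le i.bit
    exact Exp.ev_add (Exp.ev_mul (Exp.ev_lit (by omega)) v₁ (by omega)) v₂ (by omega)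
  · intro τ F
    exact Exp.ev_add (Exp.ev_mul (Exp.ev_lit (by omega)) ((Exp.ev_var _).trans
      ((F.2 _ (by decide)).trans (by simp [hσ₂, hp.pos]))) (by omega)) (Exp.ev_lit (by omega))
      (by omega)
  · rintro τ ⟨F, ⟨hf, m, hm, hlo⟩ | ⟨hf, hm⟩⟩
    · rw [List.getElem?_map, Option.map_eq_some_iff] at hm
      obtain ⟨i, hi, hik⟩ := hm
      obtain ⟨h₁, rfl⟩ := mem_innerEdges_of_infoKey hp.cluster hp.elem (List.mem_of_getElem? hi) hik
      refine ⟨F₂.trans F (List.Subset.refl _), Or.inl ⟨hf, h₁, ?_⟩⟩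
      rw [hlo]
      exact (hent m _ hi).2.1
    · refine ⟨F₂.trans F (List.Subset.refl _), Or.inr ⟨hf, fun he => hm ?_⟩⟩
      exact List.mem_map.2 ⟨_, List.mem_map.2 ⟨_, he, rfl⟩, infoKey_edgeInfo hp.cluster hp.elem b⟩

/-- If an edge leaving `x` is kept in `s`, then `x` is a head of `s`, so `s` lies on the path
towards `x`. The invariant says that such an `s` is still below the current cluster; at a leaf none
can remain unvisited. The position is required to be positive only if the edge is kept somewhere,
which leaves room for the root. -/
theorem IsDag.tot_searchWalk (h : G.IsDag P) (hV : Fintype.card V ≤ U) (hc : c ≤ U) (hH : H ≤ U)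
    (hI : ∀ t : TopTree V, (G.innerInfos t).length < 2 ^ N) (b : Bool)
    (hT : ∀ s ∈ T.vertices, (x, b) ∈ G.innerEdges s → 0 < k)
    (hN : T.height + 1 ≤ N) (hp : Path G w U H x T k σ) (hn : NodeAt G P T σ)
    (hrun : σ.v .run = 1) :
    Tot w N (searchWalk b) σ fun σ' => σ'.v .inp = σ.v .inp ∧ ∃ t k, Path G w U H x t k σ' ∧
      ((σ'.v .found = 1 ∧ IsEntry G t x b (σ'.v .lo)) ∨
        (σ'.v .found = 0 ∧ ∀ s ∈ T.vertices, (x, b) ∉ G.innerEdges s)) := by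
  let I (n : ℕ) (τ : Store) : Prop := τ.v .inp = σ.v .inp ∧ ∃ t k, Path G w U H x t k τ ∧
    ((τ.v .run = 1 ∧ NodeAt G P t τ ∧ t.height + 1 ≤ n ∧
      ∀ s ∈ T.vertices, (x, b) ∈ G.innerEdges s → 0 < k ∧ s ∈ t.vertices) ∨
    (τ.v .run = 0 ∧ ((τ.v .found = 1 ∧ IsEntry G t x b (τ.v .lo)) ∨
        (τ.v .found = 0 ∧ ∀ s ∈ T.vertices, (x, b) ∉ G.innerEdges s))))
  refine (Tot.while I ?_ hN ⟨rfl, T, k, hp, Or.inl ⟨hrun, hn, le_rfl,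
    fun s hs he => ⟨hT s hs he, hs⟩⟩⟩).mono ?_
  · rintro n τ ⟨hinp, t, k, hp, ⟨hrun, hn, hle, hJ⟩ | ⟨h, -⟩⟩ hne
    swap
    · exact (hne h).elim
    have hlt := hp.holds.lt
    refine ⟨t.height, hle, Tot.seq ((h.tot_resolve_path hp hn).mono ?_)⟩
    rintro τ₁ ⟨F, hp₁, hr₁⟩
    refine Tot.seq ((h.tot_visit hp₁ hr₁ hV (hI t) b).mono ?_)
    rintro τ₂ ⟨F₂, hor⟩
    have hinp₂ : τ₂.v .inp = σ.v .inp := by rw [F₂.2 _ (by decide), F.2 _ (by decide), hinp]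
    have hrun₂ : τ₂.v .run = 1 := by rw [F₂.2 _ (by decide), F.2 _ (by decide), hrun]
    have hp₂ := hp₁.of_frame F₂ (by decide) (by decide) (by decide)
    have hr₂ := hr₁.of_frame F₂ (by decide) (by decide) (by decide)
    have F₃ : Frame [.run] τ₂ (τ₂.set .run 0) := Frame.refl.set (by decide) _
    have hp₃ := hp₂.of_frame F₃ (by decide) (by decide) (by decide)
    rcases hor with ⟨hf, he⟩ | ⟨hf, he⟩
    · refine Tot.cond ((Exp.ev_var _).trans hf) (fun _ => ?_) fun h => by simp at h
      exact Tot.asg (Exp.ev_lit (by omega)) ⟨by simpa using hinp₂, t, k, hp₃,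
        Or.inr ⟨by simp, Or.inl ⟨by simpa using hf, by simpa using he⟩⟩⟩
    · refine Tot.cond ((Exp.ev_var _).trans hf) (fun h => by simp at h) fun _ => ?_
      refine Tot.cond (Exp.ev_var _) (fun hi => ?_) fun hi => ?_
      · have hi := (h.resolved_right hr₂).1 hi
        refine (h.tot_step hp₂ hr₂ hi hV hc hH false false).mono ?_
        rintro τ₄ ⟨hp₄, hn₄, hk⟩
        refine ⟨(hk _ (by decide)).trans hinp₂, _, _, hp₄, Or.inl ⟨(hk _ (by decide)).trans hrun₂,
          hn₄, height_descend false false k hi, fun s hs hes => ?_⟩⟩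
        obtain ⟨hk₀, hst⟩ := hJ s hs hes
        exact ⟨descend_head_pos k hi hk₀, mem_vertices_descend hp.cluster.1 hp.cluster.nodup hk₀
          hp.elem hst (fun h => he (h ▸ hes)) (mem_innerEdges hes).1⟩
      · have hi := fun h' => hi |> (h.resolved_right hr₂).2 h'
        refine Tot.asg (Exp.ev_lit (by omega)) ⟨by simpa using hinp₂, t, k, hp₃,
          Or.inr ⟨by simp, Or.inr ⟨by simpa using hf, fun s hs hes => ?_⟩⟩⟩
        have := (hJ s hs hes).2
        cases t with
        | edge u v b' =>
          rw [TopTree.vertices, List.mem_singleton] at this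
          exact he (this ▸ hes)
        | vert l r => exact hi trivial
        | horiz b' l r => exact hi trivial
  · rintro τ ⟨⟨n, hinp, t, k, hp, ⟨h, -⟩ | ⟨-, h⟩⟩, h'⟩
    · omega
    · exact ⟨hinp, t, k, hp, h⟩

theorem tot_rootSearch (hσ : Holds w U G.topZDD.segs σ.m) (hx : σ.v .inp = G.pre x)
    (hV : Fintype.card V ≤ U) (hN : (G.rootBlock x).length < 2 ^ N) (b : Bool) :
    Tot w N (rootSearch b) σ fun σ' => Frame searchVars σ σ' ∧
      ((σ'.v .found = 1 ∧ G.topZDD.dstRoot[σ'.v .lo]? = some (G.code (G.child b x))) ∨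
        (σ'.v .found = 0 ∧ (x, b) ∉ G.rootEdges)) := by
  have hlt := hσ.lt
  have hpos := G.pre_pos x
  have hle := G.pre_le x
  have hb := Bool.toNat_le b
  obtain ⟨o, y, z, hy, hz, hy₁, hz₁, hent⟩ := G.root_block x
  obtain ⟨-, -, ⟨e₁, b₁⟩, b₀⟩ := hσ.ev_tri (j := 10) rfl (e := .var .inp - .lit 1)
    (Exp.ev_sub ((Exp.ev_var _).trans hx) (Exp.ev_lit (by omega)) (by omega) (by omega)) hy
  rw [hy₁] at e₁ b₁
  refine Tot.seq (Tot.asg e₁ ?_)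
  have F₁ : Frame searchVars σ (σ.set .lo o) := Frame.refl.set (by decide) _
  obtain ⟨-, -, ⟨e₂, b₂⟩, -⟩ := hσ.ev_tri (j := 10) (σ := σ.set .lo o) rfl
    (e := .var .inp) (by simp [Exp.ev_var, hx]) hz
  rw [hz₁] at e₂ b₂
  refine Tot.seq (Tot.asg e₂ ?_)
  have F₂ := F₁.set (x := .hi) (by decide) (o + (G.rootBlock x).length)
  refine (tot_search (o := o) (tv := b.toNat) (K := (G.rootBlock x).map fun e => e.2.toNat)
    (List.pairwise_map.2 (G.pairwise_rootBlock x)) (by rw [List.length_map]; omega)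
    (by rwa [List.length_map]) (by simp) (by simp) ?_ ?_).mono ?_
  · intro τ e m n F he hm
    rw [List.getElem?_map, Option.map_eq_some_iff] at hm
    obtain ⟨i, hi, rfl⟩ := hm
    have hτ : Holds w U G.topZDD.segs τ.m := by rw [F.1]; exact hσ
    exact (hτ.ev_seg (j := 12) rfl he (S := G.topZDD.typeRoot.map Bool.toNat)
      (v := i.2.toNat) (by rw [List.getElem?_map, (hent m i hi).2]; rfl)).1
  · intro τ F
    exact Exp.ev_lit (by omega)
  · rintro τ ⟨F, ⟨hf, m, hm, hlo⟩ | ⟨hf, hm⟩⟩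
    · rw [List.getElem?_map, Option.map_eq_some_iff] at hm
      obtain ⟨⟨u, b'⟩, hi, hik⟩ := hm
      obtain rfl : u = x := (mem_rootBlock.1 (List.mem_of_getElem? hi)).1
      obtain rfl : b' = b := by revert hik; cases b <;> cases b' <;> simp
      refine ⟨F₂.trans F (List.Subset.refl _), Or.inl ⟨hf, ?_⟩⟩
      rw [hlo]
      exact (hent m _ hi).1
    · refine ⟨F₂.trans F (List.Subset.refl _), Or.inr ⟨hf, fun he => hm ?_⟩⟩
      exact List.mem_map.2 ⟨_, mem_rootBlock.2 ⟨rfl, he⟩, rfl⟩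

end ZDD

-- Correctness of the query programs

namespace ZDD

open WordRAM PTree TopTree

variable {V : Type*} [Fintype V] [DecidableEq V] {c : ℕ} {G : ZDD V c}
  {P : PTree (TopTree V)} {w N U H : ℕ} {σ σ' : Store} {x : V} {t T : TopTree V} {k : ℕ}

/-- The walk ends at a single edge. At its upper end the accumulated label is the answer; at its
lower end the stored label difference is added. -/
theorem IsDag.tot_levelProg (h : G.IsDag P) (hT : P.label = T) (hc : G.IsCluster T)
    (ho : T.localOrder = G.order) (hTH : T.height ≤ H) (hV : Fintype.card V ≤ U)
    (hcU : c ≤ U) (hH : H ≤ U) (hN : H + 1 ≤ N) (h₁ : Fintype.card V ≠ 1)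
    (hσ : Holds w U G.topZDD.segs σ.m) (hx : σ.v .inp = G.pre x) :
    Tot w N levelProg σ fun σ' => σ'.v .inp = G.label x := by
  have hlt := hσ.lt
  refine Tot.condP (P := Fintype.card V = 1) (Exp.ev_eq (hσ.ev_seg (j := 0) rfl
    (Exp.ev_lit (by omega)) rfl).1 (Exp.ev_lit (by omega))) (fun h => (h₁ h).elim) fun _ => ?_
  refine Tot.seq ((tot_start hT hc ho hTH hσ hx).mono ?_)
  rintro σ₁ ⟨hp₁, hn₁, hr₁, -⟩
  refine Tot.seq ((h.tot_walk hV hcU hH (fun _ _ => True) (fun _ _ _ _ _ _ => trivial)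
    (by omega) hp₁ hn₁ hr₁ trivial).mono ?_)
  rintro σ₂ ⟨t, k, hp, ⟨L, I, s, hs, hn, hk, hd, -, hcnt⟩, -, hi⟩
  have hl := h.labelled.of_at hs
  obtain ⟨u, v, b, rfl⟩ : ∃ u v b, t = edge u v b := by
    cases t with
    | edge u v b => exact ⟨u, v, b, rfl⟩
    | vert l r => exact (hi trivial).elim
    | horiz b l r => exact (hi trivial).elim
  have hlt₂ := hp.holds.lt
  refine Tot.seq (Tot.mono (Q := fun τ => τ.v .acc = G.label x) ?_ fun τ hτ =>
    Tot.asg ((Exp.ev_var _).trans hτ) (by simp))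
  refine Tot.condP (Exp.ev_eq ((Exp.ev_var _).trans hp.pos) (Exp.ev_lit (by omega)))
    (fun hk₀ => ?_) fun hk₀ => ?_
  · obtain rfl : k = 0 := by omega
    have hx := hp.elem
    simp only [localOrder, top, List.getElem?_cons_zero, Option.some.injEq] at hx
    exact Tot.skip (by rw [hp.acc, top, hx])
  · obtain rfl : v = x := by
      have hx := hp.elem
      obtain ⟨k, rfl⟩ : ∃ j, k = j + 1 := ⟨k - 1, by omega⟩
      cases k with
      | zero => simpa [localOrder, headList, parts] using hx
      | succ k => simp [localOrder, headList, parts] at hx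
    obtain ⟨u', v', rfl⟩ : ∃ u' v', s = leaf (edge u' v' b) := by
      obtain ⟨u', v', hs', -⟩ := key_eq_edge hk
      cases s with
      | dummy t => exact (hd t rfl).elim
      | leaf t => exact ⟨u', v', by rw [← hs']; rfl⟩
      | node t l r =>
        simp only [PTree.label] at hs'
        rcases hl.2.2 with h | ⟨b, h⟩ <;> rw [hs'] at h <;> cases h
    have hdiff : G.label v' - G.label u' = G.label v - G.label u := by
      obtain ⟨u'', v'', h, hd⟩ := key_eq_edge hk
      cases h
      exact hd
    have hlab : G.label u < G.label v := G.label_lt hp.cluster.1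
    have hle := G.label_le v
    obtain ⟨B, hL⟩ := hs.leaves
    obtain ⟨d₁, -⟩ := h.ev_dummy hp.holds hL (e := .var .cnt) hcnt
    have hdc := dummyCount_le L
    have hLU := (h.ev_node hp.holds hs (e := .var .node) hn).2.2.2.2.2
    obtain ⟨e, he⟩ := hp.holds.ev_seg (j := 5) rfl (Exp.ev_sub ((Exp.ev_var _).trans hcnt) d₁
      (by omega) (by omega)) (h.labelSpan hs)
    refine Tot.asg (Exp.ev_add ((Exp.ev_var _).trans hp.acc) e ?_) ?_
    · rw [hdiff, top]; omega
    · simp [hdiff, top]; omega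

theorem tot_levelProg_of_card_eq_one (h₁ : Fintype.card V = 1)
    (hσ : Holds w U G.topZDD.segs σ.m) :
    Tot w N levelProg σ fun σ' => σ'.v .inp = G.label x := by
  have hlt := hσ.lt
  have hx : x = G.root := (Fintype.card_le_one_iff.1 h₁.le) _ _
  refine Tot.condP (P := Fintype.card V = 1) (Exp.ev_eq (hσ.ev_seg (j := 0) rfl
    (Exp.ev_lit (by omega)) rfl).1 (Exp.ev_lit (by omega))) (fun _ => ?_) fun h => (h h₁).elim
  exact Tot.asg (hσ.ev_seg (j := 0) rfl (Exp.ev_lit (by omega)) rfl).1 (by simp [hx])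

/-- A complement edge kept in no cluster is, by definition, in the root, so an unsuccessful search
leaves only tree edges. -/
theorem mem_treeEdges {b : Bool} (h : (x, b) ∉ G.rootEdges)
    (h' : ∀ s ∈ G.clusters, (x, b) ∉ G.innerEdges s) : (x, b) ∈ G.treeEdges := by
  by_contra hn
  refine h (List.mem_filter.2 ⟨G.mem_complementEdges.2 hn, ?_⟩)
  simpa using fun s hs => h' s hs

/-- The local number of the end point of an edge, with which the descent ends. -/
theorem Path.exists_dst {b : Bool} (hp : Path G w U H x t k σ) (he : (x, b) ∈ G.innerEdges t) :
    (Fintype.card V < (G.edgeInfo t (x, b)).dst ∧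
      (G.edgeInfo t (x, b)).dst = G.code (G.child b x)) ∨
    ∃ j y, t.localOrder[j]? = some y ∧ (G.edgeInfo t (x, b)).dst = j + 1 ∧
      G.child b x = Sum.inl y := by
  rcases hy : G.child b x with y | τ
  · obtain ⟨j, -, hj⟩ := exists_position ((mem_innerEdges he).2 y hy)
    exact Or.inr ⟨j, y, hj, by simp [edgeInfo, hy, hp.cluster.localPre hj], rfl⟩
  · refine Or.inl ⟨?_, by simp [edgeInfo, hy, code]⟩
    simp only [edgeInfo, hy, terminalCode]
    split_ifs <;> omega

/-- Terminal codes exceed the number of branching nodes and local preorders do not, so one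
comparison with the header decides whether the stack has to be unwound. -/
theorem Path.tot_finish (hp : Path G w U H x t k σ) (hV : Fintype.card V ≤ U) (hH : H ≤ U)
    (hN : H ≤ N) {z : V ⊕ Bool}
    (h : (Fintype.card V < σ.v .out ∧ σ.v .out = G.code z) ∨
      ∃ j y, t.localOrder[j]? = some y ∧ σ.v .out = j + 1 ∧ z = Sum.inl y) :
    Tot w N (.seq (cond (.lt (seg 0 (.lit 0)) (.var .out)) .skip unwindProg)
      (asg .inp (.var .out))) σ fun σ' => σ'.v .inp = G.code z := by
  have hlt := hp.holds.lt
  refine Tot.seq (Tot.mono (Q := fun τ => τ.v .out = G.code z) ?_ fun τ hτ =>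
    Tot.asg ((Exp.ev_var _).trans hτ) (by simp))
  refine Tot.condP (P := Fintype.card V < σ.v .out) (Exp.ev_lt (hp.holds.ev_seg (j := 0) rfl
    (Exp.ev_lit (by omega)) rfl).1 (Exp.ev_var _)) (fun hc => ?_) fun hc => ?_
  · rcases h with ⟨-, h⟩ | ⟨j, y, hj, ho, -⟩
    · exact Tot.skip h
    · have h₁ := (List.getElem?_eq_some_iff.1 hj).1
      have h₂ := hp.cluster.length_le
      rw [localOrder_length] at h₁
      omega
  · rcases h with ⟨h, -⟩ | ⟨j, y, hj, ho, rfl⟩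
    · exact (hc h).elim
    obtain ⟨S, hS, hsp, hSH, hu⟩ := hp.stack
    have : G.code (Sum.inl y) ≤ Fintype.card V := G.pre_le y
    exact tot_unwind hS hsp (by omega) (by omega) (by omega) hlt (by rw [ho, hu j y hj]; rfl)

/-- The three places for an edge are tried in turn: the root, the vertices on the descent, the
spanning tree. Failure of the first two is the hypothesis needed for the third. -/
theorem IsDag.tot_edgeProg (h : G.IsDag P) (hT : P.label = T) (hTt : G.topTree = some T)
    (hc : G.IsCluster T)
    (ho : T.localOrder = G.order) (hTH : T.height ≤ H) (hV : Fintype.card V ≤ U)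
    (hcU : c ≤ U) (hH : H ≤ U) (hN : H + 1 ≤ N)
    (hI : ∀ t : TopTree V, (G.innerInfos t).length < 2 ^ N) (hR : (G.rootBlock x).length < 2 ^ N)
    (hσ : Holds w U G.topZDD.segs σ.m) (hx : σ.v .inp = G.pre x) (b : Bool) :
    Tot w N (edgeProg b) σ fun σ' => σ'.v .inp = G.code (G.child b x) := by
  have hlt := hσ.lt
  refine Tot.seq ((tot_rootSearch hσ hx hV hR b).mono ?_)
  rintro σ₁ ⟨F, ⟨hf, hdst⟩ | ⟨hf, hroot⟩⟩
  · have hσ₁ : Holds w U G.topZDD.segs σ₁.m := by rw [F.1]; exact hσ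
    refine Tot.cond ((Exp.ev_var _).trans hf) (fun _ => ?_) fun h => by simp at h
    exact Tot.asg (hσ₁.ev_seg (j := 11) rfl (Exp.ev_var _) hdst).1 (by simp)
  have hσ₁ : Holds w U G.topZDD.segs σ₁.m := by rw [F.1]; exact hσ
  have hx₁ : σ₁.v .inp = G.pre x := (F.2 _ (by decide)).trans hx
  refine Tot.cond ((Exp.ev_var _).trans hf) (fun h => by simp at h) fun _ => ?_
  refine Tot.seq ((tot_start hT hc ho hTH hσ₁ hx₁).mono ?_)
  rintro σ₂ ⟨hp₂, hn₂, hr₂, hx₂⟩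
  -- A head is never the root of the spanning tree, so its position is not 0.
  have hk : ∀ s ∈ T.vertices, (x, b) ∈ G.innerEdges s → 0 < G.pre x - 1 := by
    intro s hs he
    obtain ⟨j, hj, hxj⟩ := exists_position (headList_subset hs (mem_innerEdges he).1)
    rw [ho] at hxj
    have : G.pre x = j + 1 := G.getElem?_order_pre hxj
    omega
  refine Tot.seq ((h.tot_searchWalk hV hcU hH hI b hk (by omega) hp₂ hn₂ hr₂).mono ?_)
  rintro σ₃ ⟨hx₃, t, k, hp₃, ⟨hf, he, hdst⟩ | ⟨hf, hno⟩⟩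
  · obtain ⟨e, -⟩ := hp₃.holds.ev_seg (j := 15) rfl (Exp.ev_var .lo) hdst
    refine Tot.seq (Tot.cond ((Exp.ev_var _).trans hf) (fun _ => ?_) fun h => by simp at h)
    refine Tot.asg e ?_
    have hp₄ := hp₃.of_frame (X := [.out]) (Frame.refl.set (x := .out) (by decide)
      (G.edgeInfo t (x, b)).dst) (by decide) (by decide) (by decide)
    exact hp₄.tot_finish hV hH (by omega) (by simpa using hp₃.exists_dst he)
  · refine Tot.seq (Tot.cond ((Exp.ev_var _).trans hf) (fun h => by simp at h) fun _ => ?_)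
    have hmem : (x, b) ∈ T.edges := by
      have := mem_treeEdges hroot (by simpa [clusters, hTt] using hno)
      simpa [treeEdges, hTt] using this
    refine Tot.seq ((tot_start hT hc ho hTH hp₃.holds (hx₃.trans (hx₂.trans hx₁))).mono ?_)
    rintro σ₄ ⟨hp₄, hn₄, hr₄, -⟩
    refine Tot.seq ((h.tot_walk hV hcU hH (tl := true) (tr := b) (fun t _ => (x, b) ∈ t.edges)
      (fun t k ht _ hx he => mem_edges_descend ht.1 ht.nodup hx he) (by omega) hp₄ hn₄ hr₄
      hmem).mono ?_)
    rintro σ₅ ⟨t, k, hp, -, he, hi⟩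
    have hlt₅ := hp.holds.lt
    -- In a single-edge cluster the lower end has local preorder 2, and it is the end point sought.
    refine Tot.asg (Exp.ev_lit (by omega)) ?_
    have hp₆ := hp.of_frame (X := [.out]) (Frame.refl.set (x := .out) (by decide) 2)
      (by decide) (by decide) (by decide)
    refine hp₆.tot_finish hV hH (by omega) (Or.inr ?_)
    cases t with
    | edge u v b' =>
      simp only [TopTree.edges, List.mem_singleton, Prod.mk.injEq] at he
      obtain ⟨rfl, rfl⟩ := he
      exact ⟨1, v, rfl, by simp, hp.cluster.1⟩
    | vert l r => exact (hi trivial).elim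
    | horiz b' l r => exact (hi trivial).elim

/-- Without a top tree there are neither clusters nor tree edges, so every edge is found in the
root. -/
theorem tot_edgeProg_of_card_eq_one (h₁ : Fintype.card V = 1)
    (hR : (G.rootBlock x).length < 2 ^ N)
    (hσ : Holds w U G.topZDD.segs σ.m) (hx : σ.v .inp = G.pre x) (hV : Fintype.card V ≤ U)
    (b : Bool) :
    Tot w N (edgeProg b) σ fun σ' => σ'.v .inp = G.code (G.child b x) := by
  have hno := topTree_eq_none (G := G) h₁
  refine Tot.seq ((tot_rootSearch hσ hx hV hR b).mono ?_)
  rintro σ₁ ⟨F, ⟨hf, hdst⟩ | ⟨hf, hroot⟩⟩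
  · have hσ₁ : Holds w U G.topZDD.segs σ₁.m := by rw [F.1]; exact hσ
    refine Tot.cond ((Exp.ev_var _).trans hf) (fun _ => ?_) fun h => by simp at h
    exact Tot.asg (hσ₁.ev_seg (j := 11) rfl (Exp.ev_var _) hdst).1 (by simp)
  · have := mem_treeEdges hroot (by simp [clusters, hno])
    simp [treeEdges, hno] at this

end ZDD

/-! ## Size bounds -/

namespace ZDD

open WordRAM PTree TopTree

variable {V : Type*} [Fintype V] [DecidableEq V] {c : ℕ} (G : ZDD V c)

theorem length_complementEdges_le : G.complementEdges.length ≤ 2 * Fintype.card V := by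
  refine (List.length_filter_le _ _).trans ?_
  rw [List.length_flatMap]
  simp [length_order, mul_comm]

theorem length_innerEdges_le (t : TopTree V) :
    (G.innerEdges t).length ≤ 2 * Fintype.card V :=
  (innerEdges_sublist t).length_le.trans G.length_complementEdges_le

theorem length_rootEdges_le : G.rootEdges.length ≤ 2 * Fintype.card V :=
  (List.length_filter_le _ _).trans G.length_complementEdges_le

theorem length_rootBlock_le (x : V) : (G.rootBlock x).length ≤ 2 := List.length_filter_le _ _

/-- If there are at least two branching nodes, the top tree and the unfolded top DAG exist. -/
theorem exists_topTree_dag (h : Fintype.card V ≠ 1) : ∃ T P, G.topTree = some T ∧ G.IsCluster T ∧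
    T.localOrder = G.order ∧ T.height ≤ 4 * Nat.log 2 (Fintype.card V) ∧ G.IsDag P ∧
    P.label = T ∧ P.vertices.length ≤ 2 * Fintype.card V := by
  obtain ⟨T, hT, hw, ho, hh⟩ := G.exists_topTree h
  have hc : G.IsCluster T := ⟨hw, ho ▸ List.Sublist.refl _⟩
  obtain ⟨P, hP, hl, hv⟩ := exists_dag hT hc
  have h₁ := TopTree.length_vertices T
  have h₂ := hc.length_le
  exact ⟨T, P, hT, hc, ho, hh, hP, hl, by omega⟩

theorem length_dag_le : G.dagVertices.length ≤ 2 * Fintype.card V ∧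
    G.dagLeaves.length ≤ 2 * Fintype.card V ∧ G.dagInternals.length ≤ 2 * Fintype.card V ∧
    G.topZDD.bp.length ≤ 4 * Fintype.card V := by
  by_cases h : Fintype.card V = 1
  · simp [dagVertices, dagLeaves, dagInternals, topZDD, dagTree, G.topTree_eq_none h]
  · obtain ⟨T, P, -, -, -, -, hP, -, hv⟩ := G.exists_topTree_dag h
    have h₁ := PTree.length_vertices P
    rw [hP.dagVertices, hP.dagLeaves, hP.dagInternals]
    have : G.topZDD.bp = P.bp := by simp [topZDD, hP.eq]
    rw [this, PTree.length_bp]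
    omega

theorem sum_map_le_mul {α : Type*} (f : α → ℕ) (l : List α) {n : ℕ} (h : ∀ a ∈ l, f a ≤ n) :
    (l.map f).sum ≤ l.length * n := by
  have := List.sum_le_card_nsmul (l.map f) n (by simpa using h)
  simpa using this

/-- A quadratic bound is enough here, as only the logarithm of the memory size enters the word
length. -/
theorem length_storedEdges_le : G.storedEdges.length ≤ 4 * Fintype.card V ^ 2 := by
  rw [storedEdges, List.length_flatMap]
  refine (sum_map_le_mul _ _ (n := 2 * Fintype.card V) fun p _ => ?_).trans ?_
  · have := G.length_innerEdges_le p.2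
    split_ifs
    · simp
    · simpa
  · have := G.length_dag_le.1
    nlinarith

theorem localPre_le (t : TopTree V) (x : V) : G.localPre t x ≤ Fintype.card V :=
  Finset.card_le_univ _

theorem dst_le (t : TopTree V) (e : V × Bool) :
    (G.edgeInfo t e).dst ≤ Fintype.card V + 2 := by
  rcases h : G.child e.2 e.1 with y | τ
  · simp only [edgeInfo, h]
    exact (G.localPre_le t y).trans (by omega)
  · simp only [edgeInfo, h, terminalCode]
    split_ifs <;> omega

theorem code_le (z : V ⊕ Bool) : G.code z ≤ Fintype.card V + 2 := by
  rcases z with y | τ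
  · exact (G.pre_le y).trans (by omega)
  · simp only [code, terminalCode]
    split_ifs <;> omega

/-- All arrays are short and have small entries. -/
theorem segs_le {q : ℕ} (hb : Fintype.card V ≤ q) (hb2 : Fintype.card V ^ 2 ≤ q) (hc : c ≤ q)
    (h₁ : 1 ≤ q) : ∀ S ∈ G.topZDD.segs, S.length ≤ 30 * q ∧ ∀ z ∈ S, z ≤ 30 * q := by
  obtain ⟨hv, hl, hi, hbp⟩ := G.length_dag_le
  have hdum : G.dagDummies.length ≤ 2 * Fintype.card V := by
    rw [dagDummies, List.length_map]
    exact (List.length_filter_le _ _).trans hl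
  have hst := G.length_storedEdges_le
  have hre := G.length_rootEdges_le
  have hlab := G.label_le
  -- The largest length bound used is `2 * b + 4 * b ^ 2` bits, for `bEdge`, with `b` branching
  -- nodes; `9 * q` leaves room, and `3 * (9 * q + 1) ≤ 30 * q`.
  have bits : ∀ B : List Bool, B.length ≤ 9 * q → (bvEnc B).length ≤ 30 * q ∧
      ∀ z ∈ bvEnc B, z ≤ 30 * q := by
    intro B hB
    obtain ⟨h₂, h₃⟩ := bvEnc_le B
    exact ⟨by omega, fun z hz => (h₃ z hz).trans (by omega)⟩
  have nats : ∀ B : List Bool, B.length ≤ 9 * q → (B.map Bool.toNat).length ≤ 30 * q ∧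
      ∀ z ∈ B.map Bool.toNat, z ≤ 30 * q := by
    intro B hB
    refine ⟨by rw [List.length_map]; omega, fun z hz => ?_⟩
    obtain ⟨b, -, rfl⟩ := List.mem_map.1 hz
    have := Bool.toNat_le b
    omega
  have hfil : ∀ {α β : Type _} (f : α → Option β) (l : List α) {n}, l.length ≤ n →
      (l.filterMap f).length ≤ n := fun f l n h => (List.length_filterMap_le f l).trans h
  simp only [TopZDD.segs, List.forall_mem_cons]
  refine ⟨?_, ?_, bits _ ?_, ?_, ?_, ?_, nats _ ?_, bits _ ?_, ?_, ?_, bits _ ?_, ?_, nats _ ?_,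
    bits _ ?_, ?_, ?_, nats _ ?_, by simp⟩
  · refine ⟨by simp [topZDD]; omega, ?_⟩
    have := hlab G.root
    simp only [topZDD, List.forall_mem_cons]
    exact ⟨by omega, by omega, by simp⟩
  · obtain ⟨h₂, h₃⟩ := bpEnc_le G.topZDD.bp
    exact ⟨by omega, fun z hz => (h₃ z hz).trans (by omega)⟩
  · simp only [topZDD, List.length_map]; omega
  · refine ⟨by simp only [topZDD, List.length_map, List.length_range]; omega, fun z hz => ?_⟩
    obtain ⟨i, -, rfl⟩ := List.mem_map.1 hz
    refine (sum_map_le_mul _ _ (n := Fintype.card V) fun t _ => Finset.card_le_univ _).trans ?_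
    have : (G.dagDummies.take (i + 1)).length ≤ 2 * Fintype.card V :=
      (List.length_take_le' _ _).trans hdum
    nlinarith
  · refine ⟨by simp only [topZDD, List.length_map]; omega, fun z hz => ?_⟩
    obtain ⟨t, -, rfl⟩ := List.mem_map.1 hz
    have := List.findIdx_le_length (xs := G.dagVertices)
      (p := fun p => !p.1 && decide (G.key p.2 = G.key t))
    rw [dagPre]
    omega
  · refine ⟨hfil _ _ (by omega), fun z hz => ?_⟩
    obtain ⟨⟨d, t⟩, -, h⟩ := List.mem_filterMap.1 hz
    split at h
    · cases h
      exact (Nat.sub_le _ _).trans ((hlab _).trans (by omega))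
    · cases h
  · exact hfil _ _ (by omega)
  · simp only [topZDD, List.length_map]; omega
  · refine ⟨hfil _ _ (by omega), fun z hz => ?_⟩
    obtain ⟨t, -, h⟩ := List.mem_filterMap.1 hz
    split at h
    · cases h
      exact (G.localPre_le _ _).trans (by omega)
    · cases h
  · refine ⟨hfil _ _ (by omega), fun z hz => ?_⟩
    obtain ⟨t, -, h⟩ := List.mem_filterMap.1 hz
    split at h
    · cases h
      exact (Nat.sub_le _ _).trans ((hlab _).trans (by omega))
    · cases h
  · simp only [topZDD, length_flatMap_unary, length_order]
    have := sum_map_le_mul (fun u => G.rootEdges.countP fun e => e.1 = u) G.order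
      (n := 2 * Fintype.card V) fun u _ => List.countP_le_length.trans hre
    rw [length_order] at this
    nlinarith
  · refine ⟨by simp only [topZDD, List.length_map]; omega, fun z hz => ?_⟩
    obtain ⟨e, -, rfl⟩ := List.mem_map.1 hz
    exact (G.code_le _).trans (by omega)
  · simp only [topZDD, List.length_map]; omega
  · simp only [topZDD, length_flatMap_unary]
    have := sum_map_le_mul (fun p : Bool × TopTree V => if p.1 then 0 else
      (G.innerEdges p.2).length) G.dagVertices (n := 2 * Fintype.card V) fun p _ => by
        have := G.length_innerEdges_le p.2
        split_ifs <;> omega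
    nlinarith
  · refine ⟨by simp only [topZDD, List.length_map]; omega, fun z hz => ?_⟩
    obtain ⟨e, -, rfl⟩ := List.mem_map.1 hz
    exact (G.localPre_le _ _).trans (by omega)
  · refine ⟨by simp only [topZDD, List.length_map]; omega, fun z hz => ?_⟩
    obtain ⟨e, -, rfl⟩ := List.mem_map.1 hz
    exact (G.dst_le _ _).trans (by omega)
  · simp only [topZDD, List.length_map]; omega

/-- The `0`-edge of a node with maximal label ends in a terminal. Hence the size is at least 2 and
its logarithm at least 1, which lets additive constants be absorbed. -/
theorem card_lt_size : Fintype.card V < G.size := by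
  obtain ⟨v, -, hv⟩ := Finset.exists_max_image Finset.univ G.label ⟨G.root, Finset.mem_univ _⟩
  rw [size, Nat.lt_add_right_iff_pos, Finset.card_pos]
  rcases h : G.zero v with u | τ
  · have := G.ordered_zero v u h
    have := hv u (Finset.mem_univ _)
    omega
  · exact ⟨τ, by simpa using ⟨v, Or.inl h⟩⟩

/-- The initial memory. -/
theorem holds_initial {w : ℕ} (hw : 21 * Nat.log 2 (G.size + c) ≤ w) :
    ∃ U, Fintype.card V ≤ U ∧ c ≤ U ∧ 4 * Nat.log 2 (Fintype.card V) ≤ U ∧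
      Holds w U G.topZDD.segs fun i => (G.topZDD.memory bvEnc bpEnc).getD i 0 % 2 ^ w := by
  set q := (Fintype.card V + c) ^ 2 with hq
  have hb := G.card_pos
  have hc₁ : 1 ≤ c := (G.one_le_label G.root).trans (G.label_le G.root)
  have hq₁ : Fintype.card V ≤ q := by nlinarith
  have hq₂ : c ≤ q := by nlinarith
  have hq₃ : Fintype.card V ^ 2 ≤ q := Nat.pow_le_pow_left (Nat.le_add_right _ _) 2
  have hS := G.segs_le hq₁ hq₃ hq₂ (by omega)
  have hlog : Nat.log 2 (Fintype.card V) ≤ Fintype.card V := (Nat.log_lt_self 2 hb.ne').le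
  have hlen : (layout G.topZDD.segs).length ≤ 600 * q := by
    have h₁ := sum_map_le_mul List.length G.topZDD.segs (n := 30 * q) fun S h => (hS S h).1
    have h₂ : G.topZDD.segs.length = 17 := rfl
    rw [layout, List.length_append, List.length_flatten, List.length_map, List.length_range]
    rw [h₂] at h₁ ⊢
    omega
  -- Origin of 21: the left side is below `2 ^ 17 * q`. With `l` the logarithm of `G.size + c`, `q`
  -- is at most `2 ^ (2 * (l + 1))`, and `17 + 2 * (l + 1) ≤ 21 * l` because `l ≥ 1`.
  have hlt : 100 * (600 * q + 1) < 2 ^ w := by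
    have hn := G.card_lt_size
    have h₁ : 1 ≤ Nat.log 2 (G.size + c) := Nat.log_pos (by norm_num) (by omega)
    have h₂ : G.size + c < 2 ^ (Nat.log 2 (G.size + c) + 1) := Nat.lt_pow_succ_log_self (by norm_num) _
    have h₃ : q ≤ (2 ^ (Nat.log 2 (G.size + c) + 1)) ^ 2 :=
      Nat.pow_le_pow_left (by omega) 2
    calc 100 * (600 * q + 1) < 2 ^ 17 * q := by omega
      _ ≤ 2 ^ 17 * (2 ^ (Nat.log 2 (G.size + c) + 1)) ^ 2 := Nat.mul_le_mul_left _ h₃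
      _ = 2 ^ (17 + (Nat.log 2 (G.size + c) + 1) * 2) := by rw [← pow_mul, ← pow_add]
      _ ≤ 2 ^ w := Nat.pow_le_pow_right (by norm_num) (by omega)
  have hle : ∀ z ∈ layout G.topZDD.segs, z ≤ 600 * q :=
    forall_mem_layout (fun n hn => hn.trans hlen) fun S h z hz =>
      ((hS S h).2 z hz).trans (by omega)
  refine ⟨600 * q, by omega, by omega, by omega, fun i v hi => ?_, hlen, hle, hlt⟩
  have hv := hle v (List.mem_of_getElem? hi)
  have : (G.topZDD.memory bvEnc bpEnc)[i]? = some v := hi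
  rw [List.getD_eq_getElem?_getD, this, Option.getD_some, Nat.mod_eq_of_lt (by omega)]

/-- The number of iterations of the loops. -/
theorem exists_bounds : 4 * Nat.log 2 (Fintype.card V) + 1 ≤ 5 * Nat.log 2 G.size ∧
    2 * Fintype.card V < 2 ^ (5 * Nat.log 2 G.size) ∧ 1 ≤ Nat.log 2 G.size := by
  have hn := G.card_lt_size
  have hb := G.card_pos
  have h₁ : 1 ≤ Nat.log 2 G.size := Nat.log_pos (by norm_num) (by omega)
  have h₂ : Nat.log 2 (Fintype.card V) ≤ Nat.log 2 G.size := Nat.log_mono_right hn.le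
  -- The same number serves all loops: it exceeds the height of the top tree, and as an exponent it
  -- covers the blocks of at most `2 * Fintype.card V` entries.
  refine ⟨by omega, ?_, h₁⟩
  have h₃ : G.size < 2 ^ (Nat.log 2 G.size + 1) := Nat.lt_pow_succ_log_self (by norm_num) _
  calc 2 * Fintype.card V < 2 * 2 ^ (Nat.log 2 G.size + 1) := by omega
    _ = 2 ^ (Nat.log 2 G.size + 2) := by rw [pow_succ 2 (_ + 1)]; ring
    _ ≤ _ := Nat.pow_le_pow_right (by norm_num) (by omega)

theorem answers_levelProg {w : ℕ} (hw : 21 * Nat.log 2 (G.size + c) ≤ w) (x : V) :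
    Answers w levelProg (G.topZDD.memory bvEnc bpEnc) (G.pre x) (G.label x)
      (cost (5 * Nat.log 2 G.size) levelProg) := by
  obtain ⟨U, hV, hc, hH, hσ⟩ := G.holds_initial hw
  obtain ⟨hN, -, -⟩ := G.exists_bounds
  have hx : G.pre x % 2 ^ w = G.pre x :=
    Nat.mod_eq_of_lt (by have := G.pre_le x; have := hσ.lt; omega)
  refine Tot.answers ?_ le_rfl
  by_cases h₁ : Fintype.card V = 1
  · exact tot_levelProg_of_card_eq_one h₁ hσ
  · obtain ⟨T, P, -, hcl, ho, hh, hP, hl, -⟩ := G.exists_topTree_dag h₁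
    exact hP.tot_levelProg hl hcl ho hh hV hc hH hN h₁ hσ (by simpa using hx)

theorem answers_edgeProg {w : ℕ} (hw : 21 * Nat.log 2 (G.size + c) ≤ w) (x : V) (b : Bool) :
    Answers w (edgeProg b) (G.topZDD.memory bvEnc bpEnc) (G.pre x) (G.code (G.child b x))
      (cost (5 * Nat.log 2 G.size) (edgeProg b)) := by
  obtain ⟨U, hV, hc, hH, hσ⟩ := G.holds_initial hw
  obtain ⟨hN, hN₂, -⟩ := G.exists_bounds
  have hx : G.pre x % 2 ^ w = G.pre x :=
    Nat.mod_eq_of_lt (by have := G.pre_le x; have := hσ.lt; omega)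
  have hb := G.card_pos
  have hR : (G.rootBlock x).length < 2 ^ (5 * Nat.log 2 G.size) :=
    (G.length_rootBlock_le x).trans_lt (by omega)
  refine Tot.answers ?_ le_rfl
  by_cases h₁ : Fintype.card V = 1
  · exact tot_edgeProg_of_card_eq_one h₁ hR hσ (by simpa using hx) hV b
  · obtain ⟨T, P, hT, hcl, ho, hh, hP, hl, -⟩ := G.exists_topTree_dag h₁
    refine hP.tot_edgeProg hl hT hcl ho hh hV hc hH hN (fun t => ?_) hR hσ (by simpa using hx) b
    rw [innerInfos, List.length_map]
    exact (G.length_innerEdges_le t).trans_lt hN₂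

/-- The factor 5 in the number of iterations moves into the constant as `5 ^ d`. -/
theorem cost_le_mul (p : Prog) {d K : ℕ} (hd : loopDepth p = d) (hK : coeff p * 5 ^ d ≤ K) :
    cost (5 * Nat.log 2 G.size) p ≤ K * Nat.log 2 G.size ^ d := by
  have h := G.exists_bounds.2.2
  refine (cost_le (by omega) p).trans ?_
  rw [hd, mul_pow, ← mul_assoc]
  exact Nat.mul_le_mul_right _ hK

end ZDD

-- Conclusion

theorem WordRAM.Answers.mono {w x y T T' : ℕ} {p : WordRAM.Prog} {data : List ℕ}
    (h : Answers w p data x y T) (hT : T ≤ T') : Answers w p data x y T' :=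
  let ⟨t, s, r, ht, h⟩ := h
  ⟨t, s, r, ht.trans hT, h⟩

theorem mainTheorem2 :
    ∃ (bvEnc bpEnc : List Bool → List ℕ) (levelProg zeroProg oneProg : WordRAM.Prog) (a K : ℕ),
      LinearSpace bvEnc ∧ LinearSpace bpEnc ∧
      ∀ (V : Type*) [Fintype V] [DecidableEq V] (c : ℕ) (G : ZDD V c) (w : ℕ),
        a * Nat.log 2 (G.size + c) ≤ w →
        ∀ x : V,
          WordRAM.Answers w levelProg (G.topZDD.memory bvEnc bpEnc) (G.pre x)
            (G.label x) (K * Nat.log 2 G.size) ∧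
          WordRAM.Answers w zeroProg (G.topZDD.memory bvEnc bpEnc) (G.pre x)
            (G.code (G.zero x)) (K * Nat.log 2 G.size ^ 2) ∧
          WordRAM.Answers w oneProg (G.topZDD.memory bvEnc bpEnc) (G.pre x)
            (G.code (G.one x)) (K * Nat.log 2 G.size ^ 2) := by
  -- The constants are abstracted to variables to keep arithmetic from evaluating the programs. The
  -- exponents are their loop depths: 1 for a plain walk, 2 for binary search within a walk.
  obtain ⟨K₁, h₁⟩ : ∃ K, WordRAM.coeff WordRAM.levelProg * 5 ^ 1 = K := ⟨_, rfl⟩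
  obtain ⟨K₂, h₂⟩ : ∃ K, WordRAM.coeff (WordRAM.edgeProg false) * 5 ^ 2 = K := ⟨_, rfl⟩
  obtain ⟨K₃, h₃⟩ : ∃ K, WordRAM.coeff (WordRAM.edgeProg true) * 5 ^ 2 = K := ⟨_, rfl⟩
  refine ⟨_root_.bvEnc, _root_.bpEnc, WordRAM.levelProg, WordRAM.edgeProg false, WordRAM.edgeProg true, 21,
    K₁ + K₂ + K₃, ⟨3, bvEnc_le⟩, ⟨3, bpEnc_le⟩, fun V _ _ c G w hw x => ⟨?_, ?_, ?_⟩⟩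
  · have := G.cost_le_mul WordRAM.levelProg (d := 1) (K := K₁ + K₂ + K₃) (by decide) (by omega)
    rw [pow_one] at this
    exact (G.answers_levelProg hw x).mono this
  · exact (G.answers_edgeProg hw x false).mono
      (G.cost_le_mul _ (d := 2) (K := K₁ + K₂ + K₃) (by decide) (by omega))
  · exact (G.answers_edgeProg hw x true).mono
      (G.cost_le_mul _ (d := 2) (K := K₁ + K₂ + K₃) (by decide) (by omega))
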